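/- **Setting.** An instance consists of a connected undirected graph $G$ on $n$ nodes with nonnegative real edge lengths, $m$ packages given by source--target pairs $(s_j,t_j)$ of nodes, and $k\ge 2$ agents at pairwise distinct starting nodes $p_1,\dots,p_k$. A schedule is a finite sequence of actions; in each action one agent moves along an edge, picks up a package lying at its current node, or drops a package that it carries at its current node; an agent carries at most one package at a time. A solution $x$ is a schedule that brings every package $j$ from $s_j$ to $t_j$. Let $d_i(x)$ be the total distance travelled by agent $i$, and for weights $w\in\mathbb R_{\ge 0}^k$ let $\mathrm{cost}(x,w)=\sum_{i=1}^k w_i\,d_i(x)$. Let $R^\star_{\mathrm{noC}}$ be the set of solutions in which every package is delivered by exactly one agent, which picks it up and drops it exactly once (no intermediate drop-offs), and every agent ends at its starting node. Let $A^m$ be an algorithm that on an instance and reported weights $w'\in\mathbb R_{\ge0}^k$ returns a solution $A^m(w')\in\arg\min_{x\in R^\star_{\mathrm{noC}}}\mathrm{cost}(x,w')$ (also on instances with a single agent), and let $P$ be the VCG payments with Clarke's pivot rule, $$P_i(w')=\mathrm{cost}\bigl(A^m(\bot,w'_{-i}),w'_{-i}\bigr)-\sum_{j\ne i}w'_j\,d_j(A^m(w')),$$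 where $(\bot,w'_{-i})$ denotes the instance in which agent $i$ is not present. **Theorem.** The algorithm $A^m$ can be chosen such that the following holds. 1. On every instance with $k\ge2$ agents the mechanism $(A^m,P)$ is truthful, that is, $P_i(w')-w_i\,d_i(A^m(w'))\le P_i(w_i,w'_{-i})-w_i\,d_i(A^m(w_i,w'_{-i}))$ for all $w'\in\mathbb R_{\ge0}^k$, all $i$ and all $w_i\ge0$, and it satisfies voluntary participation, that is, $P_i(w')-w'_i\,d_i(A^m(w'))\ge0$ for all $w'\in\mathbb R_{\ge0}^k$ and all $i$. 2. The mechanism $(A^m,P)$ can be implemented in fixed-parameter tractable time, parametrized by the number $m$ of packages: there are a function $f$ with $$f(m)\in O\bigl(e^{2\sqrt m-m}\,m^m\,\mathrm{poly}(m)\bigr),$$ a polynomial $q$, and a single program for a real random access machine (unit-cost addition, subtraction, multiplication and comparison of real numbers; integer memory with indirect addressing, where an integer multiplication is also charged the bit lengths of its factors) which, for all $n$, $m$, $k\ge2$, all instances and all reported weights $w'\in\mathbb R_{\ge0}^k$, outputs the schedule $A^m(w')$ and all payments $P_1(w'),\dots,P_k(w')$ after at most $f(m)\cdot q(n,k)$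 steps. -/

import Mathlib

namespace Delivery

/-! ### The delivery problem -/

/-- A delivery instance with `n` nodes, `m` packages and `k` agents: a connected undirected graph
with nonnegative edge lengths, a source-target pair for every package, and pairwise distinct
starting positions of the agents. Only the values of `len` on edges of `G` matter. -/
structure Instance (n m k : ℕ) where
  G : SimpleGraph (Fin n)
  connected : G.Connected
  len : Sym2 (Fin n) → ℝ
  len_nonneg : ∀ e ∈ G.edgeSet, 0 ≤ len e
  src : Fin m → Fin n
  tgt : Fin m → Fin n
  pos : Fin k → Fin n
  pos_injective : Function.Injective pos

/-- Elementary actions: agent `i` moves to the adjacent node `v`, picks up package `j`, or drops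
package `j`. -/
inductive Action (n m k : ℕ) where
  | move (i : Fin k) (v : Fin n)
  | pick (i : Fin k) (j : Fin m)
  | drop (i : Fin k) (j : Fin m)

/-- A schedule is a finite sequence of actions; a solution is a schedule that is feasible
(see `Instance.Feasible`). -/
abbrev Schedule (n m k : ℕ) := List (Action n m k)

/-- A configuration: the node of every agent, and for every package either the node where it lies
(`Sum.inl`) or the agent carrying it (`Sum.inr`). -/
structure Config (n m k : ℕ) where
  pos : Fin k → Fin n
  loc : Fin m → Fin n ⊕ Fin k

namespace Instance

variable {n m k : ℕ}

/-- Initially all agents are at their starting positions and all packages at their sources. -/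
def init (I : Instance n m k) : Config n m k where
  pos := I.pos
  loc := fun j => Sum.inl (I.src j)

/-- `I.Step c a d`: action `a` is legal in configuration `c` and leads to `d`. Agents move along
edges, carry at most one package at a time, and pick up and drop packages at their current node. -/
inductive Step (I : Instance n m k) : Config n m k → Action n m k → Config n m k → Prop
  | move (c : Config n m k) (i : Fin k) (v : Fin n) (h : I.G.Adj (c.pos i) v) :
      Step I c (.move i v) ⟨Function.update c.pos i v, c.loc⟩
  | pick (c : Config n m k) (i : Fin k) (j : Fin m) (h : c.loc j = Sum.inl (c.pos i))
      (hfree : ∀ j', c.loc j' ≠ Sum.inr i) :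
      Step I c (.pick i j) ⟨c.pos, Function.update c.loc j (Sum.inr i)⟩
  | drop (c : Config n m k) (i : Fin k) (j : Fin m) (h : c.loc j = Sum.inr i) :
      Step I c (.drop i j) ⟨c.pos, Function.update c.loc j (Sum.inl (c.pos i))⟩

/-- `I.Runs c x d`: the schedule `x` can be executed from `c` and ends in `d`. -/
inductive Runs (I : Instance n m k) : Config n m k → Schedule n m k → Config n m k → Prop
  | nil (c : Config n m k) : Runs I c [] c
  | cons {c d e : Config n m k} {a : Action n m k} {x : Schedule n m k}
      (h : I.Step c a d) (hx : Runs I d x e) : Runs I c (a :: x) e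

/-- The schedule delivers every package from its source to its target. -/
def Feasible (I : Instance n m k) (x : Schedule n m k) : Prop :=
  ∃ c, I.Runs I.init x c ∧ ∀ j, c.loc j = Sum.inl (I.tgt j)

/-- The length travelled by agent `i`, standing at node `u`, in the schedule. -/
def travelFrom (I : Instance n m k) (i : Fin k) : Fin n → Schedule n m k → ℝ
  | _, [] => 0
  | u, .move i' v :: x =>
      if i' = i then I.len s(u, v) + I.travelFrom i v x else I.travelFrom i u x
  | u, .pick _ _ :: x => I.travelFrom i u x
  | u, .drop _ _ :: x => I.travelFrom i u x

/-- The travel distance `d_i(x)` of agent `i` in the schedule `x`. -/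
def travel (I : Instance n m k) (i : Fin k) (x : Schedule n m k) : ℝ :=
  I.travelFrom i (I.pos i) x

/-- The total energy `cost(x, w) = ∑ i, w_i * d_i(x)`. -/
def cost (I : Instance n m k) (x : Schedule n m k) (w : Fin k → ℝ) : ℝ :=
  ∑ i, w i * I.travel i x

end Instance

/-- Whether an action is a drop of package `j`. -/
def Action.isDropOf {n m k : ℕ} (j : Fin m) : Action n m k → Bool
  | .drop _ j' => decide (j' = j)
  | _ => false

namespace Instance

variable {n m k : ℕ}

/-- `RnoC`: the solutions without collaboration, in which every package is delivered by a
single agent. -/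
def RnoC (I : Instance n m k) : Set (Schedule n m k) :=
  {x | I.Feasible x ∧ ∀ j, ∃! i, Action.pick i j ∈ x}

/-- `RnoC*`: the solutions without collaboration in which every package is transported from its
source to its target without intermediate drop-offs, and every agent returns to its starting
position. -/
def RnoCStar (I : Instance n m k) : Set (Schedule n m k) :=
  {x | x ∈ I.RnoC ∧ (∀ j, x.countP (Action.isDropOf j) ≤ 1) ∧
    ∃ c, I.Runs I.init x c ∧ c.pos = I.pos}

/-- The instance in which agent `i` is not present. -/
def remove (I : Instance n m (k + 1)) (i : Fin (k + 1)) : Instance n m k where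
  G := I.G
  connected := I.connected
  len := I.len
  len_nonneg := I.len_nonneg
  src := I.src
  tgt := I.tgt
  pos := fun j => I.pos (i.succAbove j)
  pos_injective := I.pos_injective.comp Fin.succAbove_right_injective

end Instance

/-! ### Mechanisms -/

/-- A mechanism for a fixed instance: it maps the vector of reported weights to a schedule and to a
payment for every agent. -/
structure Mechanism (n m k : ℕ) where
  alg : (Fin k → ℝ) → Schedule n m k
  pay : (Fin k → ℝ) → Fin k → ℝ

/-- Truth-telling is a dominant strategy: whatever the reports `w'` and the true weight `wi` of
agent `i`, the utility of `i` does not decrease if `i` reports `wi` instead of `w' i`. -/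
def Mechanism.Truthful {n m k : ℕ} (I : Instance n m k) (M : Mechanism n m k) : Prop :=
  ∀ w' : Fin k → ℝ, 0 ≤ w' → ∀ (i : Fin k) (wi : ℝ), 0 ≤ wi →
    M.pay w' i - wi * I.travel i (M.alg w') ≤
      M.pay (Function.update w' i wi) i - wi * I.travel i (M.alg (Function.update w' i wi))

/-- Truth-telling agents have nonnegative utility. -/
def Mechanism.VoluntaryParticipation {n m k : ℕ} (I : Instance n m k) (M : Mechanism n m k) :
    Prop :=
  ∀ w' : Fin k → ℝ, 0 ≤ w' → ∀ i : Fin k, 0 ≤ M.pay w' i - w' i * I.travel i (M.alg w')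

/-- A delivery algorithm: a schedule for every instance and every vector of reported weights. -/
abbrev Algorithm := ∀ ⦃n m k : ℕ⦄, Instance n m k → (Fin k → ℝ) → Schedule n m k

/-- `A` returns a solution of minimum cost among all solutions in `RnoC*`, on every instance with at
least one agent (this includes the instances obtained by removing one of at least two agents). -/
def Algorithm.MinimizesOverRnoCStar (A : Algorithm) : Prop :=
  ∀ ⦃n m k : ℕ⦄, 1 ≤ k → ∀ (I : Instance n m k) (w : Fin k → ℝ), 0 ≤ w →
    A I w ∈ I.RnoCStar ∧ ∀ x ∈ I.RnoCStar, I.cost (A I w) w ≤ I.cost x w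

/-- The VCG mechanism with algorithm `A` and Clarke's pivot rule: the payment of agent `i` is the
cost of the output of `A` on the instance without agent `i`, minus the cost of the agents other
than `i` in the output of `A`. -/
noncomputable def Algorithm.vcg (A : Algorithm) {n m k : ℕ} (I : Instance n m (k + 1)) :
    Mechanism n m (k + 1) where
  alg := fun w => A I w
  pay := fun w i =>
    (I.remove i).cost (A (I.remove i) (fun j => w (i.succAbove j))) (fun j => w (i.succAbove j)) -
      ∑ j ∈ Finset.univ.erase i, w j * I.travel j (A I w)

/-! ### The machine model

A real random access machine, programmed in a structured language. The memory consists of arrays of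
natural numbers and arrays of real numbers; a program names finitely many of them by numerals, and
indices are computed at run time. Every elementary operation takes one unit of time, except that a
multiplication of natural numbers is also charged the binary lengths of its factors (so that in time
`t` no computed number grows by more than `O(t)` bits). The only operations on real
numbers are the constants 0 and 1, addition, subtraction, multiplication and comparison. -/

/-- The memory: `nat a i` and `real a i` are the entries with index `i` of the arrays with
name `a`. -/
structure Mem where
  nat : ℕ → ℕ → ℕ
  real : ℕ → ℕ → ℝ

/-- Overwrite an entry of an array of natural numbers. -/
def Mem.setNat (σ : Mem) (a i v : ℕ) : Mem where
  nat := Function.update σ.nat a (Function.update (σ.nat a) i v)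
  real := σ.real

/-- Overwrite an entry of an array of real numbers. -/
noncomputable def Mem.setReal (σ : Mem) (a i : ℕ) (v : ℝ) : Mem where
  nat := σ.nat
  real := Function.update σ.real a (Function.update (σ.real a) i v)

/-- Expressions for natural numbers (`sub` is truncated subtraction). -/
inductive NExp where
  | const (c : ℕ)
  | get (a : ℕ) (i : NExp)
  | add (e f : NExp)
  | sub (e f : NExp)
  | mul (e f : NExp)

namespace NExp

def eval (σ : Mem) : NExp → ℕ
  | const c => c
  | get a i => σ.nat a (i.eval σ)
  | add e f => e.eval σ + f.eval σ
  | sub e f => e.eval σ - f.eval σ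
  | mul e f => e.eval σ * f.eval σ

/-- The time to evaluate an expression. -/
def time (σ : Mem) : NExp → ℕ
  | const _ => 1
  | get _ i => 1 + i.time σ
  | add e f => 1 + e.time σ + f.time σ
  | sub e f => 1 + e.time σ + f.time σ
  | mul e f => 1 + e.time σ + f.time σ + Nat.size (e.eval σ) + Nat.size (f.eval σ)

end NExp

/-- Expressions for real numbers. -/
inductive RExp where
  | zero
  | one
  | get (a : ℕ) (i : NExp)
  | add (e f : RExp)
  | sub (e f : RExp)
  | mul (e f : RExp)

namespace RExp

noncomputable def eval (σ : Mem) : RExp → ℝ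
  | zero => 0
  | one => 1
  | get a i => σ.real a (i.eval σ)
  | add e f => e.eval σ + f.eval σ
  | sub e f => e.eval σ - f.eval σ
  | mul e f => e.eval σ * f.eval σ

/-- The time to evaluate an expression. -/
def time (σ : Mem) : RExp → ℕ
  | zero => 1
  | one => 1
  | get _ i => 1 + i.time σ
  | add e f => 1 + e.time σ + f.time σ
  | sub e f => 1 + e.time σ + f.time σ
  | mul e f => 1 + e.time σ + f.time σ

end RExp

/-- Tests. -/
inductive Test where
  | leN (e f : NExp)
  | leR (e f : RExp)
  | not (b : Test)
  | and (b c : Test)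

namespace Test

def Holds (σ : Mem) : Test → Prop
  | leN e f => e.eval σ ≤ f.eval σ
  | leR e f => e.eval σ ≤ f.eval σ
  | not b => ¬ b.Holds σ
  | and b c => b.Holds σ ∧ c.Holds σ

/-- The time to evaluate a test. -/
def time (σ : Mem) : Test → ℕ
  | leN e f => 1 + e.time σ + f.time σ
  | leR e f => 1 + e.time σ + f.time σ
  | not b => 1 + b.time σ
  | and b c => 1 + b.time σ + c.time σ

end Test

/-- Programs: assignments to array entries, sequencing, branching, and while loops. -/
inductive Prog where
  | skip
  | setN (a : ℕ) (i e : NExp)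
  | setR (a : ℕ) (i : NExp) (e : RExp)
  | seq (p q : Prog)
  | cond (b : Test) (p q : Prog)
  | loop (b : Test) (p : Prog)

/-- `Exec p σ τ t`: the program `p`, started with memory `σ`, halts with memory `τ` after exactly
`t` units of time. -/
inductive Exec : Prog → Mem → Mem → ℕ → Prop
  | skip (σ : Mem) : Exec .skip σ σ 1
  | setN (a : ℕ) (i e : NExp) (σ : Mem) :
      Exec (.setN a i e) σ (σ.setNat a (i.eval σ) (e.eval σ)) (1 + i.time σ + e.time σ)
  | setR (a : ℕ) (i : NExp) (e : RExp) (σ : Mem) :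
      Exec (.setR a i e) σ (σ.setReal a (i.eval σ) (e.eval σ)) (1 + i.time σ + e.time σ)
  | seq {p q : Prog} {σ τ ρ : Mem} {s t : ℕ} (hp : Exec p σ τ s) (hq : Exec q τ ρ t) :
      Exec (.seq p q) σ ρ (s + t)
  | condTrue {b : Test} {p q : Prog} {σ τ : Mem} {t : ℕ} (hb : b.Holds σ)
      (hp : Exec p σ τ t) : Exec (.cond b p q) σ τ (1 + b.time σ + t)
  | condFalse {b : Test} {p q : Prog} {σ τ : Mem} {t : ℕ} (hb : ¬ b.Holds σ)
      (hq : Exec q σ τ t) : Exec (.cond b p q) σ τ (1 + b.time σ + t)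
  | loopFalse {b : Test} {p : Prog} {σ : Mem} (hb : ¬ b.Holds σ) :
      Exec (.loop b p) σ σ (1 + b.time σ)
  | loopTrue {b : Test} {p : Prog} {σ τ ρ : Mem} {s t : ℕ} (hb : b.Holds σ)
      (hp : Exec p σ τ s) (hl : Exec (.loop b p) τ ρ t) :
      Exec (.loop b p) σ ρ (1 + b.time σ + s + t)

/-! ### Input and output -/

open Classical in
/-- The initial memory for an instance and reported weights.
Arrays of natural numbers: array 0 holds `n, m, k`; array 1 the starting positions of the agents;
arrays 2 and 3 the sources and targets of the packages; array 4 the adjacency matrix, with the entry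
for `(u, v)` at index `u * n + v`.
Arrays of real numbers: array 0 holds the matrix of edge lengths (0 for non-edges), array 1 the
reported weights. All other entries are 0. -/
noncomputable def input {n m k : ℕ} (I : Instance n m k) (w : Fin k → ℝ) : Mem where
  nat := fun a x =>
    match a with
    | 0 => if x = 0 then n else if x = 1 then m else if x = 2 then k else 0
    | 1 => if h : x < k then (I.pos ⟨x, h⟩ : ℕ) else 0
    | 2 => if h : x < m then (I.src ⟨x, h⟩ : ℕ) else 0
    | 3 => if h : x < m then (I.tgt ⟨x, h⟩ : ℕ) else 0
    | 4 => if h : x < n * n then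
        (if I.G.Adj (Fin.divNat ⟨x, h⟩) (Fin.modNat ⟨x, h⟩) then 1 else 0) else 0
    | _ => 0
  real := fun a x =>
    match a with
    | 0 => if h : x < n * n then
        (if I.G.Adj (Fin.divNat ⟨x, h⟩) (Fin.modNat ⟨x, h⟩) then
          I.len s(Fin.divNat ⟨x, h⟩, Fin.modNat ⟨x, h⟩) else 0) else 0
    | 1 => if h : x < k then w ⟨x, h⟩ else 0
    | _ => 0

/-- An action as a triple: kind of action, agent, and node or package. -/
def Action.code {n m k : ℕ} : Action n m k → ℕ × ℕ × ℕ
  | .move i v => (0, i, v)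
  | .pick i j => (1, i, j)
  | .drop i j => (2, i, j)

/-- The final memory contains the schedule `x` (its length at index 0 of array 5, and the three
components of its actions in arrays 6, 7 and 8 of natural numbers) and the payments (array 2 of real
numbers). -/
def IsOutput {n m k : ℕ} (τ : Mem) (x : Schedule n m k) (pay : Fin k → ℝ) : Prop :=
  τ.nat 5 0 = x.length ∧
    (∀ (l : ℕ) (h : l < x.length), (τ.nat 6 l, τ.nat 7 l, τ.nat 8 l) = (x[l]).code) ∧
    ∀ i : Fin k, τ.real 2 i = pay i

end Delivery

/-! In a solution from `RnoCStar` no package passes from one agent to another and costs add up over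
the agents, so the agents may as well make their closed tours one after the other. An optimal
solution is therefore a shortest path in a finite graph. A state consists of the acting agent, the
set of packages picked up so far, the agent's node and the package it carries; there are N =
k·2^m·n·(m+1) states. `IsWalk.mem_RnoCStar` and `IsWalk.cost_eq` turn walks from `start` to `goal`
into solutions of equal cost, and `exists_walk_of_mem_RnoCStar` goes back: since each package is
dropped at most once, all pick-ups happen at sources and all drops at targets. As weights are
nonnegative, walks with exactly N edges suffice (`IsWalk.exists_length_eq`): loops are cut out and
free `stay` edges fill up.

Truthfulness is the VCG argument. The pivot term ignores the report of agent i, so its utility is a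
constant minus the total cost measured with its true weight, and the algorithm minimizes that cost
when i is truthful. Participation holds because a solution without agent i becomes one with i at
rest, so the presence of i cannot raise the optimum.

The program is a layered Bellman–Ford recursion: layer r stores, for every state, the least weight
of a walk with r edges to the goal, and the next state on it. One solve costs O(N^3). There is one
for each agent left out and one for the full instance, which gives O(N^4), that is,
16^m·(m+1)^4·(nk)^4 up to a constant. Since 16e < 64, the factor 16^m is at most e^(2√m−m)·m^m from
m = 64 on (`time_isBigO`).

The algorithm is defined from the program: `optAlgorithm` returns the schedule that the program
writes. Payments depend on the reduced instances only through their optimal costs, so ties do not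
matter there. -/

namespace Delivery

/-! ### The tour graph

Agents are treated one after the other. A tour state records the current agent, the set of packages
picked up so far (as a bit mask), the node of the current agent and the package it carries (`0` for
none, `j.succ` for package `j`). -/

@[ext] structure TourState (n m k : ℕ) where
  a : Fin k
  S : Fin (2 ^ m)
  v : Fin n
  c : Fin (m + 1)

namespace Instance

variable {n m k : ℕ}

/-- The edges of the tour graph. -/
inductive Link (I : Instance n m k) : TourState n m k → TourState n m k → Prop
  | stay (x) : Link I x x
  | move (a S v u c) (h : I.G.Adj v u) : Link I ⟨a, S, v, c⟩ ⟨a, S, u, c⟩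
  -- Testing the bit after the addition excludes that it was set before, as adding `2 ^ j` to a set
  -- bit clears it. The program then needs only the bit of each state's own mask at its carried
  -- package.
  | pick (a) (S S' : Fin (2 ^ m)) (j : Fin m) (h : (S' : ℕ) = S + 2 ^ (j : ℕ))
      (hb : (S' : ℕ).testBit j = true) :
      Link I ⟨a, S, I.src j, 0⟩ ⟨a, S', I.src j, j.succ⟩
  | drop (a S j) : Link I ⟨a, S, I.tgt j, j.succ⟩ ⟨a, S, I.tgt j, 0⟩
  | next (a a' : Fin k) (S) (h : (a' : ℕ) = a + 1) : Link I ⟨a, S, I.pos a, 0⟩ ⟨a', S, I.pos a', 0⟩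

open Classical in
/-- The weight of an edge of the tour graph. -/
noncomputable def linkCost (I : Instance n m k) (w : Fin k → ℝ) (x y : TourState n m k) : ℝ :=
  -- A stay, pick or drop keeps the node, and no node is adjacent to itself, so only moves are
  -- charged.
  if x.a = y.a then w x.a * (if I.G.Adj x.v y.v then I.len s(x.v, y.v) else 0) else 0

end Instance

section acts

variable {n m k : ℕ}

/-- The actions performed along an edge of the tour graph. -/
def TourState.act (x y : TourState n m k) : Schedule n m k :=
  if x.a = y.a then
    if x.v = y.v then
      if x.c = y.c then []
      else if h : y.c ≠ 0 then [.pick x.a (y.c.pred h)]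
      else if h : x.c ≠ 0 then [.drop x.a (x.c.pred h)]
      else []
    else [.move x.a y.v]
  else []

/-- The actions performed along a walk of the tour graph. -/
def TourState.acts : TourState n m k → List (TourState n m k) → Schedule n m k
  | _, [] => []
  | x, y :: l => x.act y ++ y.acts l

end acts

namespace Instance

variable {n m k : ℕ}

/-- `I.IsWalk x l y`: the states of `l` form, after `x`, a walk from `x` to `y`. -/
def IsWalk (I : Instance n m k) : TourState n m k → List (TourState n m k) → TourState n m k → Prop
  | x, [], y => x = y
  | x, z :: l, y => I.Link x z ∧ I.IsWalk z l y

/-- The share of agent `i` of the weight of a walk. -/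
noncomputable def share (I : Instance n m k) (w : Fin k → ℝ) (i : Fin k) :
    TourState n m k → List (TourState n m k) → ℝ
  | _, [] => 0
  | x, z :: l => (if x.a = i then I.linkCost w x z else 0) + I.share w i z l

/-- The weight of a walk. -/
noncomputable def walkCost (I : Instance n m k) (w : Fin k → ℝ) :
    TourState n m k → List (TourState n m k) → ℝ
  | _, [] => 0
  | x, z :: l => I.linkCost w x z + I.walkCost w z l

theorem sum_share (I : Instance n m k) (w : Fin k → ℝ) (x : TourState n m k)
    (l : List (TourState n m k)) : ∑ i, I.share w i x l = I.walkCost w x l := by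
  induction l generalizing x with
  | nil => simp [share, walkCost]
  | cons z l ih => simp [share, walkCost, Finset.sum_add_distrib, ih]

theorem IsWalk.append {I : Instance n m k} {x y z : TourState n m k} {l l' : List (TourState n m k)}
    (h : I.IsWalk x l y) (h' : I.IsWalk y l' z) : I.IsWalk x (l ++ l') z := by
  induction l generalizing x with
  | nil => cases h; exact h'
  | cons u l ih => exact ⟨h.1, ih h.2⟩

theorem IsWalk.walkCost_append {I : Instance n m k} (w : Fin k → ℝ) {x y : TourState n m k}
    {l : List (TourState n m k)} (h : I.IsWalk x l y) (l' : List (TourState n m k)) :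
    I.walkCost w x (l ++ l') = I.walkCost w x l + I.walkCost w y l' := by
  induction l generalizing x with
  | nil => cases h; simp [walkCost]
  | cons u l ih => simp [walkCost, ih h.2, add_assoc]

theorem IsWalk.share_append {I : Instance n m k} (w : Fin k → ℝ) (i : Fin k) {x y : TourState n m k}
    {l : List (TourState n m k)} (h : I.IsWalk x l y) (l' : List (TourState n m k)) :
    I.share w i x (l ++ l') = I.share w i x l + I.share w i y l' := by
  induction l generalizing x with
  | nil => cases h; simp [share]
  | cons u l ih => simp [share, ih h.2, add_assoc]

theorem IsWalk.acts_append {I : Instance n m k} {x y : TourState n m k}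
    {l : List (TourState n m k)} (h : I.IsWalk x l y) (l' : List (TourState n m k)) :
    x.acts (l ++ l') = x.acts l ++ y.acts l' := by
  induction l generalizing x with
  | nil => cases h; simp [TourState.acts]
  | cons u l ih => simp [TourState.acts, ih h.2]

theorem linkCost_nonneg {I : Instance n m k} {w : Fin k → ℝ} (hw : 0 ≤ w)
    (x y : TourState n m k) : 0 ≤ I.linkCost w x y := by
  unfold linkCost
  split_ifs with h1 h2
  · exact mul_nonneg (hw _) (I.len_nonneg _ h2)
  · simp
  · rfl

end Instance

/-- Had bit `j` of `S` been set, adding `2 ^ j` would have cleared it. So it was unset, no carry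
occurs, and the other bits survive. -/
theorem testBit_of_eq_add_two_pow {S S' j : ℕ} (h : S' = S + 2 ^ j) (hb : S'.testBit j = true) :
    S.testBit j = false ∧ ∀ i, i ≠ j → S'.testBit i = S.testBit i := by
  have h0 : S.testBit j = false := by
    rw [h, add_comm, Nat.testBit_two_pow_add_eq] at hb
    simpa using hb
  refine ⟨h0, fun i hi => ?_⟩
  have hlt : S % 2 ^ (j + 1) < 2 ^ j := by
    have h1 : (S % 2 ^ (j + 1)).testBit j = false := by simp [Nat.testBit_mod_two_pow, h0]
    by_contra hge
    have h2 := Nat.testBit_of_two_pow_le_and_two_pow_add_one_gt (not_lt.1 hge)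
      (Nat.mod_lt _ (by positivity))
    simp [h1] at h2
  have hp : (2 : ℕ) ^ (j + 1) = 2 ^ j + 2 ^ j := by ring
  have hS : S = 2 ^ (j + 1) * (S / 2 ^ (j + 1)) + S % 2 ^ (j + 1) := (Nat.div_add_mod _ _).symm
  have hS' : S' = 2 ^ (j + 1) * (S / 2 ^ (j + 1)) + (2 ^ j + S % 2 ^ (j + 1)) := by omega
  rw [hS', Nat.testBit_two_pow_mul_add _ (by omega)]
  conv_rhs => rw [hS, Nat.testBit_two_pow_mul_add _ (by omega)]
  split_ifs with h1
  · rcases lt_or_ge i j with h2 | h2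
    · rw [Nat.testBit_two_pow_add_gt h2]
    · omega
  · rfl

theorem testBit_add_two_pow {S j : ℕ} (h : S.testBit j = false) :
    (S + 2 ^ j).testBit j = true := by
  rw [add_comm, Nat.testBit_two_pow_add_eq, h]; rfl

/-! ### Walks in the tour graph yield solutions -/

namespace TourState

variable {n m k : ℕ}

/-- The carried package has been picked up. -/
def Valid (x : TourState n m k) : Prop := ∀ j : Fin m, x.c = j.succ → (x.S : ℕ).testBit j = true

/-- The configuration described by a tour state. -/
def config (I : Instance n m k) (x : TourState n m k) : Config n m k where
  -- All agents but the acting one are at their starts: the earlier ones have returned, the later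
  -- ones have not left.
  pos := Function.update I.pos x.a x.v
  loc := fun j => if x.c = j.succ then Sum.inr x.a
    else if (x.S : ℕ).testBit j then Sum.inl (I.tgt j) else Sum.inl (I.src j)

end TourState

namespace Instance

variable {n m k : ℕ} {I : Instance n m k}

theorem Runs.append {c d e : Config n m k} {x y : Schedule n m k} (h : I.Runs c x d)
    (h' : I.Runs d y e) : I.Runs c (x ++ y) e := by
  induction h with
  | nil => exact h'
  | cons hs _ ih => exact .cons hs (ih h')

/-- What happens along one edge of the tour graph. -/
theorem Link.spec {x y : TourState n m k} (h : I.Link x y) (hx : x.Valid) :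
    y.Valid ∧ I.Runs (x.config I) (x.act y) (y.config I) := by
  cases h with
  | stay =>
    refine ⟨hx, ?_⟩
    simp only [TourState.act, if_true]
    exact .nil _
  | move a S v u c h =>
    refine ⟨hx, ?_⟩
    simp only [TourState.act, if_true, if_neg h.ne]
    refine .cons (.move _ _ u (by simpa [TourState.config] using h)) ?_
    simp only [TourState.config, Function.update_idem]
    exact .nil _
  | pick a S S' j h hb =>
    obtain ⟨h0, h1⟩ := testBit_of_eq_add_two_pow h hb
    refine ⟨fun j' hj' => ?_, ?_⟩
    · simp only [Fin.succ_inj] at hj'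
      rw [← hj']; exact hb
    · have hne : (0 : Fin (m + 1)) ≠ j.succ := (Fin.succ_ne_zero j).symm
      simp only [TourState.act, if_true, if_neg hne, ne_eq, Fin.succ_ne_zero, not_false_eq_true,
        dif_pos, Fin.pred_succ]
      have hd : TourState.config I ⟨a, S', I.src j, j.succ⟩ =
          ⟨(TourState.config I ⟨a, S, I.src j, 0⟩).pos,
            Function.update (TourState.config I ⟨a, S, I.src j, 0⟩).loc j (Sum.inr a)⟩ := by
        simp only [TourState.config, Config.mk.injEq, true_and]
        funext j'
        rcases eq_or_ne j' j with rfl | hj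
        · simp
        · have : ((S' : ℕ).testBit j') = (S : ℕ).testBit j' := h1 _ (by simpa [Fin.ext_iff] using hj)
          simp [Function.update_of_ne hj, Ne.symm hj, this, (Fin.succ_ne_zero _).symm]
      rw [hd]
      refine .cons (.pick _ a j ?_ ?_) (.nil _)
      · simp [TourState.config, h0, (Fin.succ_ne_zero _).symm]
      · intro j'
        simp only [TourState.config, (Fin.succ_ne_zero _).symm, if_false]
        split_ifs <;> simp
  | drop a S j =>
    refine ⟨fun j' hj' => absurd hj'.symm (Fin.succ_ne_zero _), ?_⟩
    simp only [TourState.act, if_true, ne_eq, Fin.succ_ne_zero, not_false_eq_true, if_false,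
        dif_pos, Fin.pred_succ, not_true_eq_false, dif_neg]
    have hd : TourState.config I ⟨a, S, I.tgt j, 0⟩ =
        ⟨(TourState.config I ⟨a, S, I.tgt j, j.succ⟩).pos,
          Function.update (TourState.config I ⟨a, S, I.tgt j, j.succ⟩).loc j
            (Sum.inl ((TourState.config I ⟨a, S, I.tgt j, j.succ⟩).pos a))⟩ := by
      simp only [TourState.config, Config.mk.injEq, true_and]
      funext j'
      rcases eq_or_ne j' j with rfl | hj
      · have : (S : ℕ).testBit j' = true := hx j' rfl
        simp [this, (Fin.succ_ne_zero _).symm]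
      · simp [Function.update_of_ne hj, Ne.symm hj, (Fin.succ_ne_zero _).symm]
    rw [hd]
    refine .cons (.drop _ a j ?_) (.nil _)
    simp [TourState.config]
  | next a a' S h =>
    refine ⟨fun j' hj' => absurd hj'.symm (Fin.succ_ne_zero _), ?_⟩
    have hne : a ≠ a' := fun e => by rw [e] at h; omega
    simp only [TourState.act, if_neg hne]
    -- Handing over changes nothing, because the old agent stands at its start again.
    have hd : TourState.config I ⟨a, S, I.pos a, 0⟩ = TourState.config I ⟨a', S, I.pos a', 0⟩ := by
      simp [TourState.config, (Fin.succ_ne_zero _).symm]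
    rw [hd]
    exact .nil _

theorem IsWalk.runs {x y : TourState n m k} {l : List (TourState n m k)} (h : I.IsWalk x l y)
    (hx : x.Valid) : I.Runs (x.config I) (x.acts l) (y.config I) := by
  induction l generalizing x with
  | nil => cases h; exact .nil _
  | cons z l ih =>
    obtain ⟨h1, h2⟩ := h.1.spec hx
    exact h2.append (ih h.2 h1)

/-- The pick-ups and drops along a walk to a state in which a package has been picked up. -/
theorem IsWalk.counts {x y : TourState n m k} {l : List (TourState n m k)} (h : I.IsWalk x l y)
    (hx : x.Valid) (j : Fin m) (hj : (y.S : ℕ).testBit j = true) :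
    ((x.S : ℕ).testBit j = true → ∀ i, Action.pick i j ∉ x.acts l) ∧
    ((x.S : ℕ).testBit j = false → ∃! i, Action.pick i j ∈ x.acts l) ∧
    (x.acts l).countP (Action.isDropOf j) ≤ 1 ∧
    ((x.S : ℕ).testBit j = true → x.c ≠ j.succ →
      (x.acts l).countP (Action.isDropOf j) = 0) := by
  -- The claims support each other: uniqueness of the picking agent uses the first claim for the
  -- rest of the walk, and the bound on drops uses the last one after a drop.
  induction l generalizing x with
  | nil =>
    cases h
    simp [TourState.acts, hj]
  | cons z l ih =>
    obtain ⟨hl, h2⟩ := h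
    obtain ⟨i1, i2, i3, i4⟩ := ih h2 (hl.spec hx).1
    simp only [TourState.acts]
    cases hl with
    | stay =>
      simp only [TourState.act, if_true, List.nil_append]
      exact ⟨i1, i2, i3, i4⟩
    | move a S v u c h =>
      simp only [TourState.act, if_true, if_neg h.ne, List.singleton_append, List.mem_cons,
        reduceCtorEq, false_or, List.countP_cons, Action.isDropOf]
      exact ⟨i1, i2, by simpa using i3, by simpa using i4⟩
    | pick a S S' j' h hb =>
      obtain ⟨h0, h1⟩ := testBit_of_eq_add_two_pow h hb
      simp only [TourState.act, if_true, (Fin.succ_ne_zero j').symm, if_false, ne_eq,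
        Fin.succ_ne_zero, not_false_eq_true, dif_pos, Fin.pred_succ, List.singleton_append,
        List.mem_cons, Action.pick.injEq, List.countP_cons, Action.isDropOf]
      rcases eq_or_ne j j' with rfl | hne
      · refine ⟨fun e => by simp [h0] at e, fun _ => ⟨a, by simp, fun i hi => ?_⟩, by simpa using i3,
          fun e => by simp [h0] at e⟩
        rcases hi with hi | hi
        · exact hi.1
        · exact absurd hi (i1 hb i)
      · rw [h1 j (by simpa [Fin.ext_iff] using hne)] at i1 i2 i4
        simp only [hne, and_false, false_or]
        refine ⟨i1, i2, by simpa using i3, fun e _ => ?_⟩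
        simpa using i4 e (by simpa using hne.symm)
    | drop a S j' =>
      simp only [TourState.act, if_true, if_false, ne_eq,
        Fin.succ_ne_zero, not_false_eq_true, dif_pos, Fin.pred_succ, List.singleton_append,
        List.mem_cons, reduceCtorEq, false_or, List.countP_cons, Action.isDropOf,
        not_true_eq_false, dif_neg, decide_eq_true_eq]
      refine ⟨i1, i2, ?_, fun e hne => ?_⟩
      · split_ifs with hjj
        · subst hjj
          have := i4 (hx _ rfl) (Fin.succ_ne_zero _).symm
          omega
        · exact i3
      · have := i4 e (Fin.succ_ne_zero _).symm
        rw [if_neg (by simpa using hne)]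
        omega
    | next a a' S h =>
      have hne : a ≠ a' := fun e => by rw [e] at h; omega
      simp only [TourState.act, if_neg hne, List.nil_append]
      exact ⟨i1, i2, i3, i4⟩

/-- The tail `s` is arbitrary because travel is computed from the front with the current node as
state. The factor `w i` stays in place since `linkCost` is already weighted. -/
theorem Link.travel {x y : TourState n m k} (h : I.Link x y) (w : Fin k → ℝ) (i : Fin k)
    (s : Schedule n m k) :
    w i * I.travelFrom i ((x.config I).pos i) (x.act y ++ s) =
      (if x.a = i then I.linkCost w x y else 0) +
        w i * I.travelFrom i ((y.config I).pos i) s := by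
  cases h with
  | stay => simp [TourState.act, linkCost]
  | move a S v u c h =>
    simp only [TourState.act, if_true, if_neg h.ne, List.singleton_append, travelFrom,
      linkCost, TourState.config, h]
    split_ifs with hi
    · subst hi; simp; ring
    · simp [Function.update_of_ne (Ne.symm hi)]
  | pick a S S' j h hb =>
    simp [TourState.act, (Fin.succ_ne_zero j).symm, travelFrom, linkCost, TourState.config]
  | drop a S j =>
    simp [TourState.act, travelFrom, linkCost, TourState.config]
  | next a a' S h =>
    have hne : a ≠ a' := fun e => by rw [e] at h; omega
    simp [TourState.act, if_neg hne, linkCost, TourState.config]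

theorem IsWalk.travel {x y : TourState n m k} {l : List (TourState n m k)} (h : I.IsWalk x l y)
    (w : Fin k → ℝ) (i : Fin k) :
    w i * I.travelFrom i ((x.config I).pos i) (x.acts l) = I.share w i x l := by
  induction l generalizing x with
  | nil => simp [TourState.acts, share, travelFrom]
  | cons z l ih => rw [TourState.acts, h.1.travel, ih h.2, share]

end Instance

/-! ### Start, goal and the solution read off a walk between them -/

/-- The state in which no package has been picked up and the first agent starts. -/
def Instance.start {n m k : ℕ} (I : Instance n m (k + 1)) : TourState n m (k + 1) :=
  ⟨0, ⟨0, by positivity⟩, I.pos 0, 0⟩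

/-- The state in which all packages have been delivered and the last agent has returned. -/
def Instance.goal {n m k : ℕ} (I : Instance n m (k + 1)) : TourState n m (k + 1) :=
  ⟨Fin.last k, ⟨2 ^ m - 1, Nat.sub_lt (by positivity) one_pos⟩, I.pos (Fin.last k), 0⟩

namespace Instance

variable {n m k : ℕ} {I : Instance n m (k + 1)}

theorem start_valid (I : Instance n m (k + 1)) : I.start.Valid :=
  fun _ h => absurd h.symm (Fin.succ_ne_zero _)

theorem config_start (I : Instance n m (k + 1)) : I.start.config I = I.init := by
  simp [TourState.config, start, init, (Fin.succ_ne_zero _).symm]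

theorem IsWalk.mem_RnoCStar {l : List (TourState n m (k + 1))} (h : I.IsWalk I.start l I.goal) :
    I.start.acts l ∈ I.RnoCStar := by
  have hr := h.runs I.start_valid
  rw [config_start] at hr
  have hg : ∀ j : Fin m, (I.goal.S : ℕ).testBit j = true := fun j => by simp [goal]
  have hc := fun j => h.counts I.start_valid j (hg j)
  refine ⟨⟨⟨_, hr, fun j => ?_⟩, fun j => (hc j).2.1 ?_⟩, fun j => (hc j).2.2.1, _, hr, ?_⟩
  · have h0 : I.goal.c ≠ j.succ := (Fin.succ_ne_zero j).symm
    simp only [TourState.config, hg, if_true, if_neg h0]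
  · simp [start]
  · simp [TourState.config, goal]

theorem IsWalk.weighted_travel {l : List (TourState n m (k + 1))}
    (h : I.IsWalk I.start l I.goal) (w : Fin (k + 1) → ℝ) (i : Fin (k + 1)) :
    w i * I.travel i (I.start.acts l) = I.share w i I.start l := by
  have := h.travel w i
  rwa [config_start] at this

theorem IsWalk.cost_eq {l : List (TourState n m (k + 1))}
    (h : I.IsWalk I.start l I.goal) (w : Fin (k + 1) → ℝ) :
    I.cost (I.start.acts l) w = I.walkCost w I.start l := by
  rw [← sum_share, cost]
  exact Finset.sum_congr rfl fun i _ => h.weighted_travel w i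

end Instance

end Delivery

namespace Delivery

/-! ### Solutions yield walks in the tour graph -/

namespace Instance

variable {n m k : ℕ} {I : Instance n m k}

theorem Step.unique {c d d' : Config n m k} {a : Action n m k} (h : I.Step c a d)
    (h' : I.Step c a d') : d = d' := by
  cases h <;> cases h' <;> rfl

theorem Runs.unique {c d d' : Config n m k} {x : Schedule n m k} (h : I.Runs c x d)
    (h' : I.Runs c x d') : d = d' := by
  induction h with
  | nil => cases h'; rfl
  | cons hs _ ih =>
    cases h' with
    | cons hs' hr' => rw [hs.unique hs'] at ih; exact ih hr'

/-- An action that neither picks up nor drops package `j` does not affect it. -/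
theorem Step.loc_eq {c d : Config n m k} {a : Action n m k} (h : I.Step c a d) (j : Fin m)
    (hp : ∀ i, a ≠ .pick i j) (hd : ∀ i, a ≠ .drop i j) : d.loc j = c.loc j := by
  cases h with
  | move => rfl
  | pick i j' => exact Function.update_of_ne (fun e => hp i (by rw [e])) _ _
  | drop i j' => exact Function.update_of_ne (fun e => hd i (by rw [e])) _ _

theorem Runs.drop_pos {c d : Config n m k} {x : Schedule n m k} (h : I.Runs c x d) (j : Fin m)
    {i : Fin k} {u : Fin n} (hc : c.loc j = Sum.inr i) (hd : d.loc j = Sum.inl u) :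
    x.countP (Action.isDropOf j) ≠ 0 := by
  induction h with
  | nil => rw [hc] at hd; cases hd
  | @cons c d e a x hs hr ih =>
    rw [List.countP_cons]
    by_cases h1 : ∃ i, a = .drop i j
    · obtain ⟨i, rfl⟩ := h1
      simp [Action.isDropOf]
    · have hloc := hs.loc_eq j (fun i' e => by subst e; cases hs; simp_all) (fun i' e => h1 ⟨i', e⟩)
      have := ih (hloc.trans hc) hd
      omega

/-- A pick-up would force a later drop by `Runs.drop_pos`, so without drops the package never leaves
its node. -/
theorem Runs.of_countP_eq_zero {c d : Config n m k} {x : Schedule n m k} (h : I.Runs c x d)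
    (j : Fin m) {u u' : Fin n} (hc : c.loc j = Sum.inl u) (hd : d.loc j = Sum.inl u')
    (h0 : x.countP (Action.isDropOf j) = 0) : u = u' ∧ ∀ i, Action.pick i j ∉ x := by
  induction h with
  | nil => rw [hc] at hd; cases hd; simp
  | @cons c d e a x hs hr ih =>
    rw [List.countP_cons] at h0
    have hp : ∀ i, a ≠ .pick i j := by
      rintro i rfl
      cases hs
      exact hr.drop_pos j (i := i) (by simp) hd (by omega)
    have hloc := hs.loc_eq j hp (fun i' e => by subst e; cases hs; simp_all)
    obtain ⟨h1, h2⟩ := ih (hloc.trans hc) hd (by omega)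
    refine ⟨h1, fun i hi => ?_⟩
    rcases List.mem_cons.1 hi with hi | hi
    · exact hp i hi.symm
    · exact h2 i hi

/-- Until its next drop the package is in an agent's hands; that drop is its only one, and
afterwards `Runs.of_countP_eq_zero` forbids picking it up. -/
theorem Runs.not_pick_of_carried {c d : Config n m k} {x : Schedule n m k} (h : I.Runs c x d)
    (j : Fin m) {i : Fin k} {u : Fin n} (hc : c.loc j = Sum.inr i) (hd : d.loc j = Sum.inl u)
    (h1 : x.countP (Action.isDropOf j) ≤ 1) (i' : Fin k) : Action.pick i' j ∉ x := by
  induction h with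
  | nil => simp
  | @cons c d e a x hs hr ih =>
    rw [List.countP_cons] at h1
    have hp : ∀ i, a ≠ .pick i j := by
      rintro i rfl
      cases hs
      simp_all
    have : Action.pick i' j ∉ x := by
      by_cases h2 : ∃ i, a = .drop i j
      · obtain ⟨i2, rfl⟩ := h2
        cases hs
        refine (hr.of_countP_eq_zero j (u := c.pos i2) (by simp) hd ?_).2 i'
        simp only [Action.isDropOf, decide_true, if_true] at h1
        omega
      · have hloc := hs.loc_eq j hp (fun i' e => h2 ⟨i', e⟩)
        exact ih (hloc.trans hc) hd (by omega)
    rintro hi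
    rcases List.mem_cons.1 hi with hi | hi
    · exact hp i' hi.symm
    · exact this hi

theorem two_pow_add_lt {m S : ℕ} (j : Fin m) (hS : S < 2 ^ m)
    (h : S.testBit j = false) : S + 2 ^ (j : ℕ) < 2 ^ m := by
  refine Nat.lt_pow_two_of_testBit _ fun i hi => ?_
  obtain ⟨_, h2⟩ := testBit_of_eq_add_two_pow (S := S) (j := j) rfl (testBit_add_two_pow h)
  rw [h2 i (by omega)]
  exact Nat.testBit_lt_two_pow (hS.trans_le (Nat.pow_le_pow_right (by norm_num) hi))

/-- The tour of one agent in a solution without intermediate drop-offs. -/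
theorem Runs.exists_walk {c d : Config n m k} {x : Schedule n m k} (h : I.Runs c x d)
    (w : Fin k → ℝ) (i : Fin k)
    (hd : ∀ j, d.loc j = Sum.inl (I.tgt j)) (hdrop : ∀ j, x.countP (Action.isDropOf j) ≤ 1)
    (hsrc : ∀ j u i', c.loc j = Sum.inl u → Action.pick i' j ∈ x → u = I.src j)
    (o : Fin (m + 1)) (ho : ∀ j : Fin m, c.loc j = Sum.inr i ↔ o = j.succ)
    (S : Fin (2 ^ m)) (hS : ∀ j : Fin m, Action.pick i j ∈ x → (S : ℕ).testBit j = false) :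
    ∃ l S', I.IsWalk ⟨i, S, c.pos i, o⟩ l ⟨i, S', d.pos i, 0⟩ ∧
      (∀ j : Fin m, (S' : ℕ).testBit j = true ↔ (S : ℕ).testBit j = true ∨ Action.pick i j ∈ x) ∧
      I.walkCost w ⟨i, S, c.pos i, o⟩ l = w i * I.travelFrom i (c.pos i) x := by
  -- Invariant: `o` encodes what agent `i` carries, `S` avoids the packages it will still pick up,
  -- and every package lying at a node and still to be picked up lies at its source.
  induction h generalizing o S with
  | nil c =>
    have : o = 0 := by
      induction o using Fin.cases with
      | zero => rfl
      | succ j => simpa [hd] using (ho j).2 rfl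
    subst this
    exact ⟨[], S, rfl, by simp, by simp [walkCost, travelFrom]⟩
  | @cons c d e a x hs hr ih =>
    have hdrop' : ∀ j, x.countP (Action.isDropOf j) ≤ 1 := fun j => by
      have := hdrop j
      rw [List.countP_cons] at this
      omega
    -- A package dropped just now has spent its only drop and is not picked up again; any other
    -- package lying at a node lay there before.
    have hsrc' : ∀ j u i', d.loc j = Sum.inl u → Action.pick i' j ∈ x → u = I.src j := by
      intro j u i' hu hi
      by_cases h1 : ∃ i, a = .drop i j
      · obtain ⟨i2, rfl⟩ := h1
        refine absurd hi ((hr.of_countP_eq_zero j hu (hd j) ?_).2 i')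
        have := hdrop j
        simp only [List.countP_cons, Action.isDropOf, decide_true, if_true] at this
        omega
      · have hp : ∀ i, a ≠ .pick i j := by
          rintro i rfl
          cases hs
          simp at hu
        refine hsrc j u i' ?_ (List.mem_cons_of_mem _ hi)
        rw [← hs.loc_eq j hp (fun i e => h1 ⟨i, e⟩), hu]
    cases hs with
    | move i' v hadj =>
      obtain ⟨l, S', h1, h2, h3⟩ := ih hd hdrop' hsrc' o ho S
        (fun j hj => hS j (List.mem_cons_of_mem _ hj))
      have h2' : ∀ j : Fin m, (S' : ℕ).testBit j = true ↔
          (S : ℕ).testBit j = true ∨ Action.pick i j ∈ Action.move i' v :: x := fun j => by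
        rw [h2 j]; simp
      -- Here and in the next two cases, actions of other agents leave no trace in the walk of `i`.
      by_cases hi : i' = i
      · subst hi
        simp only [Function.update_self] at h1 h3
        refine ⟨_ :: l, S', ⟨.move _ _ _ _ _ hadj, h1⟩, h2', ?_⟩
        simp only [walkCost, h3, linkCost, hadj, travelFrom, if_true]
        ring
      · simp only [Function.update_of_ne (Ne.symm hi)] at h1 h3
        refine ⟨l, S', h1, h2', ?_⟩
        simp [h3, travelFrom, hi]
    | pick i' j hj hfree =>
      by_cases hi : i' = i
      · subst hi
        have hS0 : (S : ℕ).testBit j = false := hS j (by simp)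
        have ho0 : o = 0 := by
          induction o using Fin.cases with
          | zero => rfl
          | succ j' => exact absurd ((ho j').2 rfl) (hfree j')
        subst ho0
        -- This keeps the enlarged mask disjoint from the later pick-ups of the agent.
        have hnp : ∀ i, Action.pick i j ∉ x := fun i2 =>
          hr.not_pick_of_carried j (i := i') (by simp) (hd j) (hdrop' j) i2
        have hv : c.pos i' = I.src j := hsrc j _ i' hj (by simp)
        have hb := testBit_add_two_pow hS0
        have hb' := (testBit_of_eq_add_two_pow rfl hb).2
        obtain ⟨l, S', h1, h2, h3⟩ := ih hd hdrop' hsrc' j.succ (fun j' => by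
          rcases eq_or_ne j' j with rfl | hne
          · simp
          · simp [Function.update_of_ne hne, hfree j', hne.symm])
          ⟨S + 2 ^ (j : ℕ), two_pow_add_lt j S.2 hS0⟩ (fun j' hj' => by
            have hne : j' ≠ j := fun e => hnp i' (e ▸ hj')
            simp only
            rw [hb' j' (by simpa [Fin.ext_iff] using hne)]
            exact hS j' (List.mem_cons_of_mem _ hj'))
        simp only at h1 h3
        refine ⟨_ :: l, S', ⟨?_, h1⟩, fun j' => ?_, ?_⟩
        · rw [hv]
          exact .pick _ _ _ _ rfl hb
        · rw [h2 j']
          rcases eq_or_ne j' j with rfl | hne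
          · simp [hb]
          · simp only [List.mem_cons, Action.pick.injEq, hne, and_false, false_or]
            rw [hb' j' (by simpa [Fin.ext_iff] using hne)]
        · simp [walkCost, h3, linkCost, travelFrom]
      · obtain ⟨l, S', h1, h2, h3⟩ := ih hd hdrop' hsrc' o (fun j' => by
          rw [← ho j']
          rcases eq_or_ne j' j with rfl | hne
          · simp [hi, hj]
          · simp [Function.update_of_ne hne]) S (fun j hj => hS j (List.mem_cons_of_mem _ hj))
        refine ⟨l, S', h1, fun j' => ?_, ?_⟩
        · rw [h2 j']; simp [Ne.symm hi]
        · simp [h3, travelFrom]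
    | drop i' j hj =>
      by_cases hi : i' = i
      · subst hi
        have ho' : o = j.succ := (ho j).1 hj
        subst ho'
        -- With no drop left, the package stays where it is put down, which must be its target.
        have hv : c.pos i' = I.tgt j := by
          refine (hr.of_countP_eq_zero j (u := c.pos i') (by simp) (hd j) ?_).1
          have := hdrop j
          simp only [List.countP_cons, Action.isDropOf, decide_true, if_true] at this
          omega
        obtain ⟨l, S', h1, h2, h3⟩ := ih hd hdrop' hsrc' 0 (fun j' => by
          rcases eq_or_ne j' j with rfl | hne
          · simp [(Fin.succ_ne_zero _).symm]
          · simp [Function.update_of_ne hne, ho j', hne.symm, (Fin.succ_ne_zero _).symm]) S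
            (fun j hj => hS j (List.mem_cons_of_mem _ hj))
        simp only at h1 h3
        refine ⟨_ :: l, S', ⟨?_, h1⟩, fun j' => ?_, ?_⟩
        · rw [hv]
          exact .drop _ _ _
        · rw [h2 j']; simp
        · simp [walkCost, h3, linkCost, travelFrom]
      · obtain ⟨l, S', h1, h2, h3⟩ := ih hd hdrop' hsrc' o (fun j' => by
          rw [← ho j']
          rcases eq_or_ne j' j with rfl | hne
          · simp [hj, hi]
          · simp [Function.update_of_ne hne]) S (fun j hj => hS j (List.mem_cons_of_mem _ hj))
        refine ⟨l, S', h1, fun j' => ?_, ?_⟩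
        · rw [h2 j']; simp
        · simp [h3, travelFrom]

end Instance

/-! ### Joining the tours of the agents -/

namespace Instance

variable {n m k : ℕ} {I : Instance n m (k + 1)}

/-- The tours of all agents are extracted from the same run and chained by `next` edges. The masks
fit together because every package has exactly one carrier. -/
theorem exists_walk_of_mem_RnoCStar {x : Schedule n m (k + 1)} (hx : x ∈ I.RnoCStar)
    (w : Fin (k + 1) → ℝ) :
    ∃ l, I.IsWalk I.start l I.goal ∧ I.walkCost w I.start l = I.cost x w := by
  obtain ⟨⟨⟨c, hr, hloc⟩, hpick⟩, hdrop, c', hr', hpos⟩ := hx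
  obtain rfl := hr.unique hr'
  have agent := fun i S hS => hr.exists_walk w i hloc hdrop
    (fun j u i' hu _ => by simpa [init] using hu.symm) 0
    (fun j => by simp [init, (Fin.succ_ne_zero _).symm]) S hS
  simp only [init, hpos] at agent
  have key : ∀ (a : ℕ) (ha : a < k + 1), ∃ l S,
      I.IsWalk I.start l ⟨⟨a, ha⟩, S, I.pos ⟨a, ha⟩, 0⟩ ∧
      (∀ j : Fin m, (S : ℕ).testBit j = true ↔ ∃ i : Fin (k + 1), (i : ℕ) ≤ a ∧ Action.pick i j ∈ x) ∧
      I.walkCost w I.start l =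
        ∑ i ∈ Finset.range (a + 1), if h : i < k + 1 then w ⟨i, h⟩ * I.travel ⟨i, h⟩ x else 0 := by
    intro a
    induction a with
    | zero =>
      intro ha
      obtain ⟨l, S, h1, h2, h3⟩ := agent 0 ⟨0, by positivity⟩ (by simp)
      refine ⟨l, S, h1, fun j => ?_, ?_⟩
      · rw [h2 j]
        constructor
        · rintro (h | h)
          · simp at h
          · exact ⟨0, le_rfl, h⟩
        · rintro ⟨i, hi, h⟩
          have : i = 0 := Fin.ext (by simpa using hi)
          exact Or.inr (this ▸ h)
      · rw [zero_add, Finset.sum_range_one, dif_pos (by omega)]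
        exact h3
    | succ a ih =>
      intro ha
      obtain ⟨l, S, h1, h2, h3⟩ := ih (by omega)
      -- No package of the next agent is in the mask yet, since it would then have two carriers.
      obtain ⟨l', S', h1', h2', h3'⟩ := agent ⟨a + 1, ha⟩ S (fun j hj => by
        by_contra hb
        rw [Bool.not_eq_false] at hb
        obtain ⟨i, hi, hi'⟩ := (h2 j).1 hb
        have := (hpick j).unique hi' hj
        subst this
        simp at hi)
      have hlink : I.Link ⟨⟨a, by omega⟩, S, I.pos ⟨a, by omega⟩, 0⟩
        ⟨⟨a + 1, ha⟩, S, I.pos ⟨a + 1, ha⟩, 0⟩ := .next _ _ _ rfl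
      refine ⟨l ++ _ :: l', S', h1.append ⟨hlink, h1'⟩, fun j => ?_, ?_⟩
      · rw [h2' j, h2 j]
        constructor
        · rintro (⟨i, hi, h⟩ | h)
          · exact ⟨i, by omega, h⟩
          · exact ⟨_, le_rfl, h⟩
        · rintro ⟨i, hi, h⟩
          rcases Nat.lt_or_ge a i with hlt | hge
          · have : i = ⟨a + 1, ha⟩ := Fin.ext (by simp; omega)
            exact Or.inr (this ▸ h)
          · exact Or.inl ⟨i, hge, h⟩
      · rw [h1.walkCost_append, h3, Finset.sum_range_succ _ (a + 1), dif_pos ha]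
        simp only [walkCost, h3', travel]
        simp [linkCost]
  obtain ⟨l, S, h1, h2, h3⟩ := key k (by omega)
  have hS : (S : ℕ) = 2 ^ m - 1 := by
    refine Nat.eq_of_testBit_eq fun j => ?_
    rw [Nat.testBit_two_pow_sub_one]
    rcases Nat.lt_or_ge j m with hj | hj
    · obtain ⟨i, hi, _⟩ := hpick ⟨j, hj⟩
      simpa [hj] using (h2 ⟨j, hj⟩).2 ⟨i, by omega, hi⟩
    · rw [Nat.testBit_lt_two_pow (S.2.trans_le (Nat.pow_le_pow_right (by norm_num) hj))]
      simp [hj]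
  have hg : (⟨⟨k, by omega⟩, S, I.pos ⟨k, by omega⟩, 0⟩ : TourState n m (k + 1)) = I.goal := by
    simp only [goal, TourState.mk.injEq]
    exact ⟨rfl, Fin.ext hS, rfl, trivial⟩
  rw [hg] at h1
  refine ⟨l, h1, h3.trans ?_⟩
  rw [Finset.sum_range, cost]
  exact Finset.sum_congr rfl fun i _ => by rw [dif_pos i.2]

/-! ### Existence of walks -/

theorem exists_walk_move (I : Instance n m k) (a : Fin k) (S : Fin (2 ^ m)) (c : Fin (m + 1))
    (u v : Fin n) : ∃ l, I.IsWalk ⟨a, S, u, c⟩ l ⟨a, S, v, c⟩ := by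
  obtain ⟨p⟩ := I.connected.preconnected u v
  induction p with
  | nil => exact ⟨[], rfl⟩
  | cons h p ih =>
    obtain ⟨l, hl⟩ := ih
    exact ⟨_ :: l, .move _ _ _ _ _ h, hl⟩

/-- A single agent can deliver the packages in the order of their indices, so the mask after `j` of
them is `2 ^ j - 1`. Connectedness supplies the routes. -/
theorem exists_walk_deliver (I : Instance n m k) (a : Fin k) (u v : Fin n) (j : ℕ) (hj : j ≤ m) :
    ∃ l, I.IsWalk ⟨a, ⟨0, by positivity⟩, u, 0⟩ l ⟨a, ⟨2 ^ j - 1,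
      (Nat.sub_lt (by positivity) one_pos).trans_le (Nat.pow_le_pow_right (by norm_num) hj)⟩, v, 0⟩ := by
  induction j generalizing v with
  | zero => exact exists_walk_move ..
  | succ j ih =>
    obtain ⟨l, hl⟩ := ih (I.src ⟨j, hj⟩) (by omega)
    obtain ⟨l1, hl1⟩ := I.exists_walk_move a ⟨2 ^ (j + 1) - 1,
      (Nat.sub_lt (by positivity) one_pos).trans_le (Nat.pow_le_pow_right (by norm_num) hj)⟩
      (Fin.succ ⟨j, hj⟩) (I.src ⟨j, hj⟩) (I.tgt ⟨j, hj⟩)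
    obtain ⟨l2, hl2⟩ := I.exists_walk_move a ⟨2 ^ (j + 1) - 1,
      (Nat.sub_lt (by positivity) one_pos).trans_le (Nat.pow_le_pow_right (by norm_num) hj)⟩
      0 (I.tgt ⟨j, hj⟩) v
    refine ⟨l ++ _ :: (l1 ++ _ :: l2), hl.append ⟨?_, hl1.append ⟨?_, hl2⟩⟩⟩
    · refine .pick _ _ _ _ ?_ (by simp [Nat.testBit_two_pow_sub_one])
      have := Nat.one_le_two_pow (n := j)
      simp only [pow_succ]
      omega
    · exact .drop _ _ _

theorem exists_walk_to_goal (I : Instance n m (k + 1)) : ∃ l, I.IsWalk I.start l I.goal := by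
  obtain ⟨l, hl⟩ := I.exists_walk_deliver 0 (I.pos 0) (I.pos 0) m le_rfl
  have key : ∀ (a : ℕ) (ha : a < k + 1), ∃ l, I.IsWalk I.start l
      ⟨⟨a, ha⟩, ⟨2 ^ m - 1, Nat.sub_lt (by positivity) one_pos⟩, I.pos ⟨a, ha⟩, 0⟩ := by
    intro a
    induction a with
    | zero => exact fun _ => ⟨l, hl⟩
    | succ a ih =>
      intro ha
      obtain ⟨l, hl⟩ := ih (by omega)
      exact ⟨l ++ [_], hl.append ⟨.next _ _ _ rfl, rfl⟩⟩
  exact key k (by omega)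

end Instance

end Delivery

namespace Delivery

/-! ### Codes of tour states -/

/-- The number of tour states. -/
def numStates (n m k : ℕ) : ℕ := k * (2 ^ m * (n * (m + 1)))

namespace TourState

variable {n m k : ℕ}

/-- The code of a tour state. -/
def enc (x : TourState n m k) : ℕ :=
  ((x.a * 2 ^ m + x.S) * n + x.v) * (m + 1) + x.c

theorem mul_add_div_mod {q r b : ℕ} (h : r < b) : (q * b + r) / b = q ∧ (q * b + r) % b = r := by
  have hb : 0 < b := by omega
  constructor
  · rw [add_comm, Nat.add_mul_div_right _ _ hb, Nat.div_eq_of_lt h, zero_add]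
  · rw [add_comm, Nat.add_mul_mod_self_right, Nat.mod_eq_of_lt h]

theorem enc_mod (x : TourState n m k) : x.enc % (m + 1) = x.c := (mul_add_div_mod x.c.2).2

theorem enc_div (x : TourState n m k) :
    x.enc / (m + 1) = (x.a * 2 ^ m + x.S) * n + x.v := (mul_add_div_mod x.c.2).1

theorem enc_div_mod (x : TourState n m k) : x.enc / (m + 1) % n = x.v := by
  rw [enc_div]; exact (mul_add_div_mod x.v.2).2

theorem enc_div_div (x : TourState n m k) : x.enc / (m + 1) / n = x.a * 2 ^ m + x.S := by
  rw [enc_div]; exact (mul_add_div_mod x.v.2).1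

theorem enc_div_div_mod (x : TourState n m k) : x.enc / (m + 1) / n % 2 ^ m = x.S := by
  rw [enc_div_div]; exact (mul_add_div_mod x.S.2).2

theorem enc_div_div_div (x : TourState n m k) : x.enc / (m + 1) / n / 2 ^ m = x.a := by
  rw [enc_div_div]; exact (mul_add_div_mod x.S.2).1

theorem enc_injective : Function.Injective (enc : TourState n m k → ℕ) := by
  intro x y h
  ext
  · rw [← x.enc_div_div_div, h, y.enc_div_div_div]
  · rw [← x.enc_div_div_mod, h, y.enc_div_div_mod]
  · rw [← x.enc_div_mod, h, y.enc_div_mod]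
  · rw [← x.enc_mod, h, y.enc_mod]

theorem mul_add_lt {a b q r : ℕ} (h : q < a) (h' : r < b) : q * b + r < a * b := by
  calc q * b + r < q * b + b := by omega
    _ = (q + 1) * b := by ring
    _ ≤ a * b := Nat.mul_le_mul_right _ h

theorem enc_lt (x : TourState n m k) : x.enc < numStates n m k := by
  have := mul_add_lt (mul_add_lt (mul_add_lt x.a.2 x.S.2) x.v.2) x.c.2
  refine this.trans_eq ?_
  simp only [numStates]
  ring

/-- Repeated division recovers the mixed-radix digits. Hence a program loop over all numbers below
`numStates` meets codes of states only. -/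
theorem exists_enc_eq {s : ℕ} (h : s < numStates n m k) : ∃ x : TourState n m k, x.enc = s := by
  have hn : 0 < n := by
    rcases Nat.eq_zero_or_pos n with rfl | hn
    · simp [numStates] at h
    · exact hn
  have hP : 0 < 2 ^ m := by positivity
  have e1 : k * (2 ^ m * (n * (m + 1))) = (m + 1) * (n * (2 ^ m * k)) := by ring
  have h1 : s / (m + 1) < n * (2 ^ m * k) :=
    Nat.div_lt_of_lt_mul (by rw [numStates, e1] at h; exact h)
  have h2 : s / (m + 1) / n < 2 ^ m * k := Nat.div_lt_of_lt_mul h1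
  have h3 : s / (m + 1) / n / 2 ^ m < k := Nat.div_lt_of_lt_mul h2
  refine ⟨⟨⟨_, h3⟩, ⟨_, Nat.mod_lt (s / (m + 1) / n) hP⟩, ⟨_, Nat.mod_lt (s / (m + 1)) hn⟩,
    ⟨_, Nat.mod_lt s m.succ_pos⟩⟩, ?_⟩
  simp only [enc]
  rw [Nat.div_add_mod', Nat.div_add_mod', Nat.div_add_mod']

instance : Finite (TourState n m k) :=
  Finite.of_injective (fun x => (⟨x.enc, x.enc_lt⟩ : Fin (numStates n m k))) fun x y h =>
    enc_injective (by simpa using h)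

end TourState

/-! ### Shortest walks -/

namespace Instance

variable {n m k : ℕ} {I : Instance n m k}

theorem IsWalk.exists_suffix {w : Fin k → ℝ} (hw : 0 ≤ w) {x y z : TourState n m k}
    {l : List (TourState n m k)} (h : I.IsWalk z l y) (hx : x ∈ z :: l) :
    ∃ l', I.IsWalk x l' y ∧ (x :: l').Sublist (z :: l) ∧ I.walkCost w x l' ≤ I.walkCost w z l := by
  induction l generalizing z with
  | nil =>
    obtain rfl : x = z := by simpa using hx
    exact ⟨[], h, .refl _, le_rfl⟩
  | cons u l ih =>
    rcases List.mem_cons.1 hx with rfl | hx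
    · exact ⟨_, h, .refl _, le_rfl⟩
    · obtain ⟨l', h1, h2, h3⟩ := ih h.2 hx
      exact ⟨l', h1, h2.cons _, h3.trans (le_add_of_nonneg_left (linkCost_nonneg hw _ _))⟩

/-- If the first state recurs, continuing directly from the recurrence cuts out a loop of
nonnegative weight. -/
theorem IsWalk.exists_nodup {w : Fin k → ℝ} (hw : 0 ≤ w) {x y : TourState n m k}
    {l : List (TourState n m k)} (h : I.IsWalk x l y) :
    ∃ l', I.IsWalk x l' y ∧ (x :: l').Nodup ∧ I.walkCost w x l' ≤ I.walkCost w x l := by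
  induction l generalizing x with
  | nil => exact ⟨[], h, by simp, le_rfl⟩
  | cons z l ih =>
    obtain ⟨l', h1, h2, h3⟩ := ih h.2
    by_cases hx : x ∈ z :: l'
    · obtain ⟨l2, g1, g2, g3⟩ := h1.exists_suffix hw hx
      exact ⟨l2, g1, h2.sublist g2, (g3.trans h3).trans
        (le_add_of_nonneg_left (linkCost_nonneg hw _ _))⟩
    · exact ⟨z :: l', ⟨h.1, h1⟩, List.nodup_cons.2 ⟨hx, h2⟩, by simpa [walkCost] using h3⟩

theorem IsWalk.pad (w : Fin k → ℝ) {x y : TourState n m k} {l : List (TourState n m k)}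
    (h : I.IsWalk x l y) (r : ℕ) :
    I.IsWalk x (l ++ List.replicate r y) y ∧
      I.walkCost w x (l ++ List.replicate r y) = I.walkCost w x l := by
  have key : I.IsWalk y (List.replicate r y) y ∧ I.walkCost w y (List.replicate r y) = 0 := by
    induction r with
    | zero => exact ⟨rfl, rfl⟩
    | succ r ih =>
      refine ⟨⟨.stay y, ih.1⟩, ?_⟩
      simp only [List.replicate_succ, walkCost, ih.2]
      simp [linkCost]
  exact ⟨h.append key.1, by rw [h.walkCost_append, key.2, add_zero]⟩

/-- A walk without repeated states has fewer edges than there are states, and free `stay` edges make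
up the difference. With the length fixed, finitely many walks compete and the recursion has to reach
only one layer. -/
theorem IsWalk.exists_length_eq {w : Fin k → ℝ} (hw : 0 ≤ w) {x y : TourState n m k}
    {l : List (TourState n m k)} (h : I.IsWalk x l y) :
    ∃ l', l'.length = numStates n m k ∧ I.IsWalk x l' y ∧
      I.walkCost w x l' ≤ I.walkCost w x l := by
  obtain ⟨l', h1, h2, h3⟩ := h.exists_nodup hw
  have hlen : (x :: l').length ≤ numStates n m k := by
    have : ((x :: l').map TourState.enc).Nodup := h2.map TourState.enc_injective
    have := Finset.card_le_card (s := ((x :: l').map TourState.enc).toFinset)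
      (t := Finset.range (numStates n m k)) (fun s hs => by
        simp only [List.mem_toFinset, List.mem_map] at hs
        obtain ⟨z, _, rfl⟩ := hs
        exact Finset.mem_range.2 z.enc_lt)
    rwa [List.toFinset_card_of_nodup (h2.map TourState.enc_injective), List.length_map,
      Finset.card_range] at this
  simp only [List.length_cons] at hlen
  obtain ⟨g1, g2⟩ := h1.pad w (numStates n m k - l'.length)
  refine ⟨_, ?_, g1, g2.trans_le h3⟩
  simp; omega

end Instance

/-! ### From cheapest walks to optimal solutions -/

namespace Instance

variable {n m k : ℕ} {I : Instance n m (k + 1)}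

/-- A cheapest walk of fixed length yields an optimal solution. -/
theorem IsWalk.optimal {w : Fin (k + 1) → ℝ} (hw : 0 ≤ w) {l : List (TourState n m (k + 1))}
    (h : I.IsWalk I.start l I.goal)
    (hmin : ∀ l', l'.length = numStates n m (k + 1) → I.IsWalk I.start l' I.goal →
      I.walkCost w I.start l ≤ I.walkCost w I.start l') :
    I.start.acts l ∈ I.RnoCStar ∧ ∀ x ∈ I.RnoCStar, I.cost (I.start.acts l) w ≤ I.cost x w := by
  refine ⟨h.mem_RnoCStar, fun x hx => ?_⟩
  obtain ⟨l', h1, h2⟩ := exists_walk_of_mem_RnoCStar hx w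
  obtain ⟨l2, g1, g2, g3⟩ := h1.exists_length_eq hw
  rw [h.cost_eq, ← h2]
  exact (hmin l2 g1 g2).trans g3

/-- There are infinitely many schedules, but the minimum over the finitely many walks of fixed
length is attained. This supplies the algorithm on instances with a single agent. -/
theorem exists_optimal (I : Instance n m (k + 1)) {w : Fin (k + 1) → ℝ} (hw : 0 ≤ w) :
    ∃ x ∈ I.RnoCStar, ∀ y ∈ I.RnoCStar, I.cost x w ≤ I.cost y w := by
  obtain ⟨l0, h0⟩ := I.exists_walk_to_goal
  obtain ⟨l1, h1, h2, _⟩ := h0.exists_length_eq hw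
  have hfin : {l : List (TourState n m (k + 1)) | l.length = numStates n m (k + 1) ∧
      I.IsWalk I.start l I.goal}.Finite :=
    (List.finite_length_eq _ (numStates n m (k + 1))).subset fun l hl => hl.1
  obtain ⟨l, hl, hmin⟩ := Set.exists_min_image _ (I.walkCost w I.start) hfin ⟨l1, h1, h2⟩
  have := hl.2.optimal hw fun l' h h' => hmin l' ⟨h, h'⟩
  exact ⟨_, this.1, this.2⟩

end Instance

/-! ### Removing an agent -/

namespace Action

/-- The same action in the instance with one more agent. -/
def lift {n m k : ℕ} (i : Fin (k + 1)) : Action n m k → Action n m (k + 1)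
  | .move a v => .move (i.succAbove a) v
  | .pick a j => .pick (i.succAbove a) j
  | .drop a j => .drop (i.succAbove a) j

end Action

namespace Instance

variable {n m k : ℕ} {I : Instance n m (k + 1)} {i : Fin (k + 1)}

/-- `C` extends the configuration `c` by the resting agent `i`. -/
structure Extends (I : Instance n m (k + 1)) (i : Fin (k + 1)) (c : Config n m k)
    (C : Config n m (k + 1)) : Prop where
  self : C.pos i = I.pos i
  pos : ∀ a, C.pos (i.succAbove a) = c.pos a
  loc : ∀ j, C.loc j = Sum.map id i.succAbove (c.loc j)

theorem Step.lift {c d : Config n m k} {a : Action n m k} (h : (I.remove i).Step c a d)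
    {C : Config n m (k + 1)} (hC : I.Extends i c C) :
    ∃ D, I.Step C (a.lift i) D ∧ I.Extends i d D := by
  cases h with
  | move a v h =>
    refine ⟨_, .move _ _ _ (by rw [hC.pos]; exact h), ?_, fun b => ?_, hC.loc⟩
    · simp [hC.self]
    · rcases eq_or_ne b a with rfl | hne
      · simp
      · simp [hC.pos, hne]
  | pick a j h hfree =>
    refine ⟨_, .pick _ _ _ (by rw [hC.pos, hC.loc, h]; rfl) (fun j' => ?_), hC.self, hC.pos,
      fun j' => ?_⟩
    · rw [hC.loc]
      intro e
      have := hfree j'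
      rcases hj : c.loc j' with u | b <;> rw [hj] at e this <;> simp_all
    · rcases eq_or_ne j' j with rfl | hne
      · simp
      · simp [Function.update_of_ne hne, hC.loc]
  | drop a j h =>
    refine ⟨_, .drop _ _ _ (by rw [hC.loc, h]; rfl), hC.self, hC.pos, fun j' => ?_⟩
    rcases eq_or_ne j' j with rfl | hne
    · simp [hC.pos]
    · simp [Function.update_of_ne hne, hC.loc]

theorem Runs.lift {c d : Config n m k} {x : Schedule n m k} (h : (I.remove i).Runs c x d)
    {C : Config n m (k + 1)} (hC : I.Extends i c C) :
    ∃ D, I.Runs C (x.map (Action.lift i)) D ∧ I.Extends i d D := by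
  induction h generalizing C with
  | nil => exact ⟨C, .nil _, hC⟩
  | cons hs _ ih =>
    obtain ⟨D, h1, h2⟩ := hs.lift hC
    obtain ⟨E, h3, h4⟩ := ih h2
    exact ⟨E, .cons h1 h3, h4⟩

theorem travelFrom_lift (i : Fin (k + 1)) (a : Fin k) (u : Fin n) (x : Schedule n m k) :
    I.travelFrom (i.succAbove a) u (x.map (Action.lift i)) = (I.remove i).travelFrom a u x := by
  induction x generalizing u with
  | nil => rfl
  | cons b x ih =>
    cases b <;> simp [Action.lift, travelFrom, ih, remove]

theorem travelFrom_lift_self (i : Fin (k + 1)) (u : Fin n) (x : Schedule n m k) :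
    I.travelFrom i u (x.map (Action.lift i)) = 0 := by
  induction x generalizing u with
  | nil => rfl
  | cons b x ih =>
    cases b <;> simp [Action.lift, travelFrom, ih, Fin.succAbove_ne]

/-- The added agent never acts, so it ends where it started and handles no package. -/
theorem lift_mem_RnoCStar {x : Schedule n m k} (hx : x ∈ (I.remove i).RnoCStar) :
    x.map (Action.lift i) ∈ I.RnoCStar := by
  obtain ⟨⟨⟨c, hr, hloc⟩, hpick⟩, hdrop, c', hr', hpos⟩ := hx
  obtain rfl := hr.unique hr'
  obtain ⟨C, h1, h2⟩ := hr.lift (C := I.init) ⟨rfl, fun _ => rfl, fun _ => rfl⟩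
  refine ⟨⟨⟨C, h1, fun j => by rw [h2.loc, hloc]; rfl⟩, fun j => ?_⟩, fun j => ?_, C, h1, ?_⟩
  · obtain ⟨a, ha, hu⟩ := hpick j
    refine ⟨i.succAbove a, List.mem_map.2 ⟨_, ha, rfl⟩, fun b hb => ?_⟩
    obtain ⟨y, hy, hyb⟩ := List.mem_map.1 hb
    cases y <;> simp only [Action.lift, reduceCtorEq, Action.pick.injEq] at hyb
    obtain ⟨rfl, rfl⟩ := hyb
    rw [hu _ hy]
  · rw [List.countP_map]
    convert hdrop j using 2
    funext y
    cases y <;> rfl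
  · funext b
    rcases Fin.eq_self_or_eq_succAbove i b with rfl | ⟨a, rfl⟩
    · exact h2.self
    · rw [h2.pos, hpos]; rfl

theorem cost_lift (x : Schedule n m k) (w : Fin (k + 1) → ℝ) :
    I.cost (x.map (Action.lift i)) w = (I.remove i).cost x (fun a => w (i.succAbove a)) := by
  rw [cost, Fin.sum_univ_succAbove _ i]
  simp only [travel, travelFrom_lift_self, mul_zero, zero_add, travelFrom_lift]
  rfl

end Instance

/-! ### The VCG mechanism -/

namespace Algorithm

variable {A : Algorithm} {n m k : ℕ}

theorem cost_eq_add_sum_erase (I : Instance n m k) (x : Schedule n m k) (w : Fin k → ℝ)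
    (i : Fin k) : I.cost x w = w i * I.travel i x +
      ∑ j ∈ Finset.univ.erase i, w j * I.travel j x :=
  (Finset.add_sum_erase _ _ (Finset.mem_univ i)).symm

/-- Under either report, the utility of `i` is the pivot term minus the cost of the chosen schedule
for the vector with the true weight of `i`. The pivot term is common to both, and the truthful
report minimizes the cost. -/
theorem MinimizesOverRnoCStar.truthful (hA : A.MinimizesOverRnoCStar) (I : Instance n m (k + 1)) :
    (A.vcg I).Truthful I := by
  intro w' hw' i wi hwi
  have hu : 0 ≤ Function.update w' i wi := by
    intro j
    rcases eq_or_ne j i with rfl | hj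
    · simpa using hwi
    · simpa [Function.update_of_ne hj] using hw' j
  -- Minimality at the true weight is tested against the schedule chosen for the report `w'`.
  have hmin := (hA (Nat.succ_pos k) I _ hu).2 _ (hA (Nat.succ_pos k) I _ hw').1
  rw [cost_eq_add_sum_erase _ _ _ i, cost_eq_add_sum_erase _ _ _ i] at hmin
  have hs : ∀ x : Schedule n m (k + 1), ∑ j ∈ Finset.univ.erase i,
      Function.update w' i wi j * I.travel j x =
      ∑ j ∈ Finset.univ.erase i, w' j * I.travel j x := fun x =>
    Finset.sum_congr rfl fun j hj => by rw [Function.update_of_ne (Finset.ne_of_mem_erase hj)]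
  have hr : (fun j => Function.update w' i wi (i.succAbove j)) = fun j => w' (i.succAbove j) :=
    funext fun j => Function.update_of_ne (Fin.succAbove_ne i j) _ _
  simp only [vcg, hr]
  rw [hs, hs] at *
  simp only [Function.update_self] at hmin
  linarith

/-- The utility of a truthful agent is the optimum without it minus the optimum with it, and a
lifted solution shows that the former is at least the latter. -/
theorem MinimizesOverRnoCStar.voluntaryParticipation (hA : A.MinimizesOverRnoCStar) (hk : 1 ≤ k)
    (I : Instance n m (k + 1)) : (A.vcg I).VoluntaryParticipation I := by
  intro w' hw' i
  have h1 := hA hk (I.remove i) (fun j => w' (i.succAbove j)) (fun j => hw' _)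
  have h2 := (hA (Nat.succ_pos k) I _ hw').2 _ (Instance.lift_mem_RnoCStar h1.1)
  rw [Instance.cost_lift, cost_eq_add_sum_erase _ _ _ i] at h2
  simp only [vcg]
  linarith

end Algorithm

end Delivery

namespace Delivery

/-! ### Reasoning about programs -/

namespace Mem

@[simp] theorem setNat_nat (σ : Mem) (a i v b j : ℕ) :
    (σ.setNat a i v).nat b j = if b = a ∧ j = i then v else σ.nat b j := by
  by_cases hb : b = a
  · subst hb
    by_cases hj : j = i
    · subst hj; simp [setNat]
    · simp [setNat, hj]
  · simp [setNat, hb]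

@[simp] theorem setNat_real (σ : Mem) (a i v : ℕ) : (σ.setNat a i v).real = σ.real := rfl

@[simp] theorem setReal_real (σ : Mem) (a i : ℕ) (v : ℝ) (b j : ℕ) :
    (σ.setReal a i v).real b j = if b = a ∧ j = i then v else σ.real b j := by
  by_cases hb : b = a
  · subst hb
    by_cases hj : j = i
    · subst hj; simp [setReal]
    · simp [setReal, hj]
  · simp [setReal, hb]

@[simp] theorem setReal_nat (σ : Mem) (a i : ℕ) (v : ℝ) : (σ.setReal a i v).nat = σ.nat := rfl

end Mem

/-- `Frame X Y σ τ`: the memories agree outside of the arrays `X` of natural numbers and the arrays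
`Y` of real numbers. -/
structure Frame (X Y : List ℕ) (σ τ : Mem) : Prop where
  nat : ∀ a, a ∉ X → ∀ i, τ.nat a i = σ.nat a i
  real : ∀ a, a ∉ Y → ∀ i, τ.real a i = σ.real a i

namespace Frame

variable {X X' Y Y' : List ℕ} {σ τ ρ : Mem}

theorem refl (X Y : List ℕ) (σ : Mem) : Frame X Y σ σ := ⟨fun _ _ _ => rfl, fun _ _ _ => rfl⟩

theorem trans (h : Frame X Y σ τ) (h' : Frame X Y τ ρ) : Frame X Y σ ρ :=
  ⟨fun a ha i => (h'.nat a ha i).trans (h.nat a ha i),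
    fun a ha i => (h'.real a ha i).trans (h.real a ha i)⟩

theorem mono (h : Frame X Y σ τ) (hX : X ⊆ X') (hY : Y ⊆ Y') : Frame X' Y' σ τ :=
  ⟨fun a ha => h.nat a fun h => ha (hX h), fun a ha => h.real a fun h => ha (hY h)⟩

theorem setNat (h : Frame X Y σ τ) {a : ℕ} (ha : a ∈ X) (i v : ℕ) :
    Frame X Y σ (τ.setNat a i v) :=
  ⟨fun b hb j => by
    rw [Mem.setNat_nat, if_neg (fun e : b = a ∧ j = i => hb (e.1 ▸ ha)), h.nat b hb], h.real⟩

theorem setReal (h : Frame X Y σ τ) {a : ℕ} (ha : a ∈ Y) (i : ℕ) (v : ℝ) :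
    Frame X Y σ (τ.setReal a i v) :=
  ⟨h.nat, fun b hb j => by
    rw [Mem.setReal_real, if_neg (fun e : b = a ∧ j = i => hb (e.1 ▸ ha)), h.real b hb]⟩

end Frame

/-- The program halts, and the final memory and the running time satisfy `Q`. -/
def Wp (p : Prog) (Q : Mem → ℕ → Prop) (σ : Mem) : Prop := ∃ τ t, Exec p σ τ t ∧ Q τ t

infixr:60 " ;; " => Prog.seq

namespace Wp

variable {p q : Prog} {P Q : Mem → ℕ → Prop} {σ : Mem}

theorem mono (h : Wp p P σ) (hPQ : ∀ τ t, P τ t → Q τ t) : Wp p Q σ := by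
  obtain ⟨τ, t, h1, h2⟩ := h
  exact ⟨τ, t, h1, hPQ _ _ h2⟩

theorem seq (h : Wp p P σ) (h' : ∀ τ s, P τ s → Wp q (fun ρ t => Q ρ (s + t)) τ) :
    Wp (p ;; q) Q σ := by
  obtain ⟨τ, s, h1, h2⟩ := h
  obtain ⟨ρ, t, h3, h4⟩ := h' τ s h2
  exact ⟨ρ, _, .seq h1 h3, h4⟩

theorem skip (h : Q σ 1) : Wp .skip Q σ := ⟨_, _, .skip σ, h⟩

theorem setN {a : ℕ} {i e : NExp}
    (h : Q (σ.setNat a (i.eval σ) (e.eval σ)) (1 + i.time σ + e.time σ)) :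
    Wp (.setN a i e) Q σ := ⟨_, _, .setN a i e σ, h⟩

theorem setR {a : ℕ} {i : NExp} {e : RExp}
    (h : Q (σ.setReal a (i.eval σ) (e.eval σ)) (1 + i.time σ + e.time σ)) :
    Wp (.setR a i e) Q σ := ⟨_, _, .setR a i e σ, h⟩

theorem setN_seq {a : ℕ} {i e : NExp}
    (h : Wp q (fun ρ t => Q ρ (1 + i.time σ + e.time σ + t))
      (σ.setNat a (i.eval σ) (e.eval σ))) :
    Wp (.setN a i e ;; q) Q σ :=
  seq (P := fun τ s => τ = σ.setNat a (i.eval σ) (e.eval σ) ∧ s = 1 + i.time σ + e.time σ)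
    (setN ⟨rfl, rfl⟩) (by rintro _ _ ⟨rfl, rfl⟩; exact h)

theorem setR_seq {a : ℕ} {i : NExp} {e : RExp}
    (h : Wp q (fun ρ t => Q ρ (1 + i.time σ + e.time σ + t))
      (σ.setReal a (i.eval σ) (e.eval σ))) :
    Wp (.setR a i e ;; q) Q σ :=
  seq (P := fun τ s => τ = σ.setReal a (i.eval σ) (e.eval σ) ∧ s = 1 + i.time σ + e.time σ)
    (setR ⟨rfl, rfl⟩) (by rintro _ _ ⟨rfl, rfl⟩; exact h)

theorem cond {b : Test} (h1 : b.Holds σ → Wp p (fun τ t => Q τ (1 + b.time σ + t)) σ)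
    (h2 : ¬ b.Holds σ → Wp q (fun τ t => Q τ (1 + b.time σ + t)) σ) : Wp (.cond b p q) Q σ := by
  by_cases hb : b.Holds σ
  · obtain ⟨τ, t, h3, h4⟩ := h1 hb
    exact ⟨τ, _, .condTrue hb h3, h4⟩
  · obtain ⟨τ, t, h3, h4⟩ := h2 hb
    exact ⟨τ, _, .condFalse hb h3, h4⟩

theorem loop_true {b : Test} (hb : b.Holds σ) (h : Wp p P σ)
    (h' : ∀ τ s, P τ s → Wp (.loop b p) (fun ρ t => Q ρ (1 + b.time σ + s + t)) τ) :
    Wp (.loop b p) Q σ := by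
  obtain ⟨τ, s, h1, h2⟩ := h
  obtain ⟨ρ, t, h3, h4⟩ := h' τ s h2
  exact ⟨ρ, _, .loopTrue hb h1 h3, h4⟩

theorem loop_false {b : Test} (hb : ¬ b.Holds σ) (h : Q σ (1 + b.time σ)) :
    Wp (.loop b p) Q σ := ⟨σ, _, .loopFalse hb, h⟩

end Wp

/-! ### Derived constructs: counting loops, division, tests -/

/-- The scalar variable stored at index 0 of an array. -/
def V (a : ℕ) : NExp := .get a (.const 0)

/-- Run `p` with the variable `x` ranging from 0 to the entry `c` of array `a`, exclusively. -/
def forTo (x a c : ℕ) (p : Prog) : Prog :=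
  .setN x (.const 0) (.const 0) ;;
    .loop (.leN (.add (V x) (.const 1)) (.get a (.const c)))
      (p ;; .setN x (.const 0) (.add (V x) (.const 1)))

/-- A round costs 8 for the test, `T` for the body and 6 for the increment; the final 11 are the
initialization and the failing test. The invariant must fix the bound because it is read from memory
again in every round. -/
theorem Wp.forTo {x a c : ℕ} {p : Prog} {σ : Mem} (b T : ℕ) (Inv : ℕ → Mem → Prop)
    (h0 : Inv 0 (σ.setNat x 0 0))
    (hb : ∀ i τ, Inv i τ → τ.nat a c = b)
    (hx : ∀ i τ, Inv i τ → τ.nat x 0 = i)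
    (hp : ∀ i < b, ∀ τ, Inv i τ →
      Wp p (fun ρ t => ρ.nat x 0 = i ∧ Inv (i + 1) (ρ.setNat x 0 (i + 1)) ∧ t ≤ T) τ) :
    Wp (forTo x a c p) (fun τ t => Inv b τ ∧ t ≤ b * (T + 14) + 11) σ := by
  refine .setN_seq ?_
  simp only [NExp.eval, NExp.time]
  have key : ∀ d i, i + d = b → ∀ τ, Inv i τ →
      Wp (.loop (.leN (.add (V x) (.const 1)) (.get a (.const c)))
        (p ;; .setN x (.const 0) (.add (V x) (.const 1))))
        (fun ρ t => Inv b ρ ∧ t ≤ d * (T + 14) + 8) τ := by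
    intro d
    induction d with
    | zero =>
      intro i hi τ hτ
      refine .loop_false ?_ ?_
      · simp only [Test.Holds, V, NExp.eval, hb _ _ hτ, hx _ _ hτ]
        omega
      · simp only [Test.time, V, NExp.time]
        exact ⟨by rwa [← hi] , by omega⟩
    | succ d ih =>
      intro i hi τ hτ
      refine .loop_true (P := fun ρ t => Inv (i + 1) ρ ∧ t ≤ T + 6) ?_ ?_ ?_
      · simp only [Test.Holds, V, NExp.eval, hb _ _ hτ, hx _ _ hτ]
        omega
      · refine (hp i (by omega) τ hτ).seq fun ρ s hρ => .setN ?_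
        simp only [V, NExp.eval, NExp.time, hρ.1]
        exact ⟨hρ.2.1, by have := hρ.2.2; omega⟩
      · intro ρ s hρ
        refine (ih (i + 1) (by omega) ρ hρ.1).mono fun ρ' t ht => ⟨ht.1, ?_⟩
        simp only [Test.time, V, NExp.time]
        have e : (d + 1) * (T + 14) = d * (T + 14) + T + 14 := by ring
        have := hρ.2
        have := ht.2
        omega
  refine (key b 0 (by omega) _ h0).mono fun τ t ht => ⟨ht.1, ?_⟩
  have := ht.2
  omega

/-- Division with remainder by repeated subtraction. -/
def divMod (q r : ℕ) (e f : NExp) : Prog :=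
  .setN r (.const 0) e ;; .setN q (.const 0) (.const 0) ;;
    .loop (.leN f (V r))
      (.setN r (.const 0) (.sub (V r) f) ;; .setN q (.const 0) (.add (V q) (.const 1)))

/-- The machine has no division. Time linear in the dividend is affordable, since only codes of
states and numbers derived from them by division are divided. The divisor is evaluated in every
round, so it must not depend on `q` and `r`. -/
theorem Wp.divMod {q r : ℕ} {e f : NExp} {σ : Mem} (x y : ℕ) (hqr : q ≠ r) (hy : 0 < y)
    (hx : e.eval σ = x) (he : e.time σ ≤ 2)
    (hf : ∀ τ, Frame [q, r] [] σ τ → f.eval τ = y ∧ f.time τ ≤ 5) :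
    Wp (divMod q r e f) (fun τ t => Frame [q, r] [] σ τ ∧ τ.nat q 0 = x / y ∧
      τ.nat r 0 = x % y ∧ t ≤ 25 * (x + 1)) σ := by
  have key : ∀ x c τ, Frame [q, r] [] σ τ → τ.nat r 0 = x → τ.nat q 0 = c →
      Wp (.loop (.leN f (V r))
        (.setN r (.const 0) (.sub (V r) f) ;; .setN q (.const 0) (.add (V q) (.const 1))))
        (fun ρ t => Frame [q, r] [] σ ρ ∧ ρ.nat q 0 = c + x / y ∧ ρ.nat r 0 = x % y ∧
          t ≤ 25 * x + 9) τ := by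
    intro x
    induction x using Nat.strong_induction_on with
    | _ x ih =>
      intro c τ hτ hr hq
      obtain ⟨hf1, hf2⟩ := hf τ hτ
      by_cases hxy : y ≤ x
      · refine .loop_true (P := fun ρ t => Frame [q, r] [] σ ρ ∧ ρ.nat r 0 = x - y ∧
          ρ.nat q 0 = c + 1 ∧ t ≤ 16) ?_ ?_ ?_
        · simpa only [Test.Holds, V, NExp.eval, hf1, hr] using hxy
        · refine .setN_seq (.setN ?_)
          refine ⟨(hτ.setNat (by simp) _ _).setNat (by simp) _ _, ?_, ?_, ?_⟩
          · simp [V, NExp.eval, hf1, hr, hqr.symm]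
          · simp [V, NExp.eval, hq, hqr]
          · simp only [V, NExp.time]
            omega
        · rintro ρ s ⟨h1, h2, h3, h4⟩
          refine (ih (x - y) (by omega) _ ρ h1 h2 h3).mono ?_
          rintro ρ' t ⟨g1, g2, g3, g4⟩
          refine ⟨g1, ?_, ?_, ?_⟩
          · rw [g2, Nat.div_eq_sub_div hy hxy]; ring
          · rw [g3, Nat.mod_eq_sub_mod hxy]
          · simp only [Test.time, V, NExp.time]
            omega
      · refine .loop_false ?_ ?_
        · simpa only [Test.Holds, V, NExp.eval, hf1, hr] using hxy
        · refine ⟨hτ, ?_, ?_, ?_⟩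
          · rw [Nat.div_eq_of_lt (by omega), hq]; rfl
          · rw [Nat.mod_eq_of_lt (by omega), hr]
          · simp only [Test.time, V, NExp.time]
            omega
  refine .setN_seq (.setN_seq ?_)
  simp only [NExp.eval, NExp.time, hx]
  refine (key x 0 _ (((Frame.refl _ _ σ).setNat (by simp) _ _).setNat (by simp) _ _)
    (by simp [hqr.symm]) (by simp)).mono ?_
  rintro ρ t ⟨g1, g2, g3, g4⟩
  exact ⟨g1, by omega, g3, by omega⟩

/-- Equality of natural numbers. -/
def Test.eqN (e f : NExp) : Test := .and (.leN e f) (.leN f e)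

/-- Disjunction. -/
def Test.or (b c : Test) : Test := .not (.and (.not b) (.not c))

@[simp] theorem Test.holds_eqN (σ : Mem) (e f : NExp) :
    (Test.eqN e f).Holds σ ↔ e.eval σ = f.eval σ := by
  simp only [eqN, Holds]; omega

@[simp] theorem Test.holds_or (σ : Mem) (b c : Test) :
    (Test.or b c).Holds σ ↔ b.Holds σ ∨ c.Holds σ := by
  simp only [or, Holds]; tauto

end Delivery

namespace Delivery

/-! ### The program

Arrays of natural numbers used besides input and output: 10 powers of two, 11 starting positions of
the agents present, 12 to 17 components of the tour states (agent, mask, node, carried package,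
bit of the mask at the carried package, row offset in the adjacency matrix), 20 reachability of the
goal, 21 next state. Arrays of real numbers: 3 weights of the agents present, 4 distances to the
goal, 5 optimal costs of the subinstances, 6 shares of the agents, 7 weight of an edge. All other
names are scalar variables. -/

/-- Exponentiation is not an operation of the machine, so powers of two are tabulated by doubling.
Scalars used throughout: 32 number of states, 33 number of agents loaded, 34 and 35 codes of goal
and start, 37 offset of the current layer in the distance arrays, 51 agent left out. -/
def powProg : Prog :=
  .setN 10 (.const 0) (.const 1) ;;
    forTo 30 0 1 (.setN 10 (.add (V 30) (.const 1)) (.add (.get 10 (V 30)) (.get 10 (V 30))))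

/-- Compute the number of tour states for the number of agents in variable 33. -/
def sizeProg : Prog :=
  .setN 32 (.const 0) (.mul (V 33) (.mul (.get 10 (.get 0 (.const 1)))
    (.mul (.get 0 (.const 0)) (.add (.get 0 (.const 1)) (.const 1)))))

/-- Compute the components of the state with the code in variable 30. -/
def decodeBody : Prog :=
  divMod 40 41 (V 30) (.add (.get 0 (.const 1)) (.const 1)) ;;
  divMod 42 43 (V 40) (.get 0 (.const 0)) ;;
  divMod 44 45 (V 42) (.get 10 (.get 0 (.const 1))) ;;
  divMod 46 47 (V 45) (.get 10 (.sub (V 41) (.const 1))) ;;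
  divMod 48 49 (V 46) (.const 2) ;;
  .setN 12 (V 30) (V 44) ;; .setN 13 (V 30) (V 45) ;; .setN 14 (V 30) (V 43) ;;
  .setN 15 (V 30) (V 41) ;; .setN 16 (V 30) (V 49) ;;
  .setN 17 (V 30) (.mul (V 43) (.get 0 (.const 0)))

def decodeProg : Prog := forTo 30 32 0 decodeBody

/-- Load the agents except the one in variable 51. -/
def loadProg : Prog :=
  .setN 33 (.const 0) (.const 0) ;;
  forTo 52 0 2 (.cond (.eqN (V 51) (V 52)) .skip
    (.setN 11 (V 33) (.get 1 (V 52)) ;; .setR 3 (V 33) (.get 1 (V 52)) ;;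
      .setN 33 (.const 0) (.add (V 33) (.const 1))))

/-- The weight of the edge between the states with the given codes. -/
def linkCostProg (s s' : NExp) : Prog :=
  .cond (.eqN (.get 12 s) (.get 12 s'))
    (.setR 7 (.const 0) (.mul (.get 3 (.get 12 s)) (.get 0 (.add (.get 17 s) (.get 14 s')))))
    (.setR 7 (.const 0) .zero)

/-- Whether the states with the given codes are joined by an edge. -/
def linkTest (s s' : NExp) : Test :=
  .or (.eqN s s')
  (.or (.and (.eqN (.get 12 s) (.get 12 s')) (.and (.eqN (.get 13 s) (.get 13 s'))
    (.and (.eqN (.get 15 s) (.get 15 s'))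
      (.eqN (.get 4 (.add (.get 17 s) (.get 14 s'))) (.const 1)))))
  (.or (.and (.eqN (.get 12 s) (.get 12 s')) (.and (.eqN (.get 14 s) (.get 14 s'))
    (.and (.eqN (.get 15 s) (.const 0)) (.and (.leN (.const 1) (.get 15 s'))
    (.and (.eqN (.get 2 (.sub (.get 15 s') (.const 1))) (.get 14 s))
    (.and (.eqN (.get 13 s') (.add (.get 13 s) (.get 10 (.sub (.get 15 s') (.const 1)))))
      (.eqN (.get 16 s') (.const 1))))))))
  (.or (.and (.eqN (.get 12 s) (.get 12 s')) (.and (.eqN (.get 14 s) (.get 14 s'))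
    (.and (.eqN (.get 13 s) (.get 13 s')) (.and (.eqN (.get 15 s') (.const 0))
    (.and (.leN (.const 1) (.get 15 s))
      (.eqN (.get 3 (.sub (.get 15 s) (.const 1))) (.get 14 s)))))))
  (.and (.eqN (.get 12 s') (.add (.get 12 s) (.const 1))) (.and (.eqN (.get 13 s) (.get 13 s'))
    (.and (.eqN (.get 15 s) (.const 0)) (.and (.eqN (.get 15 s') (.const 0))
    (.and (.eqN (.get 14 s) (.get 11 (.get 12 s)))
      (.eqN (.get 14 s') (.get 11 (.get 12 s')))))))))))

/-- Try the edge from the state in variable 39 to the state in variable 50. -/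
def relaxProg : Prog :=
  linkCostProg (V 39) (V 50) ;;
  .cond (.and (linkTest (V 39) (V 50)) (.and (.eqN (.get 20 (.add (V 37) (V 50))) (.const 1))
      (.or (.not (.eqN (.get 20 (.add (V 37) (.add (V 32) (V 39)))) (.const 1)))
        (.not (.leR (.get 4 (.add (V 37) (.add (V 32) (V 39))))
          (.add (.get 7 (.const 0)) (.get 4 (.add (V 37) (V 50)))))))))
    (.setN 20 (.add (V 37) (.add (V 32) (V 39))) (.const 1) ;;
      .setN 21 (.add (V 37) (.add (V 32) (V 39))) (V 50) ;;
      .setR 4 (.add (V 37) (.add (V 32) (V 39)))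
        (.add (.get 7 (.const 0)) (.get 4 (.add (V 37) (V 50)))))
    .skip

/-- Compute the cheapest walks to the goal of the state in variable 39. -/
def entryProg : Prog :=
  .setN 20 (.add (V 37) (.add (V 32) (V 39))) (.const 0) ;; forTo 50 32 0 relaxProg

/-- Compute the cheapest walks to the goal with one edge more. -/
def layerProg : Prog :=
  forTo 39 32 0 entryProg ;; .setN 37 (.const 0) (.add (V 37) (V 32))

/-- Compute the cheapest walks to the goal in the tour graph of the agents loaded. -/
def solveProg : Prog :=
  sizeProg ;;
  .setN 34 (.const 0) (.mul (.add (.mul (.add (.mul (.sub (V 33) (.const 1))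
      (.get 10 (.get 0 (.const 1)))) (.sub (.get 10 (.get 0 (.const 1))) (.const 1)))
    (.get 0 (.const 0))) (.get 11 (.sub (V 33) (.const 1)))) (.add (.get 0 (.const 1)) (.const 1))) ;;
  .setN 35 (.const 0) (.mul (.get 11 (.const 0)) (.add (.get 0 (.const 1)) (.const 1))) ;;
  forTo 36 32 0 (.setN 20 (V 36) (.const 0)) ;;
  .setN 20 (V 34) (.const 1) ;; .setR 4 (V 34) .zero ;;
  .setN 37 (.const 0) (.const 0) ;;
  forTo 38 32 0 layerProg

/-- Solve the instance without the agent in variable 51 and record the cost. -/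
def subProg : Prog :=
  loadProg ;; solveProg ;; .setR 5 (V 51) (.get 4 (.add (V 37) (V 35)))

/-- Append an action to the output. -/
def emitProg (c a z : NExp) : Prog :=
  .setN 6 (.get 5 (.const 0)) c ;; .setN 7 (.get 5 (.const 0)) a ;;
  .setN 8 (.get 5 (.const 0)) z ;; .setN 5 (.const 0) (.add (.get 5 (.const 0)) (.const 1))

/-- Append the actions performed along the edge from the state in variable 53 to the state in
variable 55. -/
def actProg : Prog :=
  .cond (.eqN (.get 12 (V 53)) (.get 12 (V 55)))
    (.cond (.eqN (.get 14 (V 53)) (.get 14 (V 55)))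
      (.cond (.eqN (.get 15 (V 53)) (.get 15 (V 55))) .skip
        (.cond (.leN (.const 1) (.get 15 (V 55)))
          (emitProg (.const 1) (.get 12 (V 53)) (.sub (.get 15 (V 55)) (.const 1)))
          (emitProg (.const 2) (.get 12 (V 53)) (.sub (.get 15 (V 53)) (.const 1)))))
      (emitProg (.const 0) (.get 12 (V 53)) (.get 14 (V 55))))
    .skip

/-- One step along the pointers in array 21: the weight of the edge is credited to the acting agent,
and 37 descends by one layer. -/
def extractBody : Prog :=
  .setN 55 (.const 0) (.get 21 (.add (V 37) (V 53))) ;;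
  linkCostProg (V 53) (V 55) ;;
  .setR 6 (.get 12 (V 53)) (.add (.get 6 (.get 12 (V 53))) (.get 7 (.const 0))) ;;
  actProg ;;
  .setN 53 (.const 0) (V 55) ;; .setN 37 (.const 0) (.sub (V 37) (V 32))

/-- Output the schedule. -/
def extractProg : Prog :=
  .setN 53 (.const 0) (V 35) ;; forTo 54 32 0 extractBody

/-- Output the payments. -/
def payProg : Prog :=
  forTo 56 0 2 (.setR 2 (V 56)
    (.sub (.get 5 (V 56)) (.sub (.get 5 (.get 0 (.const 2))) (.get 6 (V 56)))))

/-- The VCG mechanism. -/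
def mainProg : Prog :=
  powProg ;; .setN 33 (.const 0) (.get 0 (.const 2)) ;; sizeProg ;; decodeProg ;;
  -- After the loop, variable 51 equals the number of agents, so the second `subProg` leaves nobody
  -- out. It records the full optimum behind the reduced ones and leaves the tables that
  -- `extractProg` follows.
  forTo 51 0 2 subProg ;; subProg ;; extractProg ;; payProg

/-! ### Invariants -/

variable {n m k : ℕ}

/-- The tables hold the components of a tour state. -/
structure Row (τ : Mem) (x : TourState n m k) : Prop where
  a : τ.nat 12 x.enc = x.a
  S : τ.nat 13 x.enc = x.S
  v : τ.nat 14 x.enc = x.v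
  c : τ.nat 15 x.enc = x.c
  -- For `x.c = 0` truncated subtraction yields bit 0; the value is irrelevant because the pick-up
  -- test also demands a carried package.
  bit : τ.nat 16 x.enc = x.S / 2 ^ ((x.c : ℕ) - 1) % 2
  off : τ.nat 17 x.enc = x.v * n

open Classical in
/-- The memory holds the graph and the packages of the instance. -/
structure Holds (I : Instance n m k) (τ : Mem) : Prop where
  nodes : τ.nat 0 0 = n
  packages : τ.nat 0 1 = m
  src : ∀ j : Fin m, τ.nat 2 j = I.src j
  tgt : ∀ j : Fin m, τ.nat 3 j = I.tgt j
  adj : ∀ u v : Fin n, τ.nat 4 (u * n + v) = if I.G.Adj u v then 1 else 0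
  len : ∀ u v : Fin n, τ.real 0 (u * n + v) = if I.G.Adj u v then I.len s(u, v) else 0

/-- The memory holds the instance and the tables for solving it. -/
structure Tabled (I : Instance n m k) (τ : Mem) : Prop extends Holds I τ where
  pow : ∀ j ≤ m, τ.nat 10 j = 2 ^ j
  row : ∀ x : TourState n m k, Row τ x

/-- The memory holds the instance, the tables, the agents and the weights. -/
structure Loaded (I : Instance n m k) (w : Fin k → ℝ) (τ : Mem) : Prop extends Tabled I τ where
  agents : τ.nat 33 0 = k
  pos : ∀ i : Fin k, τ.nat 11 i = I.pos i
  weight : ∀ i : Fin k, τ.real 3 i = w i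

theorem Row.frame {σ τ : Mem} {X Y : List ℕ} {x : TourState n m k} (h : Row σ x)
    (hF : Frame X Y σ τ) (hX : ∀ a ∈ [12, 13, 14, 15, 16, 17], a ∉ X) : Row τ x := by
  constructor
  · rw [hF.nat 12 (hX _ (by simp)), h.a]
  · rw [hF.nat 13 (hX _ (by simp)), h.S]
  · rw [hF.nat 14 (hX _ (by simp)), h.v]
  · rw [hF.nat 15 (hX _ (by simp)), h.c]
  · rw [hF.nat 16 (hX _ (by simp)), h.bit]
  · rw [hF.nat 17 (hX _ (by simp)), h.off]

theorem Holds.frame {I : Instance n m k} {σ τ : Mem} {X Y : List ℕ} (h : Holds I σ)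
    (hF : Frame X Y σ τ) (hX : ∀ a ∈ [0, 2, 3, 4], a ∉ X) (hY : 0 ∉ Y) : Holds I τ where
  nodes := by rw [hF.nat 0 (hX _ (by simp)), h.nodes]
  packages := by rw [hF.nat 0 (hX _ (by simp)), h.packages]
  src j := by rw [hF.nat 2 (hX _ (by simp)), h.src]
  tgt j := by rw [hF.nat 3 (hX _ (by simp)), h.tgt]
  adj u v := by rw [hF.nat 4 (hX _ (by simp)), h.adj]
  len u v := by rw [hF.real 0 hY, h.len]

theorem Tabled.frame {I : Instance n m k} {σ τ : Mem} {X Y : List ℕ} (h : Tabled I σ)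
    (hF : Frame X Y σ τ) (hX : ∀ a ∈ [0, 2, 3, 4, 10, 12, 13, 14, 15, 16, 17], a ∉ X)
    (hY : 0 ∉ Y) : Tabled I τ where
  toHolds := h.toHolds.frame hF (fun a ha => hX a (by revert ha; simp; omega)) hY
  pow j hj := by rw [hF.nat 10 (hX _ (by simp)), h.pow j hj]
  row x := (h.row x).frame hF (fun a ha => hX a (by revert ha; simp; omega))

theorem Loaded.frame {I : Instance n m k} {w : Fin k → ℝ} {σ τ : Mem} {X Y : List ℕ}
    (h : Loaded I w σ) (hF : Frame X Y σ τ)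
    (hX : ∀ a ∈ [0, 2, 3, 4, 10, 11, 12, 13, 14, 15, 16, 17, 33], a ∉ X)
    (hY : ∀ a ∈ [0, 3], a ∉ Y) : Loaded I w τ where
  toTabled := h.toTabled.frame hF (fun a ha => hX a (by revert ha; simp; omega)) (hY 0 (by simp))
  agents := by rw [hF.nat 33 (hX _ (by simp)), h.agents]
  pos i := by rw [hF.nat 11 (hX _ (by simp)), h.pos]
  weight i := by rw [hF.real 3 (hY _ (by simp)), h.weight]

/-! ### Tables -/

/-- Charges for integer multiplication are bounded crudely by the factors themselves, which never
exceed the number of states. -/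
theorem natSize_le_self (x : ℕ) : Nat.size x ≤ x := Nat.size_le.2 Nat.lt_two_pow_self

theorem powProg_spec (m : ℕ) (σ : Mem) (hm : σ.nat 0 1 = m) :
    Wp powProg (fun τ t => Frame [10, 30] [] σ τ ∧ (∀ j ≤ m, τ.nat 10 j = 2 ^ j) ∧
      t ≤ m * 30 + 20) σ := by
  refine .setN_seq ?_
  simp only [NExp.eval, NExp.time]
  refine (Wp.forTo m 16 (fun i τ => τ.nat 30 0 = i ∧ Frame [10, 30] [] σ τ ∧
    ∀ j ≤ i, τ.nat 10 j = 2 ^ j) ?_ ?_ ?_ ?_).mono ?_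
  · refine ⟨by simp, ((Frame.refl _ _ σ).setNat (by simp) _ _).setNat (by simp) _ _, ?_⟩
    intro j hj
    obtain rfl : j = 0 := by omega
    simp
  · rintro i τ ⟨_, hF, _⟩
    rw [hF.nat 0 (by simp), hm]
  · rintro i τ ⟨h, _⟩; exact h
  · rintro i hi τ ⟨h30, hF, hp⟩
    refine .setN ?_
    simp only [V, NExp.eval, NExp.time, h30]
    refine ⟨by simp [h30], ⟨by simp, ?_, fun j hj => ?_⟩, by omega⟩
    · exact (hF.setNat (by simp) _ _).setNat (by simp) _ _
    · rcases Nat.lt_or_ge i j with hlt | hge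
      · obtain rfl : j = i + 1 := by omega
        simp [hp i le_rfl, pow_succ, mul_two]
      · have : j ≠ i + 1 := by omega
        simp [this, hp j hge]
  · rintro τ t ⟨⟨_, hF, hp⟩, ht⟩
    exact ⟨hF, hp, by omega⟩

theorem sizeProg_spec (n m k : ℕ) (σ : Mem) (hk : 0 < k) (hn : 0 < n) (h0 : σ.nat 0 0 = n)
    (h1 : σ.nat 0 1 = m) (h33 : σ.nat 33 0 = k) (hp : σ.nat 10 m = 2 ^ m) :
    Wp sizeProg (fun τ t => τ = σ.setNat 32 0 (numStates n m k) ∧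
      t ≤ 6 * numStates n m k + 20) σ := by
  refine .setN ⟨?_, ?_⟩
  · simp [V, NExp.eval, h0, h1, h33, hp, numStates]
  · simp only [V, NExp.eval, NExp.time, h0, h1, h33, hp]
    have e1 := natSize_le_self k
    have e2 := natSize_le_self (2 ^ m * (n * (m + 1)))
    have e3 := natSize_le_self (2 ^ m)
    have e4 := natSize_le_self (n * (m + 1))
    have e5 := natSize_le_self n
    have e6 := natSize_le_self (m + 1)
    have f1 : n ≤ n * (m + 1) := Nat.le_mul_of_pos_right _ (by omega)
    have f2 : m + 1 ≤ n * (m + 1) := Nat.le_mul_of_pos_left _ hn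
    have f3 : n * (m + 1) ≤ 2 ^ m * (n * (m + 1)) := Nat.le_mul_of_pos_left _ (by positivity)
    have f4 : 2 ^ m ≤ 2 ^ m * (n * (m + 1)) := Nat.le_mul_of_pos_right _ (by positivity)
    have f5 : 2 ^ m * (n * (m + 1)) ≤ numStates n m k := Nat.le_mul_of_pos_left _ hk
    have f6 : k ≤ numStates n m k := Nat.le_mul_of_pos_right _ (by positivity)
    omega

/-- The digits come off in the order package, node, mask, agent; two more divisions extract the bit.
Five divisions of numbers at most `x.enc`, at 25 per unit, leave room below the factor 200. -/
theorem decodeBody_spec (x : TourState n m k) (σ : Mem) (h0 : σ.nat 0 0 = n) (h1 : σ.nat 0 1 = m)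
    (hp : ∀ j ≤ m, σ.nat 10 j = 2 ^ j) (h30 : σ.nat 30 0 = x.enc) :
    Wp decodeBody (fun τ t =>
      Frame [12, 13, 14, 15, 16, 17, 40, 41, 42, 43, 44, 45, 46, 47, 48, 49] [] σ τ ∧
      Row τ x ∧
      (∀ a ∈ [12, 13, 14, 15, 16, 17], ∀ i ≠ x.enc, τ.nat a i = σ.nat a i) ∧
      t ≤ 200 * (numStates n m k + 1)) σ := by
  have hx := x.enc_lt
  have hn : 0 < n := x.v.pos
  have hc := x.c.2
  refine (Wp.divMod x.enc (m + 1) (by simp) (by omega) (by simp [V, NExp.eval, h30])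
    (by simp [V, NExp.time]) fun τ hF => ?_).seq ?_
  · simp [NExp.eval, NExp.time, hF.nat 0 (by simp), h1]
  rintro τ1 t1 ⟨F1, q1, r1, T1⟩
  rw [x.enc_mod] at r1
  refine (Wp.divMod (x.enc / (m + 1)) n (by simp) hn (by simp [V, NExp.eval, q1])
    (by simp [V, NExp.time]) fun τ hF => ?_).seq ?_
  · simp [NExp.eval, NExp.time, hF.nat 0 (by simp), F1.nat 0 (by simp), h0]
  rintro τ2 t2 ⟨F2, q2, r2, T2⟩
  rw [x.enc_div_mod] at r2
  refine (Wp.divMod (x.enc / (m + 1) / n) (2 ^ m) (by simp) (by positivity)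
    (by simp [V, NExp.eval, q2]) (by simp [V, NExp.time]) fun τ hF => ?_).seq ?_
  · simp [NExp.eval, NExp.time, hF.nat 0 (by simp), F2.nat 0 (by simp), F1.nat 0 (by simp), h1,
      hF.nat 10 (by simp), F2.nat 10 (by simp), F1.nat 10 (by simp), hp]
  rintro τ3 t3 ⟨F3, q3, r3, T3⟩
  rw [x.enc_div_div_mod] at r3
  rw [x.enc_div_div_div] at q3
  refine (Wp.divMod x.S (2 ^ ((x.c : ℕ) - 1)) (by simp) (by positivity)
    (by simp [V, NExp.eval, r3]) (by simp [V, NExp.time]) fun τ hF => ?_).seq ?_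
  · simp [V, NExp.eval, NExp.time, hF.nat 41 (by simp), F3.nat 41 (by simp), F2.nat 41 (by simp),
      r1, hF.nat 10 (by simp), F3.nat 10 (by simp), F2.nat 10 (by simp), F1.nat 10 (by simp)]
    exact hp _ (by omega)
  rintro τ4 t4 ⟨F4, q4, r4, T4⟩
  refine (Wp.divMod (x.S / 2 ^ ((x.c : ℕ) - 1)) 2 (by simp) (by norm_num)
    (by simp [V, NExp.eval, q4]) (by simp [V, NExp.time]) fun τ hF => ?_).seq ?_
  · simp [NExp.eval, NExp.time]
  rintro τ5 t5 ⟨F5, q5, r5, T5⟩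
  have g30 : τ5.nat 30 0 = x.enc := by
    rw [F5.nat 30 (by simp), F4.nat 30 (by simp), F3.nat 30 (by simp), F2.nat 30 (by simp),
      F1.nat 30 (by simp), h30]
  have g44 : τ5.nat 44 0 = x.a := by rw [F5.nat 44 (by simp), F4.nat 44 (by simp), q3]
  have g45 : τ5.nat 45 0 = x.S := by rw [F5.nat 45 (by simp), F4.nat 45 (by simp), r3]
  have g43 : τ5.nat 43 0 = x.v := by
    rw [F5.nat 43 (by simp), F4.nat 43 (by simp), F3.nat 43 (by simp), r2]
  have g41 : τ5.nat 41 0 = x.c := by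
    rw [F5.nat 41 (by simp), F4.nat 41 (by simp), F3.nat 41 (by simp), F2.nat 41 (by simp), r1]
  have g0 : τ5.nat 0 0 = n := by
    rw [F5.nat 0 (by simp), F4.nat 0 (by simp), F3.nat 0 (by simp), F2.nat 0 (by simp),
      F1.nat 0 (by simp), h0]
  have hF : Frame [12, 13, 14, 15, 16, 17, 40, 41, 42, 43, 44, 45, 46, 47, 48, 49] [] σ τ5 :=
    ((((F1.mono (by simp) (by simp)).trans (F2.mono (by simp) (by simp))).trans
      (F3.mono (by simp) (by simp))).trans (F4.mono (by simp) (by simp))).trans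
        (F5.mono (by simp) (by simp))
  refine .setN_seq (.setN_seq (.setN_seq (.setN_seq (.setN_seq (.setN ?_)))))
  simp only [V, NExp.eval, NExp.time, g30, g44, g45, g43, g41, g0, r5, Mem.setNat_nat,
    Nat.reduceEqDiff, false_and, if_false]
  refine ⟨?_, ⟨?_, ?_, ?_, ?_, ?_, ?_⟩, ?_, ?_⟩
  · exact (((((hF.setNat (by simp) _ _).setNat (by simp) _ _).setNat (by simp) _ _).setNat
      (by simp) _ _).setNat (by simp) _ _).setNat (by simp) _ _
  iterate 6 · simp
  · intro a ha i hi
    have : ∀ τ : Mem, Frame [40, 41, 42, 43, 44, 45, 46, 47, 48, 49] [] σ τ → τ.nat a i = σ.nat a i :=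
      fun τ hF => hF.nat a (by revert ha; simp; omega) i
    have h5 := this τ5 <| ((((F1.mono (by simp) (by simp)).trans (F2.mono (by simp) (by simp))).trans
      (F3.mono (by simp) (by simp))).trans (F4.mono (by simp) (by simp))).trans
        (F5.mono (by simp) (by simp))
    simp [hi, h5]
  · have e1 := natSize_le_self (x.v : ℕ)
    have e2 := natSize_le_self n
    have e3 := x.v.2
    have e4 : n ≤ numStates n m k := by
      have h1 : n ≤ n * (m + 1) := Nat.le_mul_of_pos_right _ (by omega)
      have h2 : n * (m + 1) ≤ 2 ^ m * (n * (m + 1)) := Nat.le_mul_of_pos_left _ (by positivity)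
      have h3 : 2 ^ m * (n * (m + 1)) ≤ numStates n m k := Nat.le_mul_of_pos_left _ x.a.pos
      omega
    have d1 := Nat.div_le_self x.enc (m + 1)
    have d2 := Nat.div_le_self (x.enc / (m + 1)) n
    have d3 := Nat.mod_le (x.enc / (m + 1) / n) (2 ^ m)
    rw [x.enc_div_div_mod] at d3
    have d4 := Nat.div_le_self (x.S : ℕ) (2 ^ ((x.c : ℕ) - 1))
    omega

theorem decodeProg_spec (I : Instance n m k) (σ : Mem) (hI : Holds I σ)
    (hp : ∀ j ≤ m, σ.nat 10 j = 2 ^ j) (h32 : σ.nat 32 0 = numStates n m k) :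
    Wp decodeProg (fun τ t =>
      Frame [12, 13, 14, 15, 16, 17, 30, 40, 41, 42, 43, 44, 45, 46, 47, 48, 49] [] σ τ ∧
      Tabled I τ ∧ t ≤ 225 * (numStates n m k + 1) ^ 2) σ := by
  refine (Wp.forTo (numStates n m k) (200 * (numStates n m k + 1)) (fun i τ => τ.nat 30 0 = i ∧
    Frame [12, 13, 14, 15, 16, 17, 30, 40, 41, 42, 43, 44, 45, 46, 47, 48, 49] [] σ τ ∧
    ∀ x : TourState n m k, x.enc < i → Row τ x) ?_ ?_ ?_ ?_).mono ?_
  · exact ⟨by simp, (Frame.refl _ _ σ).setNat (by simp) _ _, by simp⟩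
  · rintro i τ ⟨_, hF, _⟩
    rw [hF.nat 32 (by simp), h32]
  · rintro i τ ⟨h, _⟩; exact h
  · rintro i hi τ ⟨h30, hF, hR⟩
    obtain ⟨x, rfl⟩ := TourState.exists_enc_eq hi
    refine (decodeBody_spec x τ (by rw [hF.nat 0 (by simp), hI.nodes])
      (by rw [hF.nat 0 (by simp), hI.packages])
      (fun j hj => by rw [hF.nat 10 (by simp), hp j hj]) h30).mono ?_
    rintro ρ t ⟨hF', hx, hne, ht⟩
    refine ⟨by rw [hF'.nat 30 (by simp), h30], ⟨by simp, ?_, fun y hy => ?_⟩, ht⟩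
    · exact (hF.trans (hF'.mono (by simp) (by simp))).setNat (by simp) _ _
    · have key : Row ρ y := by
        rcases eq_or_ne y x with rfl | hyx
        · exact hx
        · have hyx' : y.enc ≠ x.enc := fun e => hyx (TourState.enc_injective e)
          have hy := hR y (by omega)
          exact ⟨by rw [hne 12 (by simp) _ hyx', hy.a], by rw [hne 13 (by simp) _ hyx', hy.S],
            by rw [hne 14 (by simp) _ hyx', hy.v], by rw [hne 15 (by simp) _ hyx', hy.c],
            by rw [hne 16 (by simp) _ hyx', hy.bit], by rw [hne 17 (by simp) _ hyx', hy.off]⟩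
      exact key.frame ((Frame.refl [30] [] ρ).setNat (by simp) _ _) (by simp)
  · rintro τ t ⟨⟨_, hF, hR⟩, ht⟩
    refine ⟨hF, ⟨hI.frame hF (by simp) (by simp), fun j hj => by rw [hF.nat 10 (by simp), hp j hj],
      fun x => hR x x.enc_lt⟩, ht.trans ?_⟩
    nlinarith [Nat.zero_le (numStates n m k)]

end Delivery

namespace Delivery

variable {n m k : ℕ}

/-! ### Edges -/

/-- The five alternatives of the test decide the five constructors of `Link`. Where a package index
is truncated, another conjunct fails. -/
theorem linkTest_iff {I : Instance n m k} {w : Fin k → ℝ} {τ : Mem} (h : Loaded I w τ)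
    {s s' : NExp} {x y : TourState n m k} (hs : s.eval τ = x.enc) (hs' : s'.eval τ = y.enc) :
    (linkTest s s').Holds τ ↔ I.Link x y := by
  have hx := h.row x
  have hy := h.row y
  simp only [linkTest, Test.holds_or, Test.Holds, Test.holds_eqN, NExp.eval, hs, hs',
    hx.a, hx.S, hx.v, hx.c, hx.off, hy.a, hy.S, hy.v, hy.c, hy.bit, h.adj, h.pos,
    Fin.val_inj]
  constructor
  · rintro (e | ⟨ha, hS, hc, hadj⟩ | ⟨ha, hv, hc, hc', hsrc, hS, hb⟩ | ⟨ha, hv, hS, hc', hc, htgt⟩ |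
      ⟨ha, hS, hc, hc', hv, hv'⟩)
    · obtain rfl := TourState.enc_injective e
      exact .stay x
    · obtain ⟨a, S, v, c⟩ := x
      obtain ⟨a', S', v', c'⟩ := y
      simp only at ha hS hc hadj
      subst ha hS hc
      refine .move _ _ _ _ _ ?_
      by_contra hne
      simp [hne] at hadj
    · obtain ⟨a, S, v, c⟩ := x
      obtain ⟨a', S', v', c'⟩ := y
      simp only at *
      obtain ⟨j, rfl⟩ := Fin.exists_succ_eq.2 (show c' ≠ 0 by rintro rfl; simp at hc')
      simp only [Fin.val_succ, Nat.add_sub_cancel, h.src, Fin.val_inj] at hsrc hS hb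
      subst ha hv
      obtain rfl : c = 0 := Fin.ext hc
      subst hsrc
      refine .pick _ _ _ _ (by rw [hS, h.pow _ j.2.le]) ?_
      rw [Nat.testBit_eq_decide_div_mod_eq, hb]; rfl
    · obtain ⟨a, S, v, c⟩ := x
      obtain ⟨a', S', v', c'⟩ := y
      simp only at *
      obtain ⟨j, rfl⟩ := Fin.exists_succ_eq.2 (show c ≠ 0 by rintro rfl; simp at hc)
      simp only [Fin.val_succ, Nat.add_sub_cancel, h.tgt, Fin.val_inj] at htgt
      subst ha hv hS
      obtain rfl : c' = 0 := Fin.ext hc'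
      subst htgt
      exact .drop _ _ _
    · obtain ⟨a, S, v, c⟩ := x
      obtain ⟨a', S', v', c'⟩ := y
      simp only at *
      obtain rfl : c' = 0 := Fin.ext hc'
      obtain rfl : c = 0 := Fin.ext hc
      subst hS hv hv'
      exact .next _ _ _ ha
  · intro hl
    cases hl with
    | stay => exact Or.inl rfl
    | move a S v u c hadj => exact Or.inr (Or.inl ⟨rfl, rfl, rfl, by simp [hadj]⟩)
    | pick a S S' j hS hb =>
      rw [Nat.testBit_eq_decide_div_mod_eq, decide_eq_true_eq] at hb
      exact Or.inr (Or.inr (Or.inl ⟨rfl, rfl, rfl, by simp, by simp [h.src],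
        by simp [hS, h.pow _ j.2.le], by simpa using hb⟩))
    | drop a S j =>
      exact Or.inr (Or.inr (Or.inr (Or.inl ⟨rfl, rfl, rfl, rfl, by simp, by simp [h.tgt]⟩)))
    | next a a' S ha => exact Or.inr (Or.inr (Or.inr (Or.inr ⟨ha, rfl, rfl, rfl, rfl, rfl⟩)))

theorem linkCostProg_spec {I : Instance n m k} {w : Fin k → ℝ} {σ : Mem} (h : Loaded I w σ)
    {a a' : ℕ} {x y : TourState n m k} (hs : σ.nat a 0 = x.enc)
    (hs' : σ.nat a' 0 = y.enc) :
    Wp (linkCostProg (V a) (V a')) (fun τ t => τ = σ.setReal 7 0 (I.linkCost w x y) ∧ t ≤ 40) σ := by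
  have hx := h.row x
  have hy := h.row y
  refine .cond (fun hb => .setR ⟨?_, ?_⟩) (fun hb => .setR ⟨?_, ?_⟩)
  · simp only [Test.holds_eqN, V, NExp.eval, hs, hs', hx.a, hy.a, Fin.val_inj] at hb
    simp only [V, NExp.eval, RExp.eval, hs, hs', hx.a, hx.off, hy.v, h.weight, h.len,
      Instance.linkCost, hb, if_true]
  · simp [Test.eqN, Test.time, NExp.time, RExp.time, V]
  · simp only [Test.holds_eqN, V, NExp.eval, hs, hs', hx.a, hy.a, Fin.val_inj] at hb
    simp only [NExp.eval, RExp.eval, Instance.linkCost, hb, if_false]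
  · simp [Test.eqN, Test.time, NExp.time, RExp.time, V]

/-! ### Distances -/

/-- The arrays describe, at index `p`, the cheapest continuation from `x` through one of the states
with code below `s`, whose distances are stored from index `b` on. -/
structure Entry (I : Instance n m k) (w : Fin k → ℝ) (τ : Mem) (b p : ℕ) (x : TourState n m k)
    (s : ℕ) : Prop where
  attained : τ.nat 20 p = 1 → ∃ y, τ.nat 21 p = y.enc ∧ I.Link x y ∧ τ.nat 20 (b + y.enc) = 1 ∧
    τ.real 4 p = I.linkCost w x y + τ.real 4 (b + y.enc)
  le : ∀ y : TourState n m k, y.enc < s → I.Link x y → τ.nat 20 (b + y.enc) = 1 →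
    τ.nat 20 p = 1 ∧ τ.real 4 p ≤ I.linkCost w x y + τ.real 4 (b + y.enc)

/-- The arrays of distances agree at an index. -/
structure Same (σ τ : Mem) (i : ℕ) : Prop where
  flag : τ.nat 20 i = σ.nat 20 i
  ptr : τ.nat 21 i = σ.nat 21 i
  dist : τ.real 4 i = σ.real 4 i

theorem Same.trans {σ τ ρ : Mem} {i : ℕ} (h : Same σ τ i) (h' : Same τ ρ i) : Same σ ρ i :=
  ⟨h'.flag.trans h.flag, h'.ptr.trans h.ptr, h'.dist.trans h.dist⟩

theorem Frame.same {X Y : List ℕ} {σ τ : Mem} (h : Frame X Y σ τ) (hX : 20 ∉ X ∧ 21 ∉ X)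
    (hY : 4 ∉ Y) (i : ℕ) : Same σ τ i :=
  ⟨h.nat _ hX.1 i, h.nat _ hX.2 i, h.real _ hY i⟩

theorem Entry.congr {I : Instance n m k} {w : Fin k → ℝ} {σ τ : Mem} {b p s : ℕ}
    {x : TourState n m k} (h : Entry I w σ b p x s) (hp : Same σ τ p)
    (hb : ∀ i < numStates n m k, Same σ τ (b + i)) : Entry I w τ b p x s where
  attained h1 := by
    rw [hp.flag] at h1
    obtain ⟨y, g1, g2, g3, g4⟩ := h.attained h1
    exact ⟨y, by rw [hp.ptr, g1], g2, by rw [(hb _ y.enc_lt).flag, g3],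
      by rw [hp.dist, g4, (hb _ y.enc_lt).dist]⟩
  le y hy hl h1 := by
    rw [(hb _ y.enc_lt).flag] at h1
    rw [hp.flag, hp.dist, (hb _ y.enc_lt).dist]
    exact h.le y hy hl h1

/-- One more candidate `y` is taken into the minimum. The time is constant because the row offsets
are tabulated and no integer multiplication is left. -/
theorem relaxProg_spec {I : Instance n m k} {w : Fin k → ℝ} {σ : Mem} (h : Loaded I w σ)
    {b : ℕ} {x y : TourState n m k} (h39 : σ.nat 39 0 = x.enc) (h50 : σ.nat 50 0 = y.enc)
    (h37 : σ.nat 37 0 = b) (h32 : σ.nat 32 0 = numStates n m k)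
    (hE : Entry I w σ b (b + (numStates n m k + x.enc)) x y.enc) :
    Wp relaxProg (fun τ t => Frame [20, 21] [4, 7] σ τ ∧
      (∀ i ≠ b + (numStates n m k + x.enc), Same σ τ i) ∧
      Entry I w τ b (b + (numStates n m k + x.enc)) x (y.enc + 1) ∧ t ≤ 1000) σ := by
  set p := b + (numStates n m k + x.enc) with hp
  -- The entry written belongs to the layer after the one that is read.
  have hne : ∀ z : TourState n m k, b + z.enc ≠ p := fun z => by have := z.enc_lt; omega
  refine (linkCostProg_spec h h39 h50).seq ?_
  rintro _ t1 ⟨rfl, ht1⟩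
  set σ' := σ.setReal 7 0 (I.linkCost w x y) with hσ'
  have hF : Frame [20, 21] [4, 7] σ σ' := (Frame.refl _ _ σ).setReal (by simp) _ _
  have hsame : ∀ i, Same σ σ' i := fun i => ⟨rfl, rfl, by simp [hσ']⟩
  have h' : Loaded I w σ' := h.frame hF (by simp) (by simp)
  have h7 : σ'.real 7 0 = I.linkCost w x y := by simp [hσ']
  have g39 : σ'.nat 39 0 = x.enc := h39
  have g50 : σ'.nat 50 0 = y.enc := h50
  have g37 : σ'.nat 37 0 = b := h37
  have g32 : σ'.nat 32 0 = numStates n m k := h32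
  have hE' : Entry I w σ' b p x y.enc := hE.congr (hsame _) fun i _ => hsame _
  clear_value σ'
  refine .cond (fun hb => ?_) (fun hb => ?_)
  · have hl := (linkTest_iff h' (s := V 39) (s' := V 50) g39 g50).1 hb.1
    replace hb := hb.2
    simp only [Test.Holds, Test.holds_eqN, Test.holds_or, V, NExp.eval, RExp.eval, g39, g50,
      g37, g32, h7, ← hp] at hb
    refine .setN_seq (.setN_seq (.setR ?_))
    simp only [V, NExp.eval, RExp.eval, g39, g50, g37, g32, h7, Mem.setNat_nat, Nat.reduceEqDiff,
      false_and, if_false, Mem.setNat_real, ← hp]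
    refine ⟨?_, fun i hi => ?_, ⟨fun _ => ⟨y, ?_⟩, fun z hz hlz hfz => ?_⟩, ?_⟩
    · exact ((hF.setNat (by simp) _ _).setNat (by simp) _ _).setReal (by simp) _ _
    · refine (hsame i).trans ⟨?_, ?_, ?_⟩ <;> simp [hi]
    · simp [hl, hb.1, hne]
    · simp only [Mem.setReal_nat, Mem.setNat_nat, hne, and_false, if_false,
        Nat.reduceEqDiff] at hfz
      simp only [Mem.setReal_nat, Mem.setNat_nat, hne, and_false, if_false, Nat.reduceEqDiff,
        false_and, Mem.setReal_real, Mem.setNat_real, true_and, if_true]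
      rcases eq_or_ne z y with rfl | hzy
      · exact le_rfl
      · have hzy' : z.enc ≠ y.enc := fun e => hzy (TourState.enc_injective e)
        obtain ⟨e1, e2⟩ := hE'.le z (by omega) hlz hfz
        -- For an earlier candidate `z` an entry existed already, so the write happened because the
        -- old value exceeded the new one.
        rcases hb.2 with hb2 | hb2
        · exact absurd e1 hb2
        · exact (not_le.1 hb2).le.trans e2
    · simp only [linkTest, Test.or, Test.eqN, Test.time, NExp.time, RExp.time]
      omega
  · refine .skip ⟨hF, fun i _ => hsame i, ⟨hE'.attained, fun z hz hlz hfz => ?_⟩, ?_⟩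
    · rcases eq_or_ne z y with rfl | hzy
      · have hl := (linkTest_iff h' (s := V 39) (s' := V 50) g39 g50).2 hlz
        rw [Test.Holds] at hb
        have hb := fun e => hb ⟨hl, e⟩
        simp only [Test.Holds, Test.holds_eqN, Test.holds_or, V, NExp.eval, RExp.eval, g39, g50,
          g37, g32, h7, ← hp] at hb
        -- Had `y` been an improvement, the test would have succeeded.
        by_contra hcon
        refine hb ⟨hfz, ?_⟩
        rw [not_and_or] at hcon
        exact hcon
      · have hzy' : z.enc ≠ y.enc := fun e => hzy (TourState.enc_injective e)
        exact hE'.le z (by omega) hlz hfz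
    · simp only [linkTest, Test.or, Test.eqN, Test.time, NExp.time, RExp.time, V]
      omega

theorem entryProg_spec {I : Instance n m k} {w : Fin k → ℝ} {σ : Mem} (h : Loaded I w σ)
    {b : ℕ} {x : TourState n m k} (h39 : σ.nat 39 0 = x.enc)
    (h37 : σ.nat 37 0 = b) (h32 : σ.nat 32 0 = numStates n m k) :
    Wp entryProg (fun τ t => Frame [20, 21, 50] [4, 7] σ τ ∧
      (∀ i ≠ b + (numStates n m k + x.enc), Same σ τ i) ∧
      Entry I w τ b (b + (numStates n m k + x.enc)) x (numStates n m k) ∧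
      t ≤ numStates n m k * 1014 + 30) σ := by
  set p := b + (numStates n m k + x.enc) with hp
  refine .setN_seq ?_
  simp only [V, NExp.eval, NExp.time, h37, h32, h39, ← hp]
  refine (Wp.forTo (numStates n m k) 1000 (fun i τ => τ.nat 50 0 = i ∧
    Frame [20, 21, 50] [4, 7] σ τ ∧ (∀ i ≠ p, Same σ τ i) ∧ Entry I w τ b p x i) ?_ ?_ ?_ ?_).mono ?_
  -- With the flag cleared and no candidate considered, both conditions are vacuous, whatever an
  -- earlier solve left behind.
  · refine ⟨by simp, ((Frame.refl _ _ σ).setNat (by simp) _ _).setNat (by simp) _ _,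
      fun i hi => ⟨by simp [hi], by simp, by simp⟩, ⟨by simp, by simp⟩⟩
  · rintro i τ ⟨_, hF, _⟩
    rw [hF.nat 32 (by simp), h32]
  · rintro i τ ⟨h, _⟩; exact h
  · rintro i hi τ ⟨h50, hF, hS, hE⟩
    obtain ⟨y, rfl⟩ := TourState.exists_enc_eq hi
    refine (relaxProg_spec (h.frame hF (by simp) (by simp)) (by rw [hF.nat 39 (by simp), h39]) h50
      (by rw [hF.nat 37 (by simp), h37]) (by rw [hF.nat 32 (by simp), h32]) hE).mono ?_
    rintro ρ t ⟨hF', hS', hE', ht⟩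
    have hR : Frame [50] [] ρ (ρ.setNat 50 0 (y.enc + 1)) :=
      (Frame.refl _ _ ρ).setNat (by simp) _ _
    have hs := hR.same (by simp) (by simp)
    refine ⟨by rw [hF'.nat 50 (by simp), h50], ⟨by simp, ?_, fun i hi => ?_, ?_⟩, ht⟩
    · exact (hF.trans (hF'.mono (by simp) (by simp))).trans (hR.mono (by simp) (by simp))
    · exact ((hS i hi).trans (hS' i hi)).trans (hs i)
    · exact hE'.congr (hs _) fun i _ => hs _
  · rintro τ t ⟨⟨_, hF, hS, hE⟩, ht⟩
    exact ⟨hF, hS, hE, by omega⟩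

theorem layerProg_spec {I : Instance n m k} {w : Fin k → ℝ} {σ : Mem} (h : Loaded I w σ)
    {b : ℕ} (h37 : σ.nat 37 0 = b) (h32 : σ.nat 32 0 = numStates n m k) :
    Wp layerProg (fun τ t => Frame [20, 21, 37, 39, 50] [4, 7] σ τ ∧
      τ.nat 37 0 = b + numStates n m k ∧
      (∀ i < b + numStates n m k, Same σ τ i) ∧
      (∀ x, Entry I w τ b (b + (numStates n m k + x.enc)) x (numStates n m k)) ∧
      t ≤ numStates n m k * (numStates n m k * 1014 + 44) + 20) σ := by
  set N := numStates n m k with hN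
  refine (Wp.forTo N (N * 1014 + 30) (fun s τ => τ.nat 39 0 = s ∧
    Frame [20, 21, 39, 50] [4, 7] σ τ ∧ (∀ i < b + N, Same σ τ i) ∧
    ∀ x : TourState n m k, x.enc < s → Entry I w τ b (b + (N + x.enc)) x N)
    ?_ ?_ ?_ ?_).seq ?_
  · exact ⟨by simp, (Frame.refl _ _ σ).setNat (by simp) _ _,
      fun i hi => ⟨by simp, by simp, by simp⟩, by simp⟩
  · rintro i τ ⟨_, hF, _⟩
    rw [hF.nat 32 (by simp), h32]
  · rintro i τ ⟨h, _⟩; exact h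
  · rintro i hi τ ⟨h39, hF, hS, hE⟩
    obtain ⟨x, rfl⟩ := TourState.exists_enc_eq hi
    refine (entryProg_spec (h.frame hF (by simp) (by simp)) h39
      (by rw [hF.nat 37 (by simp), h37]) (by rw [hF.nat 32 (by simp), h32])).mono ?_
    rintro ρ t ⟨hF', hS', hE', ht⟩
    have hR : Frame [39] [] ρ (ρ.setNat 39 0 (x.enc + 1)) :=
      (Frame.refl _ _ ρ).setNat (by simp) _ _
    have hs := hR.same (by simp) (by simp)
    have hS2 : ∀ i ≠ b + (N + x.enc), Same τ (ρ.setNat 39 0 (x.enc + 1)) i := fun i hi =>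
      (hS' i hi).trans (hs i)
    refine ⟨by rw [hF'.nat 39 (by simp), h39], ⟨by simp, ?_, fun i hi => ?_, fun y hy => ?_⟩, ht⟩
    · exact (hF.trans (hF'.mono (by simp) (by simp))).trans (hR.mono (by simp) (by simp))
    · exact (hS i hi).trans (hS2 i (by omega))
    · rcases eq_or_ne y x with rfl | hyx
      · exact hE'.congr (hs _) fun i _ => hs _
      · have hyx' : y.enc ≠ x.enc := fun e => hyx (TourState.enc_injective e)
        exact (hE y (by omega)).congr (hS2 _ (by omega)) fun i hi => hS2 _ (by omega)
  · rintro τ s ⟨⟨_, hF, hS, hE⟩, ht⟩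
    refine .setN ?_
    have e37 : τ.nat 37 0 = b := by rw [hF.nat 37 (by simp), h37]
    have e32 : τ.nat 32 0 = N := by rw [hF.nat 32 (by simp), h32]
    simp only [V, NExp.eval, NExp.time, e37, e32]
    have hR : Frame [37] [] τ (τ.setNat 37 0 (b + N)) := (Frame.refl _ _ τ).setNat (by simp) _ _
    have hs := hR.same (by simp) (by simp)
    refine ⟨(hF.mono (by simp) (by simp)).trans (hR.mono (by simp) (by simp)), by simp,
      fun i hi => (hS i hi).trans (hs i), fun x => ?_, ?_⟩
    · exact (hE x x.enc_lt).congr (hs _) fun i _ => hs _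
    · have : N * (N * 1014 + 30 + 14) = N * (N * 1014 + 44) := by ring
      omega

end Delivery

namespace Delivery

variable {n m k : ℕ}

/-! ### Solving an instance -/

/-- The arrays describe cheapest walks to the goal with any number of edges up to the number of
states. -/
structure Solved (I : Instance n m (k + 1)) (w : Fin (k + 1) → ℝ) (τ : Mem) : Prop where
  base : ∀ x : TourState n m (k + 1), τ.nat 20 x.enc = 1 ↔ x = I.goal
  zero : τ.real 4 I.goal.enc = 0
  layer : ∀ r < numStates n m (k + 1), ∀ x, Entry I w τ (r * numStates n m (k + 1))
    (r * numStates n m (k + 1) + (numStates n m (k + 1) + x.enc)) x (numStates n m (k + 1))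

theorem Solved.congr {I : Instance n m (k + 1)} {w : Fin (k + 1) → ℝ} {σ τ : Mem}
    (h : Solved I w σ) (hs : ∀ i, Same σ τ i) : Solved I w τ where
  base x := by rw [(hs _).flag, h.base]
  zero := by rw [(hs _).dist, h.zero]
  layer r hr x := (h.layer r hr x).congr (hs _) fun _ _ => hs _

/-- The recursion takes every edge into account, so by induction on the walk a layer's value is a
lower bound for all walks with that number of edges. -/
theorem Solved.le_walkCost {I : Instance n m (k + 1)} {w : Fin (k + 1) → ℝ} {τ : Mem}
    (h : Solved I w τ) {x : TourState n m (k + 1)} {l : List (TourState n m (k + 1))}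
    (hl : l.length ≤ numStates n m (k + 1)) (hw : I.IsWalk x l I.goal) :
    τ.nat 20 (l.length * numStates n m (k + 1) + x.enc) = 1 ∧
      τ.real 4 (l.length * numStates n m (k + 1) + x.enc) ≤ I.walkCost w x l := by
  induction l generalizing x with
  | nil =>
    obtain rfl : x = I.goal := hw
    simp [(h.base _).2 rfl, h.zero, Instance.walkCost]
  | cons y l ih =>
    simp only [List.length_cons] at hl ⊢
    obtain ⟨h1, h2⟩ := ih (by omega) hw.2
    obtain ⟨g1, g2⟩ := (h.layer l.length (by omega) x).le y y.enc_lt hw.1 h1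
    have e : (l.length + 1) * numStates n m (k + 1) + x.enc =
      l.length * numStates n m (k + 1) + (numStates n m (k + 1) + x.enc) := by ring
    rw [e]
    exact ⟨g1, g2.trans (by simpa [Instance.walkCost] using h2)⟩

/-- Following the attained minima down to layer 0 gives a walk with exactly the stored weight, so
the lower bound is sharp. -/
theorem Solved.exists_walk {I : Instance n m (k + 1)} {w : Fin (k + 1) → ℝ} {τ : Mem}
    (h : Solved I w τ) (r : ℕ) (hr : r ≤ numStates n m (k + 1)) (x : TourState n m (k + 1))
    (hx : τ.nat 20 (r * numStates n m (k + 1) + x.enc) = 1) :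
    ∃ l, I.IsWalk x l I.goal ∧
      I.walkCost w x l = τ.real 4 (r * numStates n m (k + 1) + x.enc) := by
  induction r generalizing x with
  | zero =>
    simp only [zero_mul, zero_add] at hx ⊢
    obtain rfl := (h.base x).1 hx
    exact ⟨[], rfl, h.zero.symm⟩
  | succ r ih =>
    have e : (r + 1) * numStates n m (k + 1) + x.enc =
      r * numStates n m (k + 1) + (numStates n m (k + 1) + x.enc) := by ring
    rw [e] at hx ⊢
    obtain ⟨y, -, g2, g3, g4⟩ := (h.layer r (by omega) x).attained hx
    obtain ⟨l, hl, hc⟩ := ih (by omega) y g3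
    exact ⟨y :: l, ⟨g2, hl⟩, by rw [Instance.walkCost, hc, g4]⟩

/-- The distance computed for the start is the minimum over all walks. -/
theorem Solved.start {I : Instance n m (k + 1)} {w : Fin (k + 1) → ℝ} (hw : 0 ≤ w) {τ : Mem}
    (h : Solved I w τ) :
    τ.nat 20 (numStates n m (k + 1) * numStates n m (k + 1) + I.start.enc) = 1 ∧
    ∀ l, l.length = numStates n m (k + 1) → I.IsWalk I.start l I.goal →
      τ.real 4 (numStates n m (k + 1) * numStates n m (k + 1) + I.start.enc) ≤
        I.walkCost w I.start l := by
  obtain ⟨l0, h0⟩ := I.exists_walk_to_goal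
  obtain ⟨l1, h1, h2, -⟩ := h0.exists_length_eq hw
  refine ⟨?_, fun l hl hl' => ?_⟩
  · have := (h.le_walkCost h1.le h2).1
    rwa [h1] at this
  · have := (h.le_walkCost hl.le hl').2
    rwa [hl] at this

theorem Solved.exists_optimal {I : Instance n m (k + 1)} {w : Fin (k + 1) → ℝ} (hw : 0 ≤ w)
    {τ : Mem} (h : Solved I w τ) :
    ∃ x ∈ I.RnoCStar, (∀ y ∈ I.RnoCStar, I.cost x w ≤ I.cost y w) ∧
      I.cost x w =
        τ.real 4 (numStates n m (k + 1) * numStates n m (k + 1) + I.start.enc) := by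
  obtain ⟨h1, h2⟩ := h.start hw
  obtain ⟨l, hl, hc⟩ := h.exists_walk _ le_rfl _ h1
  obtain ⟨h3, h4⟩ := hl.optimal hw fun l' g g' => hc ▸ h2 l' g g'
  exact ⟨_, h3, h4, by rw [hl.cost_eq, hc]⟩

theorem numStates_bounds (hn : 0 < n) (hk : 0 < k) : k ≤ numStates n m k ∧
    k * 2 ^ m ≤ numStates n m k ∧ k * 2 ^ m * n ≤ numStates n m k ∧ n ≤ numStates n m k ∧
    m + 1 ≤ numStates n m k ∧ 2 ^ m ≤ numStates n m k := by
  have e1 : numStates n m k = k * 2 ^ m * n * (m + 1) := by rw [numStates]; ring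
  have h1 : k * 2 ^ m * n ≤ numStates n m k := e1 ▸ Nat.le_mul_of_pos_right _ (by omega)
  have h2 : k * 2 ^ m ≤ k * 2 ^ m * n := Nat.le_mul_of_pos_right _ hn
  have h3 : k ≤ k * 2 ^ m := Nat.le_mul_of_pos_right _ (by positivity)
  have h4 : 2 ^ m ≤ k * 2 ^ m := Nat.le_mul_of_pos_left _ hk
  have h5 : n ≤ k * 2 ^ m * n := Nat.le_mul_of_pos_left _ (by positivity)
  have h6 : m + 1 ≤ numStates n m k := e1 ▸ Nat.le_mul_of_pos_left _ (by positivity)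
  omega

/-- Only layer 0 has to be reset, because `entryProg` clears every later entry before use. The cubic
bound comes from one relaxation for each layer and each pair of states. -/
theorem solveProg_spec {I : Instance n m (k + 1)} {w : Fin (k + 1) → ℝ} {σ : Mem}
    (h : Loaded I w σ) :
    Wp solveProg (fun τ t =>
      Frame [20, 21, 32, 34, 35, 36, 37, 38, 39, 50] [4, 7] σ τ ∧ Solved I w τ ∧
      τ.nat 32 0 = numStates n m (k + 1) ∧ τ.nat 35 0 = I.start.enc ∧
      τ.nat 37 0 = numStates n m (k + 1) * numStates n m (k + 1) ∧
      t ≤ 2000 * (numStates n m (k + 1) + 1) ^ 3) σ := by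
  set N := numStates n m (k + 1) with hN
  have hn : 0 < n := (I.pos 0).pos
  obtain ⟨b1, b2, b3, b4, b5, b6⟩ := numStates_bounds (m := m) (k := k + 1) hn k.succ_pos
  rw [← hN] at b1 b2 b3 b4 b5 b6
  have hM : 1 ≤ 2 ^ m := Nat.one_le_two_pow
  refine (sizeProg_spec n m (k + 1) σ k.succ_pos hn h.nodes h.packages h.agents
    (h.pow m le_rfl)).seq ?_
  rintro _ t1 ⟨rfl, ht1⟩
  refine .setN_seq ?_
  have hpl : σ.nat 11 k = I.pos (Fin.last k) := h.pos (Fin.last k)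
  have hp0 : σ.nat 11 0 = I.pos 0 := h.pos 0
  have hg : I.goal.enc = ((k * 2 ^ m + (2 ^ m - 1)) * n + (I.pos (Fin.last k) : ℕ)) * (m + 1) := rfl
  have hs : I.start.enc = (I.pos 0 : ℕ) * (m + 1) := by
    simp [Instance.start, TourState.enc]
  simp only [V, NExp.eval, NExp.time, Mem.setNat_nat, Nat.reduceEqDiff, OfNat.zero_ne_ofNat,
    false_and, if_false, h.nodes, h.packages, h.agents, h.pow m le_rfl, Nat.add_sub_cancel, hpl, ← hg]
  refine .setN_seq ?_
  simp only [NExp.eval, NExp.time, Mem.setNat_nat, Nat.reduceEqDiff, OfNat.zero_ne_ofNat,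
    false_and, if_false, h.packages, hp0, ← hs, ← hN]
  set σ1 := ((σ.setNat 32 0 N).setNat 34 0 I.goal.enc).setNat 35 0 I.start.enc with hσ1
  have F1 : Frame [20, 21, 32, 34, 35, 36, 37, 38, 39, 50] [4, 7] σ σ1 :=
    (((Frame.refl _ _ σ).setNat (by simp) _ _).setNat (by simp) _ _).setNat (by simp) _ _
  have s32 : σ1.nat 32 0 = N := by simp [hσ1]
  have s34 : σ1.nat 34 0 = I.goal.enc := by simp [hσ1]
  have s35 : σ1.nat 35 0 = I.start.enc := by simp [hσ1]
  clear_value σ1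
  refine (Wp.forTo N 10 (fun i τ => τ.nat 36 0 = i ∧ Frame [20, 36] [] σ1 τ ∧
    ∀ j < i, τ.nat 20 j = 0) ?_ ?_ ?_ ?_).seq ?_
  · exact ⟨by simp, (Frame.refl _ _ _).setNat (by simp) _ _, by simp⟩
  · rintro i τ ⟨_, hF, _⟩
    rw [hF.nat 32 (by simp), s32]
  · rintro i τ ⟨h, _⟩; exact h
  · rintro i hi τ ⟨h36, hF, hz⟩
    refine .setN ?_
    simp only [NExp.eval, NExp.time, h36]
    refine ⟨by simp [h36], ⟨by simp, (hF.setNat (by simp) _ _).setNat (by simp) _ _, ?_⟩, by omega⟩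
    intro j hj
    rcases eq_or_ne j i with rfl | hne
    · simp
    · simp [hne, hz j (by omega)]
  rintro τ2 t2 ⟨⟨_, F2, hz⟩, ht2⟩
  have F2' : Frame [20, 21, 32, 34, 35, 36, 37, 38, 39, 50] [4, 7] σ τ2 :=
    F1.trans (F2.mono (by simp) (by simp))
  have u34 : τ2.nat 34 0 = I.goal.enc := by rw [F2.nat 34 (by simp), s34]
  have u32 : τ2.nat 32 0 = N := by rw [F2.nat 32 (by simp), s32]
  have u35 : τ2.nat 35 0 = I.start.enc := by rw [F2.nat 35 (by simp), s35]
  refine .setN_seq (.setR_seq (.setN_seq ?_))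
  simp only [NExp.eval, NExp.time, RExp.eval, RExp.time, u34, Mem.setNat_nat, Nat.reduceEqDiff,
    false_and, if_false]
  set σ3 := ((τ2.setNat 20 I.goal.enc 1).setReal 4 I.goal.enc 0).setNat 37 0 0 with hσ3
  have F3 : Frame [20, 21, 32, 34, 35, 36, 37, 38, 39, 50] [4, 7] σ σ3 :=
    ((F2'.setNat (by simp) _ _).setReal (by simp) _ _).setNat (by simp) _ _
  have s32 : σ3.nat 32 0 = N := by simp [hσ3, u32]
  have s35 : σ3.nat 35 0 = I.start.enc := by simp [hσ3, u35]
  have s37 : σ3.nat 37 0 = 0 := by simp [hσ3]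
  have sb : ∀ x : TourState n m (k + 1), σ3.nat 20 x.enc = 1 ↔ x = I.goal := by
    intro x
    rcases eq_or_ne x I.goal with rfl | hne
    · simp [hσ3]
    · have : x.enc ≠ I.goal.enc := fun e => hne (TourState.enc_injective e)
      simp [hσ3, this, hz _ x.enc_lt, hne]
  have sz : σ3.real 4 I.goal.enc = 0 := by simp [hσ3]
  clear_value σ3
  refine (Wp.forTo N (N * (N * 1014 + 44) + 20) (fun r τ => τ.nat 38 0 = r ∧
    Frame [20, 21, 37, 38, 39, 50] [4, 7] σ3 τ ∧ τ.nat 37 0 = r * N ∧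
    (∀ i < N, Same σ3 τ i) ∧
    ∀ r' < r, ∀ x, Entry I w τ (r' * N) (r' * N + (N + x.enc)) x N) ?_ ?_ ?_ ?_).mono ?_
  · exact ⟨by simp, (Frame.refl _ _ _).setNat (by simp) _ _, by simp [s37],
      fun i _ => ⟨by simp, by simp, by simp⟩, by simp⟩
  · rintro i τ ⟨_, hF, _⟩
    rw [hF.nat 32 (by simp), s32]
  · rintro i τ ⟨h, _⟩; exact h
  · rintro r hr τ ⟨h38, hF, h37, hS, hE⟩
    have hL := (h.frame F3 (by simp) (by simp)).frame hF (by simp) (by simp)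
    refine (layerProg_spec hL h37 (by rw [hF.nat 32 (by simp), s32])).mono ?_
    rintro ρ t ⟨hF', g37, hS', hE', ht⟩
    rw [← hN] at g37 hS' hE' ht
    have hR : Frame [38] [] ρ (ρ.setNat 38 0 (r + 1)) :=
      (Frame.refl _ _ ρ).setNat (by simp) _ _
    have hs := hR.same (by simp) (by simp)
    have hS2 : ∀ i < r * N + N, Same τ (ρ.setNat 38 0 (r + 1)) i := fun i hi =>
      (hS' i hi).trans (hs i)
    refine ⟨by rw [hF'.nat 38 (by simp), h38], ⟨by simp, ?_, ?_, fun i hi => ?_,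
      fun r' hr' x => ?_⟩, ht⟩
    · exact (hF.trans (hF'.mono (by simp) (by simp))).trans (hR.mono (by simp) (by simp))
    · rw [hR.nat 37 (by simp), g37]; ring
    · exact (hS i hi).trans (hS2 i (by omega))
    · have hx : x.enc < N := x.enc_lt
      rcases Nat.lt_or_ge r' r with hlt | hge
      · have hmul : (r' + 1) * N ≤ r * N := Nat.mul_le_mul_right _ hlt
        have e : (r' + 1) * N = r' * N + N := by ring
        exact (hE r' hlt x).congr (hS2 _ (by omega)) fun i hi => hS2 _ (by omega)
      · obtain rfl : r' = r := by omega
        exact (hE' x).congr (hs _) fun i _ => hs _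
  · rintro τ t ⟨⟨_, hF, h37, hS, hE⟩, ht⟩
    refine ⟨F3.trans (hF.mono (by simp) (by simp)), ⟨fun x => ?_, ?_, hE⟩, ?_, ?_, h37, ?_⟩
    · rw [(hS _ x.enc_lt).flag, sb]
    · rw [(hS _ I.goal.enc_lt).dist, sz]
    · rw [hF.nat 32 (by simp), s32]
    · rw [hF.nat 35 (by simp), s35]
    · have hpl' := (I.pos (Fin.last k)).2
      have hp0' := (I.pos 0).2
      have c1 : k * 2 ^ m + 2 ^ m = (k + 1) * 2 ^ m := by ring
      have c2 := TourState.mul_add_lt (a := (k + 1) * 2 ^ m) (q := k * 2 ^ m + (2 ^ m - 1))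
        (by omega) hpl'
      have e1 := natSize_le_self k
      have e2 := natSize_le_self (2 ^ m)
      have e3 := natSize_le_self (k * 2 ^ m + (2 ^ m - 1))
      have e4 := natSize_le_self n
      have e5 := natSize_le_self ((k * 2 ^ m + (2 ^ m - 1)) * n + (I.pos (Fin.last k) : ℕ))
      have e6 := natSize_le_self (m + 1)
      have e7 := natSize_le_self (I.pos 0 : ℕ)
      have c3 : (N + 1) ^ 3 = N * (N * N) + 3 * (N * N) + 3 * N + 1 := by ring
      have c4 : N * (N * (N * 1014 + 44) + 20 + 14) = 1014 * (N * (N * N)) + 44 * (N * N) + 34 * N := by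
        ring
      have c5 : N * (10 + 14) = 24 * N := by ring
      rw [c3]
      omega

/-! ### Loading the agents -/

/-- The agent is the leading digit of a code, so codes do not depend on the number of agents, and
the tables for the full instance serve all reduced ones. -/
theorem Tabled.remove {I : Instance n m (k + 1)} {τ : Mem} (h : Tabled I τ) (i : Fin (k + 1)) :
    Tabled (I.remove i) τ where
  nodes := h.nodes
  packages := h.packages
  src := h.src
  tgt := h.tgt
  adj := h.adj
  len := h.len
  pow := h.pow
  row x := by
    have := h.row ⟨x.a.castSucc, x.S, x.v, x.c⟩
    exact ⟨this.a, this.S, this.v, this.c, this.bit, this.off⟩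

/-- The position, in the list without the number `s`, of the number `b`. -/
def shiftIdx (s b : ℕ) : ℕ := if s < b then b - 1 else b

/-- Variable 33 counts the agents kept so far and is thus also the next free index, `shiftIdx s` of
the loop variable. -/
theorem loadProg_spec {K s : ℕ} {σ : Mem} (hK : σ.nat 0 2 = K) (hs : σ.nat 51 0 = s) :
    Wp loadProg (fun τ t => Frame [11, 33, 52] [3] σ τ ∧ τ.nat 33 0 = shiftIdx s K ∧
      (∀ b < K, b ≠ s → τ.nat 11 (shiftIdx s b) = σ.nat 1 b ∧
        τ.real 3 (shiftIdx s b) = σ.real 1 b) ∧ t ≤ K * 100 + 20) σ := by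
  refine .setN_seq ?_
  simp only [NExp.eval, NExp.time]
  refine (Wp.forTo K 60 (fun a τ => τ.nat 52 0 = a ∧ Frame [11, 33, 52] [3] σ τ ∧
    τ.nat 33 0 = shiftIdx s a ∧ (∀ b < a, b ≠ s → τ.nat 11 (shiftIdx s b) = σ.nat 1 b ∧
        τ.real 3 (shiftIdx s b) = σ.real 1 b)) ?_ ?_ ?_ ?_).mono ?_
  · exact ⟨by simp, ((Frame.refl _ _ σ).setNat (by simp) _ _).setNat (by simp) _ _,
      by simp [shiftIdx], by simp⟩
  · rintro i τ ⟨_, hF, _⟩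
    rw [hF.nat 0 (by simp), hK]
  · rintro i τ ⟨h, _⟩; exact h
  · rintro a ha τ ⟨h52, hF, h33, hb⟩
    have h51 : τ.nat 51 0 = s := by rw [hF.nat 51 (by simp), hs]
    refine .cond (fun hc => .skip ?_) (fun hc => .setN_seq (.setR_seq (.setN ?_)))
    · simp only [Test.holds_eqN, V, NExp.eval, h51, h52] at hc
      subst hc
      refine ⟨h52, ⟨by simp, hF.setNat (by simp) _ _, ?_, fun b hb1 hb2 => ?_⟩, ?_⟩
      · simp [h33, shiftIdx]
      · simpa using hb b (by omega) hb2
      · simp [Test.eqN, Test.time, NExp.time, V]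
    · simp only [Test.holds_eqN, V, NExp.eval, h51, h52] at hc
      simp only [V, NExp.eval, NExp.time, RExp.eval, RExp.time, h33, h52, Mem.setNat_nat,
        Mem.setReal_nat, Mem.setNat_real, Nat.reduceEqDiff, false_and, if_false]
      refine ⟨by simp, ⟨by simp, ?_, ?_, fun b hb1 hb2 => ?_⟩, ?_⟩
      · exact (((hF.setNat (by simp) _ _).setReal (by simp) _ _).setNat (by simp) _ _).setNat
          (by simp) _ _
      · simp only [shiftIdx]
        simp
        split_ifs <;> omega
      · rcases eq_or_ne b a with rfl | hne
        · simp [hF.nat 1 (by simp), hF.real 1 (by simp)]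
        -- Away from `s` the renumbering is injective, so nothing loaded earlier is overwritten.
        · have : shiftIdx s b ≠ shiftIdx s a := by
            simp only [shiftIdx]; split_ifs <;> omega
          simpa [this] using hb b (by omega) hb2
      · simp [Test.eqN, Test.time, NExp.time]
  · rintro τ t ⟨⟨_, hF, h33, hb⟩, ht⟩
    exact ⟨hF, h33, hb, by omega⟩

/-- The memory holds all agents and weights. -/
structure HoldsAgents (I : Instance n m k) (w : Fin k → ℝ) (τ : Mem) : Prop where
  count : τ.nat 0 2 = k
  pos : ∀ i : Fin k, τ.nat 1 i = I.pos i
  weight : ∀ i : Fin k, τ.real 1 i = w i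

theorem HoldsAgents.frame {I : Instance n m k} {w : Fin k → ℝ} {σ τ : Mem} {X Y : List ℕ}
    (h : HoldsAgents I w σ) (hF : Frame X Y σ τ) (hX : 0 ∉ X ∧ 1 ∉ X) (hY : 1 ∉ Y) :
    HoldsAgents I w τ where
  count := by rw [hF.nat 0 hX.1, h.count]
  pos i := by rw [hF.nat 1 hX.2, h.pos]
  weight i := by rw [hF.real 1 hY, h.weight]

theorem loadProg_remove {I : Instance n m (k + 1)} {w : Fin (k + 1) → ℝ} {σ : Mem}
    (h : Tabled I σ) (hA : HoldsAgents I w σ) (i : Fin (k + 1)) (hs : σ.nat 51 0 = i) :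
    Wp loadProg (fun τ t => Frame [11, 33, 52] [3] σ τ ∧
      Loaded (I.remove i) (fun a => w (i.succAbove a)) τ ∧ t ≤ (k + 1) * 100 + 20) σ := by
  refine (loadProg_spec hA.count hs).mono ?_
  rintro τ t ⟨hF, h33, hb, ht⟩
  -- Closing the gap at `i` undoes `Fin.succAbove i`.
  have key : ∀ a : Fin k, shiftIdx i (i.succAbove a) = a := by
    intro a
    rcases lt_or_ge a.castSucc i with hlt | hge
    · rw [Fin.succAbove_of_castSucc_lt _ _ hlt]
      have : (a : ℕ) < i := hlt
      simp only [shiftIdx, Fin.val_castSucc]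
      split_ifs <;> omega
    · rw [Fin.succAbove_of_le_castSucc _ _ hge]
      have : (i : ℕ) ≤ a := hge
      simp only [shiftIdx, Fin.val_succ]
      split_ifs <;> omega
  have hb' := fun a : Fin k => hb (i.succAbove a) (i.succAbove a).2
    (fun e => Fin.succAbove_ne i a (Fin.ext e))
  simp only [key] at hb'
  refine ⟨hF, ⟨(h.remove i).frame hF (by simp) (by simp), ?_, fun a => ?_, fun a => ?_⟩, ht⟩
  · rw [h33]
    have := i.2
    simp only [shiftIdx]
    split_ifs <;> omega
  · rw [(hb' a).1, hA.pos]; rfl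
  · rw [(hb' a).2, hA.weight]

/-- The index to be left out, `k + 1`, belongs to no agent. -/
theorem loadProg_full {I : Instance n m (k + 1)} {w : Fin (k + 1) → ℝ} {σ : Mem}
    (h : Tabled I σ) (hA : HoldsAgents I w σ) (hs : σ.nat 51 0 = k + 1) :
    Wp loadProg (fun τ t => Frame [11, 33, 52] [3] σ τ ∧
      Loaded I w τ ∧ t ≤ (k + 1) * 100 + 20) σ := by
  refine (loadProg_spec hA.count hs).mono ?_
  rintro τ t ⟨hF, h33, hb, ht⟩
  have hb' := fun a : Fin (k + 1) => hb a a.2 (by omega)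
  have key : ∀ a : Fin (k + 1), shiftIdx (k + 1) a = a := fun a => if_neg (by omega)
  simp only [key] at hb'
  refine ⟨hF, ⟨h.frame hF (by simp) (by simp), ?_, fun a => ?_, fun a => ?_⟩, ht⟩
  · rw [h33]
    exact if_neg (by omega)
  · rw [(hb' a).1, hA.pos]
  · rw [(hb' a).2, hA.weight]

/-- The instance `J` is whatever `loadProg` provides, so that the reduced instances and the full one
are covered alike. -/
theorem subProg_spec {J : Instance n m (k + 1)} {u : Fin (k + 1) → ℝ} {σ : Mem} {T : ℕ}
    (hload : Wp loadProg (fun τ t => Frame [11, 33, 52] [3] σ τ ∧ Loaded J u τ ∧ t ≤ T) σ) :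
    Wp subProg (fun τ t =>
      Frame [11, 20, 21, 32, 33, 34, 35, 36, 37, 38, 39, 50, 52] [3, 4, 5, 7] σ τ ∧
      Loaded J u τ ∧ Solved J u τ ∧
      τ.nat 32 0 = numStates n m (k + 1) ∧ τ.nat 35 0 = J.start.enc ∧
      τ.nat 37 0 = numStates n m (k + 1) * numStates n m (k + 1) ∧
      τ.real 5 (σ.nat 51 0) =
        τ.real 4 (numStates n m (k + 1) * numStates n m (k + 1) + J.start.enc) ∧
      (∀ i ≠ σ.nat 51 0, τ.real 5 i = σ.real 5 i) ∧
      t ≤ T + 2000 * (numStates n m (k + 1) + 1) ^ 3 + 20) σ := by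
  refine hload.seq ?_
  rintro τ1 t1 ⟨F1, L1, ht1⟩
  refine (solveProg_spec L1).seq ?_
  rintro τ2 t2 ⟨F2, S2, g32, g35, g37, ht2⟩
  refine .setR ?_
  have g51 : τ2.nat 51 0 = σ.nat 51 0 := by rw [F2.nat 51 (by simp), F1.nat 51 (by simp)]
  simp only [V, NExp.eval, NExp.time, RExp.eval, RExp.time, g37, g35, g51]
  have hR := (Frame.refl [] [5] τ2).setReal (List.mem_singleton_self 5) (σ.nat 51 0)
    (τ2.real 4 (numStates n m (k + 1) * numStates n m (k + 1) + J.start.enc))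
  refine ⟨((F1.mono (by simp) (by simp)).trans (F2.mono (by simp) (by simp))).trans
    (hR.mono (by simp) (by simp)), (L1.frame F2 (by simp) (by simp)).frame hR (by simp) (by simp),
    S2.congr (hR.same (by simp) (by simp)), ?_, ?_, ?_, ?_, fun i hi => ?_, ?_⟩
  · rw [hR.nat 32 (by simp), g32]
  · rw [hR.nat 35 (by simp), g35]
  · rw [hR.nat 37 (by simp), g37]
  · simp
  · simp [hi, F2.real 5 (by simp), F1.real 5 (by simp)]
  · omega

end Delivery

namespace Delivery

variable {n m k : ℕ}

/-! ### Output of the schedule -/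

/-- The memory holds the schedule. -/
structure Emitted (τ : Mem) (s : Schedule n m k) : Prop where
  length : τ.nat 5 0 = s.length
  code : ∀ (l : ℕ) (h : l < s.length), (τ.nat 6 l, τ.nat 7 l, τ.nat 8 l) = (s[l]).code

theorem Emitted.frame {σ τ : Mem} {s : Schedule n m k} {X Y : List ℕ} (h : Emitted σ s)
    (hF : Frame X Y σ τ) (hX : 5 ∉ X ∧ 6 ∉ X ∧ 7 ∉ X ∧ 8 ∉ X) : Emitted τ s where
  length := by rw [hF.nat 5 hX.1, h.length]
  code l hl := by
    rw [hF.nat 6 hX.2.1, hF.nat 7 hX.2.2.1, hF.nat 8 hX.2.2.2, h.code l hl]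

theorem emitProg_spec {σ : Mem} {s : Schedule n m k} (h : Emitted σ s) (a : Action n m k)
    (c e z : NExp)
    (hc : c.eval σ = a.code.1) (he : ∀ i v, e.eval (σ.setNat 6 i v) = a.code.2.1)
    (hz : ∀ i v i' v', z.eval ((σ.setNat 6 i v).setNat 7 i' v') = a.code.2.2)
    (tc : ∀ τ, c.time τ ≤ 10) (te : ∀ τ, e.time τ ≤ 10) (tz : ∀ τ, z.time τ ≤ 10) :
    Wp (emitProg c e z) (fun τ t => Frame [5, 6, 7, 8] [] σ τ ∧ Emitted τ (s ++ [a]) ∧ t ≤ 60) σ := by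
  refine .setN_seq (.setN_seq (.setN_seq (.setN ?_)))
  simp only [NExp.eval, NExp.time, Mem.setNat_nat, Nat.reduceEqDiff, false_and, if_false, hc, he, hz,
    h.length]
  refine ⟨?_, ⟨by simp, fun l hl => ?_⟩, ?_⟩
  · exact ((((Frame.refl _ _ σ).setNat (by simp) _ _).setNat (by simp) _ _).setNat
      (by simp) _ _).setNat (by simp) _ _
  · rw [List.length_append, List.length_singleton] at hl
    rcases Nat.lt_or_ge l s.length with hlt | hge
    · rw [List.getElem_append_left hlt, ← h.code l hlt]
      simp [hlt.ne]
    · obtain rfl : l = s.length := by omega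
      simp
  · have h1 := tc σ
    have h2 := te (σ.setNat 6 s.length a.code.1)
    have h3 := tz ((σ.setNat 6 s.length a.code.1).setNat 7 s.length a.code.2.1)
    omega

theorem actProg_spec {I : Instance n m k} {w : Fin k → ℝ} {σ : Mem} (hL : Loaded I w σ)
    {s : Schedule n m k} (h : Emitted σ s) {x y : TourState n m k} (h53 : σ.nat 53 0 = x.enc)
    (h55 : σ.nat 55 0 = y.enc) :
    Wp actProg (fun τ t => Frame [5, 6, 7, 8] [] σ τ ∧ Emitted τ (s ++ x.act y) ∧ t ≤ 150) σ := by
  have hx := hL.row x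
  have hy := hL.row y
  refine .cond (fun ha => .cond (fun hv => .cond (fun hc => .skip ?_) (fun hc =>
    .cond (fun hc' => ?_) (fun hc' => ?_))) (fun hv => ?_)) (fun ha => .skip ?_)
  · simp only [Test.holds_eqN, V, NExp.eval, h53, h55, hx.a, hy.a, hx.v, hy.v, hx.c, hy.c,
      Fin.val_inj] at ha hv hc
    refine ⟨Frame.refl _ _ _, ?_, by simp [Test.eqN, Test.time, NExp.time, V]⟩
    simpa [TourState.act, ha, hv, hc] using h
  · simp only [Test.holds_eqN, V, Test.Holds, NExp.eval, h53, h55, hx.a, hy.a, hx.v, hy.v, hx.c,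
      hy.c, Fin.val_inj] at ha hv hc hc'
    have hne : y.c ≠ 0 := by rintro e; simp [e] at hc'
    have e : x.act y = [.pick x.a (y.c.pred hne)] := by simp [TourState.act, ha, hv, hc, hne]
    rw [e]
    refine (emitProg_spec h (.pick x.a (y.c.pred hne)) _ _ _ ?_ ?_ ?_ ?_ ?_ ?_).mono ?_
    · simp [NExp.eval, Action.code]
    · simp [NExp.eval, Action.code, V, h53, hx.a]
    · simp [NExp.eval, Action.code, V, h55, hy.c]
    iterate 3 · simp [NExp.time, V]
    · rintro τ t ⟨h1, h2, h3⟩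
      refine ⟨h1, h2, ?_⟩
      simp only [Test.eqN, Test.time, NExp.time, V]
      omega
  · simp only [Test.holds_eqN, V, Test.Holds, NExp.eval, h53, h55, hx.a, hy.a, hx.v, hy.v, hx.c,
      hy.c, Fin.val_inj] at ha hv hc hc'
    have hy0 : y.c = 0 := Fin.ext (by simpa using hc')
    have hne : x.c ≠ 0 := fun e => hc (e.trans hy0.symm)
    have e : x.act y = [.drop x.a (x.c.pred hne)] := by
      simp [TourState.act, ha, hv, hy0, hne]
    rw [e]
    refine (emitProg_spec h (.drop x.a (x.c.pred hne)) _ _ _ ?_ ?_ ?_ ?_ ?_ ?_).mono ?_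
    · simp [NExp.eval, Action.code]
    · simp [NExp.eval, Action.code, V, h53, hx.a]
    · simp [NExp.eval, Action.code, V, h53, hx.c]
    iterate 3 · simp [NExp.time, V]
    · rintro τ t ⟨h1, h2, h3⟩
      refine ⟨h1, h2, ?_⟩
      simp only [Test.eqN, Test.time, NExp.time, V]
      omega
  · simp only [Test.holds_eqN, V, NExp.eval, h53, h55, hx.a, hy.a, hx.v, hy.v, Fin.val_inj] at ha hv
    have e : x.act y = [.move x.a y.v] := by simp [TourState.act, ha, hv]
    rw [e]
    refine (emitProg_spec h (.move x.a y.v) _ _ _ ?_ ?_ ?_ ?_ ?_ ?_).mono ?_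
    · simp [NExp.eval, Action.code]
    · simp [NExp.eval, Action.code, V, h53, hx.a]
    · simp [NExp.eval, Action.code, V, h55, hy.v]
    iterate 3 · simp [NExp.time, V]
    · rintro τ t ⟨h1, h2, h3⟩
      refine ⟨h1, h2, ?_⟩
      simp only [Test.eqN, Test.time, NExp.time, V]
      omega
  · simp only [Test.holds_eqN, V, NExp.eval, h53, h55, hx.a, hy.a, Fin.val_inj] at ha
    refine ⟨Frame.refl _ _ _, ?_, by simp [Test.eqN, Test.time, NExp.time, V]⟩
    simpa [TourState.act, ha] using h

/-- The output after the walk `l`. -/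
structure Extracted (I : Instance n m (k + 1)) (w : Fin (k + 1) → ℝ) (τ : Mem)
    (l : List (TourState n m (k + 1))) : Prop where
  emitted : Emitted τ (I.start.acts l)
  share : ∀ i : Fin (k + 1), τ.real 6 i = I.share w i I.start l

theorem extractBody_spec {I : Instance n m (k + 1)} {w : Fin (k + 1) → ℝ} {σ : Mem}
    (hL : Loaded I w σ) {b : ℕ} {x y : TourState n m (k + 1)}
    {l : List (TourState n m (k + 1))} (hw : I.IsWalk I.start l x) (hE : Extracted I w σ l)
    (h53 : σ.nat 53 0 = x.enc) (h37 : σ.nat 37 0 = b) (hy : σ.nat 21 (b + x.enc) = y.enc) :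
    Wp extractBody (fun τ t => Frame [5, 6, 7, 8, 37, 53, 55] [6, 7] σ τ ∧
      Extracted I w τ (l ++ [y]) ∧ τ.nat 53 0 = y.enc ∧ τ.nat 37 0 = b - σ.nat 32 0 ∧
      t ≤ 300) σ := by
  refine .setN_seq ?_
  simp only [V, NExp.eval, NExp.time, h37, h53, hy]
  have F1 : Frame [5, 6, 7, 8, 37, 53, 55] [6, 7] σ (σ.setNat 55 0 y.enc) :=
    (Frame.refl _ _ σ).setNat (by simp) _ _
  have L1 := hL.frame F1 (by simp) (by simp)
  refine (linkCostProg_spec L1 (a := 53) (a' := 55) (x := x) (y := y) (by simp [h53])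
    (by simp)).seq ?_
  rintro _ t1 ⟨rfl, ht1⟩
  refine .setR_seq ?_
  simp only [NExp.eval, NExp.time, RExp.eval, RExp.time, Mem.setNat_nat, Mem.setReal_nat,
    Nat.reduceEqDiff, false_and, if_false, h53, (hL.row x).a, Mem.setReal_real, Mem.setNat_real,
    true_and, if_true, hE.share]
  set τ2 := ((σ.setNat 55 0 y.enc).setReal 7 0 (I.linkCost w x y)).setReal 6 (x.a : ℕ)
    (I.share w x.a I.start l + I.linkCost w x y) with hτ2
  have F2 : Frame [5, 6, 7, 8, 37, 53, 55] [6, 7] σ τ2 :=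
    (F1.setReal (by simp) _ _).setReal (by simp) _ _
  -- A sharper frame than `F2`: the output arrays are still untouched.
  have F2' : Frame [55] [6, 7] σ τ2 :=
    (((Frame.refl _ _ σ).setNat (by simp) _ _).setReal (by simp) _ _).setReal (by simp) _ _
  have s2 : ∀ i : Fin (k + 1), τ2.real 6 i = I.share w i I.start (l ++ [y]) := by
    intro i
    rw [hw.share_append]
    rcases eq_or_ne i x.a with rfl | hne
    · simp [hτ2, Instance.share]
    · have : (i : ℕ) ≠ x.a := fun e => hne (Fin.ext e)
      simp [hτ2, this, hE.share, Instance.share, hne.symm]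
  have g53 : τ2.nat 53 0 = x.enc := by simp [hτ2, h53]
  have g55 : τ2.nat 55 0 = y.enc := by simp [hτ2]
  clear_value τ2
  refine (actProg_spec (hL.frame F2 (by simp) (by simp)) (hE.emitted.frame F2' (by simp))
    g53 g55).seq ?_
  rintro τ3 t3 ⟨F3, E3, ht3⟩
  have g55 : τ3.nat 55 0 = y.enc := by rw [F3.nat 55 (by simp), g55]
  have g37 : τ3.nat 37 0 = b := by rw [F3.nat 37 (by simp), F2'.nat 37 (by simp), h37]
  have g32 : τ3.nat 32 0 = σ.nat 32 0 := by rw [F3.nat 32 (by simp), F2.nat 32 (by simp)]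
  refine .setN_seq (.setN ?_)
  simp only [NExp.eval, NExp.time, Mem.setNat_nat, Nat.reduceEqDiff, false_and, if_false, g55,
    g37, g32]
  have F4 : Frame [37, 53] [] τ3 ((τ3.setNat 53 0 y.enc).setNat 37 0 (b - σ.nat 32 0)) :=
    ((Frame.refl _ _ τ3).setNat (by simp) _ _).setNat (by simp) _ _
  refine ⟨(F2.trans (F3.mono (by simp) (by simp))).trans (F4.mono (by simp) (by simp)), ⟨?_, ?_⟩,
    by simp, by simp, by omega⟩
  · rw [hw.acts_append]
    simp only [TourState.acts, List.append_nil]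
    exact E3.frame F4 (by simp)
  · intro i
    rw [F4.real 6 (by simp), F3.real 6 (by simp), s2]

/-- After `r` steps, the weight of the walk so far plus the distance stored in layer `N - r` equals
the optimum. In layer 0 only the goal is flagged, so the walk ends there and its weight is the
optimum. -/
theorem extractProg_spec {I : Instance n m (k + 1)} {w : Fin (k + 1) → ℝ} (hw : 0 ≤ w) {σ : Mem}
    (hL : Loaded I w σ) (hS : Solved I w σ) (h35 : σ.nat 35 0 = I.start.enc)
    (h32 : σ.nat 32 0 = numStates n m (k + 1))
    (h37 : σ.nat 37 0 = numStates n m (k + 1) * numStates n m (k + 1))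
    (h5 : σ.nat 5 0 = 0) (h6 : ∀ i, σ.real 6 i = 0) :
    Wp extractProg (fun τ t => Frame [5, 6, 7, 8, 37, 53, 54, 55] [6, 7] σ τ ∧
      (∃ l, I.IsWalk I.start l I.goal ∧ Extracted I w τ l ∧ I.walkCost w I.start l =
        σ.real 4 (numStates n m (k + 1) * numStates n m (k + 1) + I.start.enc)) ∧
      t ≤ numStates n m (k + 1) * 320 + 20) σ := by
  set N := numStates n m (k + 1) with hN
  refine .setN_seq ?_
  simp only [V, NExp.eval, NExp.time, h35]
  refine (Wp.forTo N 300 (fun r τ => τ.nat 54 0 = r ∧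
    Frame [5, 6, 7, 8, 37, 53, 54, 55] [6, 7] σ τ ∧ τ.nat 37 0 = (N - r) * N ∧
    ∃ l x, I.IsWalk I.start l x ∧ Extracted I w τ l ∧ τ.nat 53 0 = x.enc ∧
      σ.nat 20 ((N - r) * N + x.enc) = 1 ∧
      I.walkCost w I.start l + σ.real 4 ((N - r) * N + x.enc) =
        σ.real 4 (N * N + I.start.enc)) ?_ ?_ ?_ ?_).mono ?_
  · refine ⟨by simp, ((Frame.refl _ _ σ).setNat (by simp) _ _).setNat (by simp) _ _,
      by simp [h37], [], I.start, rfl, ⟨⟨?_, ?_⟩, ?_⟩, ?_, ?_, ?_⟩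
    · simp [h5, TourState.acts]
    · simp [TourState.acts]
    · simp [h6, Instance.share]
    · simp
    · simpa using (hS.start hw).1
    · simp [Instance.walkCost]
  · rintro i τ ⟨_, hF, _⟩
    rw [hF.nat 32 (by simp), h32]
  · rintro i τ ⟨h, _⟩; exact h
  · rintro r hr τ ⟨h54, hF, g37, l, x, hl, hE, g53, hf, hc⟩
    obtain ⟨d, hd⟩ : ∃ d, N - r = d + 1 := ⟨N - r - 1, by omega⟩
    have hd' : N - (r + 1) = d := by omega
    have e : (N - r) * N + x.enc = d * N + (N + x.enc) := by rw [hd]; ring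
    rw [e] at hf hc
    obtain ⟨y, h1, h2, h3, h4⟩ := (hS.layer d (by omega) x).attained hf
    rw [← hN] at h1 h3 h4
    refine (extractBody_spec (hL.frame hF (by simp) (by simp)) hl hE g53 g37 (y := y) ?_).mono ?_
    · rw [hF.nat 21 (by simp), e, h1]
    rintro ρ t ⟨F', E', k53, k37, ht⟩
    have hR : Frame [54] [] ρ (ρ.setNat 54 0 (r + 1)) := (Frame.refl _ _ ρ).setNat (by simp) _ _
    refine ⟨by rw [F'.nat 54 (by simp), h54], ⟨by simp, ?_, ?_, l ++ [y], y,
      hl.append ⟨h2, rfl⟩, ⟨E'.emitted.frame hR (by simp), fun i => ?_⟩, ?_, ?_, ?_⟩, ht⟩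
    · exact (hF.trans (F'.mono (by simp) (by simp))).trans (hR.mono (by simp) (by simp))
    · rw [hR.nat 37 (by simp), k37, hF.nat 32 (by simp), h32, hd, hd', Nat.add_mul, one_mul,
        Nat.add_sub_cancel]
    · rw [hR.real 6 (by simp), E'.share]
    · rw [hR.nat 53 (by simp), k53]
    · rw [hd', h3]
    · rw [hd', hl.walkCost_append, ← hc, h4]
      simp only [Instance.walkCost]
      ring
  · rintro τ t ⟨⟨_, hF, _, l, x, hl, hE, _, hf, hc⟩, ht⟩
    simp only [Nat.sub_self, zero_mul, zero_add] at hf hc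
    obtain rfl := (hS.base x).1 hf
    rw [hS.zero, add_zero] at hc
    exact ⟨hF, ⟨l, hl, hE, hc⟩, by omega⟩

/-- Index `K` of array 5 is meant for the full optimum; subtracting the share of an agent leaves the
cost of the others. -/
theorem payProg_spec {K : ℕ} {σ : Mem} (hK : σ.nat 0 2 = K) :
    Wp payProg (fun τ t => Frame [56] [2] σ τ ∧
      (∀ i < K, τ.real 2 i = σ.real 5 i - (σ.real 5 K - σ.real 6 i)) ∧ t ≤ K * 40 + 20) σ := by
  refine (Wp.forTo K 20 (fun a τ => τ.nat 56 0 = a ∧ Frame [56] [2] σ τ ∧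
    (∀ i < a, τ.real 2 i = σ.real 5 i - (σ.real 5 K - σ.real 6 i))) ?_ ?_ ?_ ?_).mono ?_
  · exact ⟨by simp, (Frame.refl _ _ σ).setNat (by simp) _ _, by simp⟩
  · rintro i τ ⟨_, hF, _⟩
    rw [hF.nat 0 (by simp), hK]
  · rintro i τ ⟨h, _⟩; exact h
  · rintro a ha τ ⟨h56, hF, hp⟩
    refine .setR ?_
    have g0 : τ.nat 0 2 = K := by rw [hF.nat 0 (by simp), hK]
    simp only [V, NExp.eval, NExp.time, RExp.eval, RExp.time, h56, g0, hF.real 5 (by simp),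
      hF.real 6 (by simp)]
    refine ⟨by simp [h56], ⟨by simp, (hF.setReal (by simp) _ _).setNat (by simp) _ _,
      fun i hi => ?_⟩, by omega⟩
    rcases eq_or_ne i a with rfl | hne
    · simp
    · simp [hne, hp i (by omega)]
  · rintro τ t ⟨⟨_, hF, hp⟩, ht⟩
    exact ⟨hF, hp, by omega⟩

/-! ### The whole program -/

theorem input_holds (I : Instance n m k) (w : Fin k → ℝ) : Holds I (input I w) := by
  have key : ∀ u v : Fin n, ∃ h : (u : ℕ) * n + v < n * n,
      Fin.divNat ⟨(u : ℕ) * n + v, h⟩ = u ∧ Fin.modNat ⟨(u : ℕ) * n + v, h⟩ = v := by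
    intro u v
    refine ⟨TourState.mul_add_lt u.2 v.2, Fin.ext ?_, Fin.ext ?_⟩
    · exact (TourState.mul_add_div_mod v.2).1
    · exact (TourState.mul_add_div_mod v.2).2
  refine ⟨by simp [input], by simp [input], by simp [input], by simp [input], fun u v => ?_,
    fun u v => ?_⟩
  · obtain ⟨h1, h2, h3⟩ := key u v
    have e : I.G.Adj (Fin.divNat ⟨(u : ℕ) * n + v, h1⟩) (Fin.modNat ⟨(u : ℕ) * n + v, h1⟩) ↔
        I.G.Adj u v := by rw [h2, h3]
    by_cases hadj : I.G.Adj u v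
    · simp only [input, dif_pos h1, if_pos hadj, if_pos (e.2 hadj)]
    · simp only [input, dif_pos h1, if_neg hadj, if_neg (fun g => hadj (e.1 g))]
  · obtain ⟨h1, h2, h3⟩ := key u v
    have e : I.G.Adj (Fin.divNat ⟨(u : ℕ) * n + v, h1⟩) (Fin.modNat ⟨(u : ℕ) * n + v, h1⟩) ↔
        I.G.Adj u v := by rw [h2, h3]
    by_cases hadj : I.G.Adj u v
    · simp only [input, dif_pos h1, if_pos hadj, if_pos (e.2 hadj), h2, h3]
    · simp only [input, dif_pos h1, if_neg hadj, if_neg (fun g => hadj (e.1 g))]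

theorem input_holdsAgents (I : Instance n m k) (w : Fin k → ℝ) : HoldsAgents I w (input I w) :=
  ⟨by simp [input], by simp [input], by simp [input]⟩

theorem numStates_mono {k k' : ℕ} (h : k ≤ k') : numStates n m k ≤ numStates n m k' :=
  Nat.mul_le_mul_right _ h

/-- The program outputs an optimal solution and the VCG payments. -/
theorem mainProg_spec (I : Instance n m (k + 2)) {w : Fin (k + 2) → ℝ} (hw : 0 ≤ w) :
    Wp mainProg (fun τ t => (∃ x ∈ I.RnoCStar, (∀ y ∈ I.RnoCStar, I.cost x w ≤ I.cost y w) ∧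
      Emitted τ x ∧ ∀ i, ∃ z ∈ (I.remove i).RnoCStar,
        (∀ y ∈ (I.remove i).RnoCStar, (I.remove i).cost z (fun a => w (i.succAbove a)) ≤
          (I.remove i).cost y (fun a => w (i.succAbove a))) ∧
        τ.real 2 i = (I.remove i).cost z (fun a => w (i.succAbove a)) -
          (I.cost x w - w i * I.travel i x)) ∧
      t ≤ 10000 * (numStates n m (k + 2) + 1) ^ 4) (input I w) := by
  set σ := input I w with hσ
  have H0 : Holds I σ := input_holds I w
  have A0 : HoldsAgents I w σ := input_holdsAgents I w
  have z5 : σ.nat 5 0 = 0 := rfl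
  have z6 : ∀ i, σ.real 6 i = 0 := fun i => rfl
  clear_value σ
  have hn : 0 < n := (I.pos 0).pos
  obtain ⟨b1, -, -, -, b5, -⟩ := numStates_bounds (m := m) (k := k + 2) hn (by omega)
  set N := numStates n m (k + 2) with hN
  refine (powProg_spec m σ H0.packages).seq ?_
  rintro τ1 t1 ⟨F1, P1, ht1⟩
  have H1 := H0.frame F1 (by simp) (by simp)
  have A1 := A0.frame F1 (by simp) (by simp)
  refine .setN_seq ?_
  simp only [NExp.eval, NExp.time, A1.count]
  refine (sizeProg_spec n m (k + 2) _ (by omega) hn (by simp [H1.nodes]) (by simp [H1.packages])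
    (by simp) (by simp [P1])).seq ?_
  rintro _ t2 ⟨rfl, ht2⟩
  set τ2 := (τ1.setNat 33 0 (k + 2)).setNat 32 0 (numStates n m (k + 2)) with hτ2
  have F2 : Frame [32, 33] [] τ1 τ2 :=
    ((Frame.refl _ _ _).setNat (by simp) _ _).setNat (by simp) _ _
  have g32 : τ2.nat 32 0 = N := by simp [hτ2, hN]
  clear_value τ2
  have H2 := H1.frame F2 (by simp) (by simp)
  have A2 := A1.frame F2 (by simp) (by simp)
  refine (decodeProg_spec I τ2 H2 (fun j hj => by rw [F2.nat 10 (by simp), P1 j hj]) g32).seq ?_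
  rintro τ3 t3 ⟨F3, T3, ht3⟩
  have A3 := A2.frame F3 (by simp) (by simp)
  have y5 : τ3.nat 5 0 = 0 := by
    rw [F3.nat 5 (by simp), F2.nat 5 (by simp), F1.nat 5 (by simp), z5]
  have y6 : ∀ i, τ3.real 6 i = 0 := fun i => by
    rw [F3.real 6 (by simp), F2.real 6 (by simp), F1.real 6 (by simp), z6]
  refine (Wp.forTo (k + 2) ((k + 2) * 100 + 20 + 2000 * (N + 1) ^ 3 + 20) (fun r τ =>
    τ.nat 51 0 = r ∧
    Frame [11, 20, 21, 32, 33, 34, 35, 36, 37, 38, 39, 50, 51, 52] [3, 4, 5, 7] τ3 τ ∧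
    ∀ i : Fin (k + 2), (i : ℕ) < r → ∃ z ∈ (I.remove i).RnoCStar,
        (∀ y ∈ (I.remove i).RnoCStar, (I.remove i).cost z (fun a => w (i.succAbove a)) ≤
          (I.remove i).cost y (fun a => w (i.succAbove a))) ∧
        (I.remove i).cost z (fun a => w (i.succAbove a)) = τ.real 5 i) ?_ ?_ ?_ ?_).seq ?_
  · exact ⟨by simp, (Frame.refl _ _ _).setNat (by simp) _ _, by simp⟩
  · rintro i τ ⟨_, hF, _⟩
    rw [hF.nat 0 (by simp), A3.count]
  · rintro i τ ⟨h, _⟩; exact h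
  · rintro r hr τ ⟨h51, hF, hz⟩
    refine (subProg_spec (loadProg_remove (T3.frame hF (by simp) (by simp))
      (A3.frame hF (by simp) (by simp)) ⟨r, hr⟩ h51)).mono ?_
    rintro ρ t ⟨F', -, S', -, -, -, e1, e2, ht⟩
    refine ⟨by rw [F'.nat 51 (by simp), h51], ⟨by simp, ?_, fun i hi => ?_⟩, ht.trans ?_⟩
    · exact (hF.trans (F'.mono (by simp) (by simp))).setNat (by simp) _ _
    · simp only [Mem.setNat_real]
      rcases Nat.lt_or_ge i r with hlt | hge
      · rw [e2 i (by omega)]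
        exact hz i hlt
      · obtain rfl : i = ⟨r, hr⟩ := Fin.ext (by simp; omega)
        obtain ⟨z, hz1, hz2, hz3⟩ := S'.exists_optimal (w := fun a => w (Fin.succAbove ⟨r, hr⟩ a))
          (fun a => hw _)
        rw [h51] at e1
        exact ⟨z, hz1, hz2, hz3.trans e1.symm⟩
    -- The time bound for the full instance also covers the smaller ones.
    · have : numStates n m (k + 1) + 1 ≤ N + 1 := Nat.succ_le_succ (numStates_mono (by omega))
      gcongr
  rintro τ4 t4 ⟨⟨h51, F4, hz⟩, ht4⟩
  have T4 := T3.frame F4 (by simp) (by simp)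
  have A4 := A3.frame F4 (by simp) (by simp)
  refine (subProg_spec (loadProg_full T4 A4 h51)).seq ?_
  rintro τ5 t5 ⟨F5, L5, S5, g32, g35, g37, e1, e2, ht5⟩
  rw [h51] at e1 e2
  refine (extractProg_spec hw L5 S5 g35 g32 g37
    (by rw [F5.nat 5 (by simp), F4.nat 5 (by simp), y5])
    (fun i => by rw [F5.real 6 (by simp), F4.real 6 (by simp), y6])).seq ?_
  rintro τ6 t6 ⟨F6, ⟨l, hl, hE, hc⟩, ht6⟩
  refine (payProg_spec (K := k + 2) (by rw [F6.nat 0 (by simp), F5.nat 0 (by simp), A4.count])).mono ?_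
  rintro τ7 t7 ⟨F7, hpay, ht7⟩
  obtain ⟨o1, o2⟩ := hl.optimal hw fun l' g g' => by
    rw [hc]; exact (S5.start hw).2 l' g g'
  refine ⟨⟨I.start.acts l, o1, o2, hE.emitted.frame F7 (by simp), fun i => ?_⟩, ?_⟩
  · obtain ⟨z, hz1, hz2, hz3⟩ := hz i i.2
    refine ⟨z, hz1, hz2, ?_⟩
    -- The accumulated share of an agent is its weighted travel distance, by
    -- `IsWalk.weighted_travel`.
    rw [hpay i i.2, hE.share, F6.real 5 (by simp), F6.real 5 (by simp), e1, e2 i (by omega), ← hz3,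
      hl.weighted_travel, hl.cost_eq, hc]
  · rw [← hN] at ht2 ht3 ht5 ht6
    have hN1 : 1 ≤ N + 1 := by omega
    set B := N + 1 with hB
    -- The number of agents is at most the number of states, so the loop over cubic solves costs at
    -- most a quartic term.
    have c0 : (k + 2) * ((k + 2) * 100 + 20 + 2000 * B ^ 3 + 20 + 14) ≤
        B * (B * 100 + 54 + 2000 * B ^ 3) := Nat.mul_le_mul (by omega) (by omega)
    have c1 : B * (B * 100 + 54 + 2000 * B ^ 3) = 100 * B ^ 2 + 54 * B + 2000 * B ^ 4 := by ring
    have c2 : B ≤ B ^ 2 := Nat.le_self_pow (by norm_num) B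
    have c3 : B ^ 2 ≤ B ^ 4 := Nat.pow_le_pow_right hN1 (by norm_num)
    have c4 : B ^ 3 ≤ B ^ 4 := Nat.pow_le_pow_right hN1 (by norm_num)
    omega

end Delivery

namespace Delivery

variable {n m k : ℕ}

/-! ### The algorithm and its running time -/

/-- A schedule that, for the instance and the reported weights, is optimal and is output by the
program together with the VCG payments within the time bound. -/
def IsProgOutput (I : Instance n m (k + 2)) (w : Fin (k + 2) → ℝ) (x : Schedule n m (k + 2)) :
    Prop :=
  (x ∈ I.RnoCStar ∧ ∀ y ∈ I.RnoCStar, I.cost x w ≤ I.cost y w) ∧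
  ∃ τ t, Exec mainProg (input I w) τ t ∧ Emitted τ x ∧
    (∀ i, ∃ z ∈ (I.remove i).RnoCStar,
      (∀ y ∈ (I.remove i).RnoCStar, (I.remove i).cost z (fun a => w (i.succAbove a)) ≤
        (I.remove i).cost y (fun a => w (i.succAbove a))) ∧
      τ.real 2 i = (I.remove i).cost z (fun a => w (i.succAbove a)) -
        (I.cost x w - w i * I.travel i x)) ∧
    t ≤ 10000 * (numStates n m (k + 2) + 1) ^ 4

/-- Choosing the algorithm's value among such schedules makes it agree with the program without
fixing a rule for ties. -/
theorem exists_isProgOutput (I : Instance n m (k + 2)) {w : Fin (k + 2) → ℝ} (hw : 0 ≤ w) :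
    ∃ x, IsProgOutput I w x := by
  obtain ⟨τ, t, h1, ⟨x, h2, h3, h4, h5⟩, h6⟩ := mainProg_spec I hw
  exact ⟨x, ⟨h2, h3⟩, τ, t, h1, h4, h5, h6⟩

open Classical in
/-- The algorithm: the output of the program if there are at least two agents, and any optimal
solution if there is only one. -/
noncomputable def optAlgorithm : Algorithm := fun _ _ k =>
  match k with
  | 0 => fun _ _ => []
  | 1 => fun I w => if hw : 0 ≤ w then (I.exists_optimal hw).choose else []
  | _ + 2 => fun I w => if hw : 0 ≤ w then (exists_isProgOutput I hw).choose else []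

theorem optAlgorithm_spec (I : Instance n m (k + 2)) {w : Fin (k + 2) → ℝ} (hw : 0 ≤ w) :
    IsProgOutput I w (optAlgorithm I w) := by
  simp only [optAlgorithm, dif_pos hw]
  exact (exists_isProgOutput I hw).choose_spec

theorem optAlgorithm_minimizes : optAlgorithm.MinimizesOverRnoCStar := by
  intro n m k hk I w hw
  match k with
  | 0 => omega
  | 1 =>
    simp only [optAlgorithm, dif_pos hw]
    exact (I.exists_optimal hw).choose_spec
  | k + 2 => exact (optAlgorithm_spec I hw).1

theorem time_isBigO :
    (fun m : ℕ => 160000 * ((16 : ℝ) ^ m * ((m : ℝ) + 1) ^ 4)) =O[Filter.atTop] fun m : ℕ =>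
      Real.exp (2 * Real.sqrt m - m) * (m : ℝ) ^ m *
        (((((Polynomial.X + 1) ^ 4 : Polynomial ℕ).eval m : ℕ)) : ℝ) := by
  -- The threshold is 64 = 16·4, with 4 in place of e; the factor `exp (2 * √m)` is only used as
  -- being at least 1.
  refine Asymptotics.IsBigO.of_bound 160000 (Filter.eventually_atTop.2 ⟨64, fun m hm => ?_⟩)
  have hm' : (64 : ℝ) ≤ m := by exact_mod_cast hm
  have e1 : (16 : ℝ) ^ m ≤ Real.exp (2 * Real.sqrt m - m) * (m : ℝ) ^ m := by
    have h1 : Real.exp m ≤ 4 ^ m := by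
      have : Real.exp m = Real.exp 1 ^ m := by rw [← Real.exp_nat_mul, mul_one]
      rw [this]
      have := Real.exp_one_lt_d9
      gcongr
      linarith
    have h2 : (16 : ℝ) ^ m * 4 ^ m ≤ (m : ℝ) ^ m := by
      rw [← mul_pow]
      gcongr
      linarith
    have h3 : (1 : ℝ) ≤ Real.exp (2 * Real.sqrt m) := Real.one_le_exp (by positivity)
    rw [Real.exp_sub, div_mul_eq_mul_div, le_div_iff₀ (Real.exp_pos _)]
    calc (16 : ℝ) ^ m * Real.exp m ≤ 16 ^ m * 4 ^ m := by gcongr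
      _ ≤ (m : ℝ) ^ m := h2
      _ ≤ Real.exp (2 * Real.sqrt m) * (m : ℝ) ^ m := le_mul_of_one_le_left (by positivity) h3
  have e2 : (((((Polynomial.X + 1) ^ 4 : Polynomial ℕ).eval m : ℕ)) : ℝ) = ((m : ℝ) + 1) ^ 4 := by
    simp
  rw [e2, Real.norm_of_nonneg (by positivity), Real.norm_of_nonneg (by positivity)]
  gcongr

/-- There is at least one state, so N + 1 ≤ 2N, which turns 10000 into 160000; the fourth power of N
then splits into a factor in `m` and one in `n` and `k`. -/
theorem time_le (hn : 0 < n) (hk : 0 < k) {t : ℕ} (ht : t ≤ 10000 * (numStates n m k + 1) ^ 4) :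
    (t : ℝ) ≤ 160000 * ((16 : ℝ) ^ m * ((m : ℝ) + 1) ^ 4) * (((n : ℝ) * k) ^ 4) := by
  have h1 := (numStates_bounds (m := m) hn hk).1
  have h2 : t ≤ 10000 * (2 * numStates n m k) ^ 4 := ht.trans (by gcongr; omega)
  have h3 : (16 : ℝ) ^ m = (2 ^ m) ^ 4 := by rw [← pow_mul, mul_comm, pow_mul]; norm_num
  calc (t : ℝ) ≤ ((10000 * (2 * numStates n m k) ^ 4 : ℕ) : ℝ) := by exact_mod_cast h2
    _ = _ := by
      rw [h3, numStates]
      push_cast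
      ring

end Delivery

/-! ### The main theorem -/

theorem mainTheorem3 :
    ∃ A : Delivery.Algorithm,
      A.MinimizesOverRnoCStar ∧
      (∀ (n m k : ℕ), 1 ≤ k → ∀ I : Delivery.Instance n m (k + 1),
        (A.vcg I).Truthful I ∧ (A.vcg I).VoluntaryParticipation I) ∧
      ∃ (prog : Delivery.Prog) (f : ℕ → ℝ) (p : Polynomial ℕ) (q : MvPolynomial (Fin 2) ℕ),
        (f =O[Filter.atTop] fun m : ℕ =>
          Real.exp (2 * Real.sqrt m - m) * (m : ℝ) ^ m * ((p.eval m : ℕ) : ℝ)) ∧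
        ∀ (n m k : ℕ), 1 ≤ k → ∀ (I : Delivery.Instance n m (k + 1)) (w : Fin (k + 1) → ℝ), 0 ≤ w →
          ∃ (τ : Delivery.Mem) (t : ℕ),
            Delivery.Exec prog (Delivery.input I w) τ t ∧
            Delivery.IsOutput τ ((A.vcg I).alg w) ((A.vcg I).pay w) ∧
            (t : ℝ) ≤ f m * ((MvPolynomial.eval ![n, k + 1] q : ℕ) : ℝ) := by
  refine ⟨Delivery.optAlgorithm, Delivery.optAlgorithm_minimizes, fun n m k hk I =>
    ⟨Delivery.optAlgorithm_minimizes.truthful I,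
      Delivery.optAlgorithm_minimizes.voluntaryParticipation hk I⟩,
    Delivery.mainProg, fun m => 160000 * ((16 : ℝ) ^ m * ((m : ℝ) + 1) ^ 4),
    (Polynomial.X + 1) ^ 4, (MvPolynomial.X 0 * MvPolynomial.X 1) ^ 4, Delivery.time_isBigO,
    fun n m k hk I w hw => ?_⟩
  obtain ⟨k, rfl⟩ : ∃ k', k = k' + 1 := ⟨k - 1, by omega⟩
  obtain ⟨-, τ, t, h1, h2, h3, h4⟩ := Delivery.optAlgorithm_spec I hw
  refine ⟨τ, t, h1, ⟨h2.length, h2.code, fun i => ?_⟩, ?_⟩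
  · obtain ⟨z, hz, hmin, hpay⟩ := h3 i
    -- The reduced solution behind the program's payment may differ from the algorithm's own, but
    -- both are optimal and hence have equal cost.
    have hA := Delivery.optAlgorithm_minimizes (Nat.succ_pos k) (I.remove i)
      (fun a => w (i.succAbove a)) (fun a => hw _)
    rw [hpay, le_antisymm (hmin _ hA.1) (hA.2 _ hz),
      Delivery.Algorithm.cost_eq_add_sum_erase _ _ _ i, add_sub_cancel_left]
    rfl
  · have := Delivery.time_le (I.pos 0).pos (Nat.succ_pos (k + 1)) h4
    simpa using this
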